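/- **Setting.** A *set-system* is a pair $M=(E,\mathcal I)$ where $E$ is a finite set and $\mathcal I$ is a collection of subsets of $E$. We say that $M$ *is a matroid* if $\mathcal I$ is the family of independent sets of a matroid on the ground set $E$. *Monadic second-order formulas ($\mathit{MS}_0$).* There are countably many variables. The atomic formulas are $\mathrm{Ind}[X]$ and $X\subseteq X'$, in which all variables are free. If $\varphi$ is a formula then so is $\neg\varphi$, with the same free and bound variables; if $X$ is a free variable of $\varphi$ then $\exists X\,\varphi$ is a formula, in which $X$ is bound instead of free; and if no variable is free in one of $\varphi_1,\varphi_2$ and bound in the other, then $\varphi_1\wedge\varphi_2$ is a formula, whose free (bound) variables are those that are free (bound) in $\varphi_1$ or in $\varphi_2$. Given a set-system $M=(E,\mathcal I)$ and an interpretation $\theta$ of the free variables by subsets of $E$, satisfaction is defined recursively: $\mathrm{Ind}[X]$ holds iff $\theta(X)\in\mathcal I$; $X\subseteq X'$ holds iff $\theta(X)\subseteq\theta(X')$; $\neg$ and $\wedge$ have their usual meaning; and $\exists X$ ranges over all subsets of $E$. The notation $\varphi[X]$ means that $X$ is the only free variable of $\varphi$, and $(M,X\mapsto L)$ denotes $M$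 together with the interpretation that takes $X$ to $L$. *Matroids and graphs.* A matroid $M$ on $E$ with rank function $r$ is *$3$-connected* if there are no $k\in\{1,2\}$ and $A\subseteq E$ such that $|A|\ge k$, $|E-A|\ge k$ and $r(A)+r(E-A)-r(M)<k$. Graphs are finite and may have loops and parallel edges. A *bicycle* of a graph $G$ is a minimal set $X$ of edges such that the subgraph $G[X]$ formed by the edges in $X$ and their ends is connected and contains more than one cycle (a loop is a cycle, and so is a pair of parallel non-loop edges). $B(G)$ is the matroid whose ground set is the edge-set of $G$ and whose circuits are exactly the bicycles of $G$. A *rooted matroid* is a pair $(M,L)$ of a matroid $M$ and a set $L$ of its elements. It is *bicircular* if there is a graph $G$ such that $M=B(G)$ and every element of $L$ is a loop of $G$; it is *$3$-connected* if $M$ is. **Theorem.** There is an $\mathit{MS}_0$ formula $\mathrm{BicircularLoops}[X]$ such that, whenever $M=(E,\mathcal I)$ is a set-system and $L\subseteq E$ is a subset, $(M,X\mapsto L)$ satisfies $\mathrm{BicircularLoops}$ if and only if $M$ is a matroid and $(M,L)$ is a $3$-connected rooted bicircular matroid. -/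

import Mathlib

/-! ### Monadic second-order logic for set-systems -/

/-- A set-system: a finite ground set `E` with a collection `indep` of subsets of `E`. -/
structure SetSystem (α : Type*) where
  /-- the ground set -/
  E : Set α
  /-- the distinguished family of subsets -/
  indep : Set (Set α)
  finite_E : E.Finite
  subset_E : ∀ I ∈ indep, I ⊆ E

namespace MS0

/-- Raw monadic second-order expressions; the variables are the natural numbers. Those obeying the
formation rules are singled out by `Expr.IsFormula`. -/
inductive Expr where
  /-- the atomic expression `Ind[X]` -/
  | ind (x : ℕ) : Expr
  /-- the atomic expression `X ⊆ X'` -/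
  | sub (x y : ℕ) : Expr
  /-- negation -/
  | neg (φ : Expr) : Expr
  /-- conjunction -/
  | conj (φ ψ : Expr) : Expr
  /-- the existential quantifier `∃ X φ` -/
  | ex (x : ℕ) (φ : Expr) : Expr

namespace Expr

/-- The free variables. -/
def free : Expr → Finset ℕ
  | ind x => {x}
  | sub x y => {x, y}
  | neg φ => φ.free
  | conj φ ψ => φ.free ∪ ψ.free
  | ex x φ => φ.free.erase x

/-- The bound variables. -/
def bound : Expr → Finset ℕ
  | ind _ => ∅
  | sub _ _ => ∅
  | neg φ => φ.bound
  | conj φ ψ => φ.bound ∪ ψ.bound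
  | ex x φ => insert x φ.bound

/-- The formation rules of `MS₀`: only free variables may be quantified, and in a conjunction no
variable is free in one conjunct while bound in the other. -/
def IsFormula : Expr → Prop
  | ind _ => True
  | sub _ _ => True
  | neg φ => φ.IsFormula
  | conj φ ψ => φ.IsFormula ∧ ψ.IsFormula ∧ Disjoint φ.free ψ.bound ∧ Disjoint φ.bound ψ.free
  | ex x φ => φ.IsFormula ∧ x ∈ φ.free

end Expr

/-- `(M, θ)` satisfies `φ`. Here `θ` assigns a set to every variable, but only its values at the free
variables of `φ` matter (see `sat_congr`). Quantifiers range over the subsets of the ground set. -/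
def Sat {α : Type*} (M : SetSystem α) : Expr → (ℕ → Set α) → Prop
  | .ind x, θ => θ x ∈ M.indep
  | .sub x y, θ => θ x ⊆ θ y
  | .neg φ, θ => ¬ Sat M φ θ
  | .conj φ ψ, θ => Sat M φ θ ∧ Sat M ψ θ
  | .ex x φ, θ => ∃ Y : Set α, Y ⊆ M.E ∧ Sat M φ (Function.update θ x Y)

theorem sat_congr {α : Type*} (M : SetSystem α) (φ : Expr) (θ θ' : ℕ → Set α)
    (h : ∀ x ∈ φ.free, θ x = θ' x) : Sat M φ θ ↔ Sat M φ θ' := by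
  induction φ generalizing θ θ' with
  | ind x => simp only [Sat, h x (by simp [Expr.free])]
  | sub x y => simp only [Sat, h x (by simp [Expr.free]), h y (by simp [Expr.free])]
  | neg φ ih => simp only [Sat, ih θ θ' h]
  | conj φ ψ ih₁ ih₂ =>
    simp only [Sat, ih₁ θ θ' fun x hx => h x (by simp [Expr.free, hx]),
      ih₂ θ θ' fun x hx => h x (by simp [Expr.free, hx])]
  | ex x φ ih =>
    refine exists_congr fun Y => and_congr_right fun _ => ih _ _ fun y hy => ?_
    by_cases hyx : y = x
    · subst hyx; simp
    · simpa [hyx] using h y (by simp [Expr.free, hyx, hy])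

/-- `(M, X ↦ Y)` satisfies `φ`, for a formula `φ` whose only free variable is `X`. -/
def SatAt {α : Type*} (M : SetSystem α) (φ : Expr) (X : ℕ) (Y : Set α) : Prop :=
  Sat M φ (Function.update (fun _ => ∅) X Y)

end MS0

/-! ### Cycles and bicycles of a multigraph (vertex type `β`, edge type `α`) -/

namespace Graph

/-- `V(X)`: the vertices incident with at least one edge in `X`. -/
def vertsOf {α β : Type*} (G : Graph β α) (X : Set α) : Set β :=
  {v | ∃ e ∈ X, G.Inc e v}

/-- `X` is a non-empty set of edges of `G`, and the subgraph `G[X]` with edge-set `X` and vertex-set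
`V(X)` is connected. -/
def ConnectedOn {α β : Type*} (G : Graph β α) (X : Set α) : Prop :=
  X ⊆ G.edgeSet ∧ X.Nonempty ∧ ∀ u ∈ G.vertsOf X, ∀ v ∈ G.vertsOf X,
    Relation.ReflTransGen (fun a b => ∃ e ∈ X, G.IsLink e a b) u v

/-- The degree of `v` in `G[X]`; a loop counts twice. -/
noncomputable def degreeOn {α β : Type*} (G : Graph β α) (X : Set α) (v : β) : ℕ∞ :=
  {e ∈ X | G.Inc e v}.encard + {e ∈ X | G.IsLoopAt e v}.encard

/-- `C` is the edge-set of a cycle of `G`: a connected subgraph in which every vertex has degree two.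
A loop is a cycle, and so is a pair of parallel non-loop edges. -/
def IsCycle {α β : Type*} (G : Graph β α) (C : Set α) : Prop :=
  G.ConnectedOn C ∧ C.Finite ∧ ∀ v ∈ G.vertsOf C, G.degreeOn C v = 2

/-- A bicycle: a minimal set `X` of edges such that `G[X]` is connected and contains more than one
cycle. -/
def IsBicycle {α β : Type*} (G : Graph β α) (X : Set α) : Prop :=
  Minimal (fun X => G.ConnectedOn X ∧
    ∃ C₁ C₂, C₁ ⊆ X ∧ C₂ ⊆ X ∧ C₁ ≠ C₂ ∧ G.IsCycle C₁ ∧ G.IsCycle C₂) X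

end Graph

/-! ### Connectivity of matroids, bicircular matroids -/

namespace Matroid

/-- `(A, E - A)` is a `k`-separation: both sides have at least `k` elements and
`r(A) + r(E - A) - r(M) < k`. Used for matroids on finite ground sets, whose ranks are finite. -/
def IsSeparation {α : Type*} (M : Matroid α) (k : ℕ) (A : Set α) : Prop :=
  A ⊆ M.E ∧ (k : ℕ∞) ≤ A.encard ∧ (k : ℕ∞) ≤ (M.E \ A).encard ∧
    M.eRk A + M.eRk (M.E \ A) < M.eRank + k

/-- `M` is `n`-connected: it has no `k`-separation with `k < n`. -/
def IsNConnected {α : Type*} (M : Matroid α) (n : ℕ) : Prop :=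
  ∀ k, 0 < k → k < n → ∀ A, ¬ M.IsSeparation k A

/-- `M = B(G)`: the ground set of `M` is the edge-set of `G`, and the circuits of `M` are precisely the
bicycles of `G`. (A matroid is determined by its ground set and its circuits.) -/
def IsBicircularOf {α β : Type*} (M : Matroid α) (G : Graph β α) : Prop :=
  M.E = G.edgeSet ∧ ∀ C, M.IsCircuit C ↔ G.IsBicycle C

/-- The rooted matroid `(M, L)` is bicircular: `M = B(G)` for a graph `G`, with finitely many vertices,
in which every element of `L` is a loop. Finite graphs may be relabelled, so it makes no difference in
which type the vertices are taken. -/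
def IsRootedBicircular {α : Type*} (M : Matroid α) (L : Set α) : Prop :=
  ∃ (β : Type) (G : Graph β α), G.vertexSet.Finite ∧ M.IsBicircularOf G ∧
    ∀ e ∈ L, ∃ v, G.IsLoopAt e v

end Matroid

namespace SetSystem

/-- The set-system `M` is the matroid `N`: same ground set, and the members of the family are the
independent sets of `N`. -/
def IsMatroid {α : Type*} (M : SetSystem α) (N : Matroid α) : Prop :=
  N.E = M.E ∧ ∀ I, N.Indep I ↔ I ∈ M.indep

/-- `(M, L)` is a `3`-connected rooted bicircular matroid. -/
def IsThreeConnectedRootedBicircular {α : Type*} (M : SetSystem α) (L : Set α) : Prop :=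
  ∃ N : Matroid α, M.IsMatroid N ∧ N.IsNConnected 3 ∧ N.IsRootedBicircular L

end SetSystem

/-! Soundness is cheap. The formula guesses a bounded number of sets, builds from them an incidence
relation between elements and sets, and checks (`Represents`) that every element has one or two
ends, that the elements of `L` have only one, and that independence is that of the bicircular
matroid of the resulting multigraph. A set of edges is dependent exactly when it contains a subgraph
with all degrees at least two and some degree at least three (`not_sparse_iff_exists_denseCore`),
which needs no counting of vertices. Whatever was guessed, passing this check yields a graph
(`Represents.exists_endGraph`). The matroid axioms and 3-connectedness are likewise stated through
independent sets.

The substance is completeness: for a 3-connected `B(G)` some guess must succeed, although the number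
of vertices is unbounded. With at most four vertices, arbitrary names and the stars of the vertices
are guessed outright. With at least five, 3-connectedness forces minimum degree three and excludes
cut-vertices, and vertices are read off from cyclic flats.

Cyclic flats correspond to strong sets of vertices (`cycFlat_iff`). These are closed under union, so
each vertex `w` has a largest strong set avoiding it, its hull; the vertices other than `w` outside
the hull form its rim. By maximality at most `|rim w|` edges touch the rim and avoid `w`
(`card_touch_rim_le`). Combined with degree counting this shows that distinct vertices with
non-empty hulls have disjoint rims (`TwoConn.disjoint_rims`) and that at most one vertex has an
empty hull (`eq_of_hull_eq_empty`).

A maximal cyclic flat avoiding an edge is the flat of one of its ends. Conversely the flat of an end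
`v` can fail to be maximal only when the other end `b` has a strictly larger hull; then the flat of
`b` is the largest one avoiding the edge, and disjointness of rims singles out `v` among the
vertices with smaller flats. Three exceptions are handled by guessed sets. The star of the vertex
with empty hull is guessed. Twins, which share a non-empty hull, are separated by one edge
(`star_eq_of_twin`). A vertex whose flat is maximal for no edge at it is exhibited by a circuit skew
to that flat; the complements of the hulls of such vertices are disjoint, so one set holds all these
circuits (`exists_witness`). -/

open scoped Classical

/-! ### Multigraphs as incidence data, and counting edges -/

/-- A finite multigraph given by its edges, its vertices, and the set of ends of each edge. -/
structure EndGraph (α β : Type*) where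
  /-- the edges -/
  E : Finset α
  /-- the vertices -/
  V : Finset β
  /-- the ends of an edge; a loop has one end -/
  ends : α → Finset β
  ends_subset : ∀ e ∈ E, ends e ⊆ V
  ends_nonempty : ∀ e ∈ E, (ends e).Nonempty
  card_ends_le : ∀ e ∈ E, (ends e).card ≤ 2

namespace EndGraph

variable {α β : Type*} (H : EndGraph α β)

theorem exists_ends {e : α} (he : e ∈ H.E) : ∃ x ∈ H.V, ∃ y ∈ H.V, H.ends e = {x, y} := by
  have h1 := H.card_ends_le e he
  have h2 := (H.ends_nonempty e he).card_pos
  have h3 := H.ends_subset e he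
  rcases (by omega : (H.ends e).card = 1 ∨ (H.ends e).card = 2) with h | h
  · obtain ⟨x, hx⟩ := Finset.card_eq_one.1 h
    exact ⟨x, h3 (by simp [hx]), x, h3 (by simp [hx]), by simp [hx]⟩
  · obtain ⟨x, y, -, hx⟩ := Finset.card_eq_two.1 h
    exact ⟨x, h3 (by simp [hx]), y, h3 (by simp [hx]), hx⟩

theorem ends_eq_pair {e : α} (he : e ∈ H.E) {x y : β} (hx : x ∈ H.ends e) (hy : y ∈ H.ends e)
    (hxy : x ≠ y) : H.ends e = {x, y} := by
  refine (Finset.eq_of_subset_of_card_le ?_ ?_).symm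
  · intro z hz
    simp only [Finset.mem_insert, Finset.mem_singleton] at hz
    rcases hz with rfl | rfl <;> assumption
  · rw [Finset.card_pair hxy]
    exact H.card_ends_le e he

/-- The number of edges incident with a vertex. -/
noncomputable def deg (v : β) : ℕ := (H.E.filter (fun e => v ∈ H.ends e)).card

theorem sum_deg (Y : Finset β) : ∑ v ∈ Y, H.deg v = ∑ e ∈ H.E, (H.ends e ∩ Y).card := by
  have := Finset.sum_card_bipartiteAbove_eq_sum_card_bipartiteBelow (s := Y) (t := H.E)
    (fun v e => v ∈ H.ends e)
  simp only [Finset.bipartiteAbove, Finset.bipartiteBelow] at this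
  unfold deg
  rw [this]
  refine Finset.sum_congr rfl fun e _ => congrArg _ ?_
  ext v
  simp [and_comm]

/-- Double counting of degrees: the edges pay for the degrees of `Y`, each drawing only on its
memberships in `A` and `B`, and `X` records payments left over. All the rim estimates below have
this shape. -/
theorem three_mul_card_add_le {Y : Finset β} {A B X : Finset α} (hdeg : ∀ v ∈ Y, 3 ≤ H.deg v)
    (hA : A ⊆ H.E) (hB : B ⊆ H.E) (hX : X ⊆ H.E)
    (h : ∀ e ∈ H.E, (H.ends e ∩ Y).card + (if e ∈ X then 1 else 0) ≤
      (if e ∈ A then 1 else 0) + (if e ∈ B then 1 else 0)) :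
    3 * Y.card + X.card ≤ A.card + B.card := by
  have h1 : 3 * Y.card ≤ ∑ v ∈ Y, H.deg v := by
    rw [mul_comm, ← smul_eq_mul]
    exact Finset.card_nsmul_le_sum _ _ _ hdeg
  have h2 := Finset.sum_le_sum h
  rw [Finset.sum_add_distrib, Finset.sum_add_distrib, ← H.sum_deg] at h2
  simp only [Finset.sum_ite_mem, Finset.inter_eq_right.2 hA, Finset.inter_eq_right.2 hB,
    Finset.inter_eq_right.2 hX, Finset.sum_const, smul_eq_mul, mul_one] at h2
  omega

/-- If the edges in `F` link every set between `Q` and `U` to its complement in `U`, then there are at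
least as many of them as there are vertices in `U \ Q`. -/
theorem card_sdiff_le_card_filter {F : Finset α} (hF : F ⊆ H.E) {U : Finset β} (Q : Finset β)
    (hQU : Q ⊆ U)
    (h : ∀ Q', Q ⊆ Q' → Q' ⊆ U → Q' ≠ U → ∃ e ∈ F, H.ends e ⊆ U ∧ (∃ q ∈ Q', q ∈ H.ends e) ∧
      ∃ u ∈ U \ Q', u ∈ H.ends e) :
    (U \ Q).card ≤ (F.filter fun e => H.ends e ⊆ U ∧ ∃ u ∈ U \ Q, u ∈ H.ends e).card := by
  induction hn : (U \ Q).card generalizing Q with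
  | zero => exact Nat.zero_le _
  | succ n ih =>
    have hne : Q ≠ U := by rintro rfl; simp at hn
    obtain ⟨e, heF, heU, ⟨q, hq, hqe⟩, u, hu, hue⟩ := h Q subset_rfl hQU hne
    rw [Finset.mem_sdiff] at hu
    have hcard : (U \ insert u Q).card = n := by
      have : U \ insert u Q = (U \ Q).erase u := by ext; simp; tauto
      rw [this, Finset.card_erase_of_mem (by simp [hu]), hn]; rfl
    have ih' := ih (insert u Q) (Finset.insert_subset hu.1 hQU)
      (fun Q' hQ' => h Q' ((Finset.subset_insert _ _).trans hQ')) hcard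
    have hends := H.ends_eq_pair (hF heF) hqe hue (by rintro rfl; exact hu.2 hq)
    refine (Nat.succ_le_succ ih').trans ?_
    rw [Nat.succ_eq_add_one, ← Finset.card_insert_of_notMem (a := e)]
    · refine Finset.card_le_card fun f hf => ?_
      simp only [Finset.mem_insert, Finset.mem_filter, Finset.mem_sdiff] at hf ⊢
      rcases hf with rfl | ⟨h1, h2, v, hv, hvf⟩
      · exact ⟨heF, heU, u, hu, hue⟩
      · exact ⟨h1, h2, v, ⟨hv.1, fun h => hv.2 (by simp [h])⟩, hvf⟩
    -- The other end of `e` lies in `Q`, so `e` is not among the edges already counted for `insert u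
    -- Q`.
    · simp only [Finset.mem_filter, not_and]
      rintro - - ⟨v, hv, hve⟩
      rw [hends] at hve
      simp only [Finset.mem_sdiff, Finset.mem_insert, Finset.mem_singleton] at hv hve
      rcases hve with rfl | rfl <;> tauto

/-! ### Strong sets, hulls and rims -/

/-- The edges avoiding `w` and touching `X`. -/
noncomputable def touch (w : β) (X : Finset β) : Finset α :=
  H.E.filter fun e => w ∉ H.ends e ∧ ∃ x ∈ X, x ∈ H.ends e

/-- The edges with all ends in `S`. -/
noncomputable def within (S : Finset β) : Finset α := H.E.filter fun e => H.ends e ⊆ S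

theorem mem_touch {w : β} {X : Finset β} {e : α} :
    e ∈ H.touch w X ↔ e ∈ H.E ∧ w ∉ H.ends e ∧ ∃ x ∈ X, x ∈ H.ends e := by simp [touch]

theorem mem_within {S : Finset β} {e : α} : e ∈ H.within S ↔ e ∈ H.E ∧ H.ends e ⊆ S := by
  simp [within]

theorem within_subset (S : Finset β) : H.within S ⊆ H.E := Finset.filter_subset _ _

theorem touch_subset (w : β) (S : Finset β) : H.touch w S ⊆ H.E := Finset.filter_subset _ _

theorem within_mono {S T : Finset β} (h : S ⊆ T) : H.within S ⊆ H.within T := by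
  intro e he
  rw [mem_within] at he ⊢
  exact ⟨he.1, he.2.trans h⟩

/-- Every non-empty `Y ⊆ S` is touched by at least `|Y| + 1` edges that have both ends in `S`. -/
def Strong (S : Finset β) : Prop :=
  S ⊆ H.V ∧ ∀ Y ⊆ S, Y.Nonempty → Y.card + 1 ≤ ((H.within S).filter fun e => ∃ y ∈ Y, y ∈ H.ends e).card

theorem strong_empty : H.Strong ∅ :=
  ⟨by simp, fun Y hY hne => absurd hne (by simp [Finset.subset_empty.1 hY])⟩

/-- Split `Y` into `Y ∩ S` and `Y \ S`. The edges within `S` touching the first part are disjoint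
from the edges within `T` touching the second, so the two bounds add up, and the surplus of one
survives. -/
theorem Strong.union {S T : Finset β} (hS : H.Strong S) (hT : H.Strong T) : H.Strong (S ∪ T) := by
  refine ⟨Finset.union_subset hS.1 hT.1, fun Y hY hne => ?_⟩
  set N := (H.within (S ∪ T)).filter fun e => ∃ y ∈ Y, y ∈ H.ends e with hN
  set N₁ := (H.within S).filter fun e => ∃ y ∈ Y ∩ S, y ∈ H.ends e with hN₁
  set N₂ := (H.within T).filter fun e => ∃ y ∈ Y \ S, y ∈ H.ends e with hN₂
  have hdisj : Disjoint N₁ N₂ := by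
    rw [Finset.disjoint_left]
    intro e h1 h2
    simp only [hN₁, hN₂, Finset.mem_filter, Finset.mem_sdiff, mem_within] at h1 h2
    obtain ⟨-, y, hy, hye⟩ := h2
    exact hy.2 (h1.1.2 hye)
  have hsub : N₁ ∪ N₂ ⊆ N := by
    intro e he
    simp only [hN₁, hN₂, hN, Finset.mem_union, Finset.mem_filter, Finset.mem_sdiff, Finset.mem_inter]
      at he ⊢
    rcases he with ⟨h, y, hy, hye⟩ | ⟨h, y, hy, hye⟩
    · exact ⟨H.within_mono Finset.subset_union_left h, y, hy.1, hye⟩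
    · exact ⟨H.within_mono Finset.subset_union_right h, y, hy.1, hye⟩
  have hle : N₁.card + N₂.card ≤ N.card := by
    rw [← Finset.card_union_of_disjoint hdisj]; exact Finset.card_le_card hsub
  have hYc : (Y ∩ S).card + (Y \ S).card = Y.card := Finset.card_inter_add_card_sdiff _ _
  have h1 : (Y ∩ S).Nonempty → (Y ∩ S).card + 1 ≤ N₁.card := hS.2 _ Finset.inter_subset_right
  have h2 : (Y \ S).Nonempty → (Y \ S).card + 1 ≤ N₂.card := hT.2 _ (by
    intro y hy; rw [Finset.mem_sdiff] at hy; have := hY hy.1; simp at this; tauto)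
  have hpos := hne.card_pos
  rw [← Finset.card_pos] at h1 h2
  omega

/-- The largest strong set avoiding `w`. -/
noncomputable def hull (w : β) : Finset β :=
  (H.V.powerset.filter fun S => H.Strong S ∧ w ∉ S).sup id

/-- Closure under union makes the supremum itself a strong set avoiding `w`. -/
theorem hull_spec (w : β) : H.Strong (H.hull w) ∧ w ∉ H.hull w := by
  unfold hull
  refine Finset.sup_induction (p := fun S => H.Strong S ∧ w ∉ S) ?_ ?_ ?_
  · exact ⟨H.strong_empty, by simp⟩
  · rintro S ⟨hS, hwS⟩ T ⟨hT, hwT⟩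
    exact ⟨hS.union H hT, by simp [hwS, hwT]⟩
  · intro S hS
    simpa using (Finset.mem_filter.1 hS).2

theorem subset_hull {w : β} {S : Finset β} (hS : H.Strong S) (hw : w ∉ S) : S ⊆ H.hull w := by
  unfold hull
  exact Finset.le_sup (f := id) (by simp [hS, hw, hS.1])

theorem hull_subset (w : β) : H.hull w ⊆ H.V := (H.hull_spec w).1.1

theorem notMem_hull (w : β) : w ∉ H.hull w := (H.hull_spec w).2

theorem hull_subset_hull {v w : β} (h : w ∉ H.hull v) : H.hull v ⊆ H.hull w :=
  H.subset_hull (H.hull_spec v).1 h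

/-- The vertices other than `w` outside the hull of `w`. -/
noncomputable def rim (w : β) : Finset β := H.V.erase w \ H.hull w

theorem mem_rim {v w : β} : v ∈ H.rim w ↔ v ∈ H.V ∧ v ≠ w ∧ v ∉ H.hull w := by
  simp [rim]; tauto

/-- Take `X` avoiding `w` as large as possible with at most `|X|` edges touching it and avoiding
`w`. A set violating strength of the complement could be added to `X`, so that complement is strong,
lies in the hull, and `X` contains the rim. Discarding `X ∩ hull w` preserves the inequality,
because by strength it is touched by more than its size of edges inside the hull. -/
theorem card_touch_rim_le (w : β) : (H.touch w (H.rim w)).card ≤ (H.rim w).card := by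
  obtain ⟨X, hX, hmax⟩ := Finset.exists_max_image
    ((H.V.erase w).powerset.filter fun X => (H.touch w X).card ≤ X.card) Finset.card
    ⟨∅, Finset.mem_filter.2 ⟨by simp, by simp [touch]⟩⟩
  simp only [Finset.mem_filter, Finset.mem_powerset] at hX hmax
  have hstrong : H.Strong (H.V.erase w \ X) := by
    refine ⟨Finset.sdiff_subset.trans (Finset.erase_subset _ _), fun Y hY hne => ?_⟩
    by_contra! hlt
    have hdisj : Disjoint X Y := by
      rw [Finset.disjoint_left]; intro a ha hb; exact (Finset.mem_sdiff.1 (hY hb)).2 ha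
    have h1 : (H.touch w (X ∪ Y)).card ≤ (X ∪ Y).card := by
      rw [Finset.card_union_of_disjoint hdisj]
      have hsub : H.touch w (X ∪ Y) ⊆ H.touch w X ∪
          ((H.within (H.V.erase w \ X)).filter fun e => ∃ y ∈ Y, y ∈ H.ends e) := by
        intro e he
        simp only [mem_touch, mem_within, Finset.mem_union, Finset.mem_filter] at he ⊢
        obtain ⟨heE, hw, x, hx, hxe⟩ := he
        by_cases hX' : ∃ x ∈ X, x ∈ H.ends e
        · exact Or.inl ⟨heE, hw, hX'⟩
        · push Not at hX'
          refine Or.inr ⟨⟨heE, fun z hz => ?_⟩, x, hx.resolve_left fun h => hX' x h hxe, hxe⟩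
          simp only [Finset.mem_sdiff, Finset.mem_erase]
          exact ⟨⟨by rintro rfl; exact hw hz, H.ends_subset e heE hz⟩, fun h => hX' z h hz⟩
      have := (Finset.card_le_card hsub).trans (Finset.card_union_le _ _)
      omega
    have h2 := hmax (X ∪ Y) ⟨Finset.union_subset hX.1 (hY.trans Finset.sdiff_subset), h1⟩
    rw [Finset.card_union_of_disjoint hdisj] at h2
    have := hne.card_pos
    omega
  have hS := H.subset_hull hstrong (w := w) (by simp)
  have hrim : H.rim w ⊆ X := by
    intro v hv
    rw [rim, Finset.mem_sdiff] at hv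
    by_contra hvX
    exact hv.2 (hS (by rw [Finset.mem_sdiff]; exact ⟨hv.1, hvX⟩))
  have hrimeq : X \ (X ∩ H.hull w) = H.rim w := by
    ext v
    constructor
    · intro hv
      simp only [Finset.mem_sdiff, Finset.mem_inter, not_and] at hv
      rw [rim, Finset.mem_sdiff]
      exact ⟨hX.1 hv.1, hv.2 hv.1⟩
    · intro hv
      have := hrim hv
      rw [rim, Finset.mem_sdiff] at hv
      simp [this, hv.2]
  have hc : (X \ (X ∩ H.hull w)).card + (X ∩ H.hull w).card = X.card :=
    Finset.card_sdiff_add_card_eq_card Finset.inter_subset_left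
  rw [hrimeq] at hc
  rcases (X ∩ H.hull w).eq_empty_or_nonempty with h0 | hne
  · have : X = H.rim w := by rw [← hrimeq, h0, Finset.sdiff_empty]
    rw [← this]; exact hX.2
  · have h1 := (H.hull_spec w).1.2 _ Finset.inter_subset_right hne
    have h2 : H.touch w (H.rim w) ∪
        ((H.within (H.hull w)).filter fun e => ∃ y ∈ X ∩ H.hull w, y ∈ H.ends e) ⊆ H.touch w X := by
      intro e he
      simp only [mem_touch, mem_within, Finset.mem_union, Finset.mem_filter, Finset.mem_inter] at he ⊢
      rcases he with ⟨h1, h2, x, hx, hxe⟩ | ⟨⟨h1, h2⟩, x, hx, hxe⟩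
      · exact ⟨h1, h2, x, hrim hx, hxe⟩
      · exact ⟨h1, fun h => H.notMem_hull w (h2 h), x, hx.1, hxe⟩
    have h3 : Disjoint (H.touch w (H.rim w))
        ((H.within (H.hull w)).filter fun e => ∃ y ∈ X ∩ H.hull w, y ∈ H.ends e) := by
      rw [Finset.disjoint_left]
      intro e he hf
      simp only [mem_touch, mem_within, Finset.mem_filter] at he hf
      obtain ⟨-, -, x, hx, hxe⟩ := he
      exact (H.mem_rim.1 hx).2.2 (hf.1.2 hxe)
    have h4 := Finset.card_le_card h2
    rw [Finset.card_union_of_disjoint h3] at h4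
    omega

/-! ### Graphs without a cut-vertex -/

/-- Deleting any one vertex leaves a connected graph. -/
def TwoConn : Prop :=
  ∀ w ∈ H.V, ∀ Q ⊆ H.V.erase w, Q.Nonempty → Q ≠ H.V.erase w →
    ∃ e ∈ H.E, w ∉ H.ends e ∧ (∃ q ∈ Q, q ∈ H.ends e) ∧ ∃ r ∈ H.V.erase w \ Q, r ∈ H.ends e

variable {H}

/-- Since `H - w` is connected, it can be grown from the complement of `Z`, each new vertex bringing
a new edge that touches `Z`. -/
theorem TwoConn.card_le_card_touch (hH : H.TwoConn) {w : β} (hw : w ∈ H.V) {Z : Finset β}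
    (hZ : Z ⊆ H.V.erase w) (hne : Z ≠ H.V.erase w) : Z.card ≤ (H.touch w Z).card := by
  have h := H.card_sdiff_le_card_filter (F := H.E) subset_rfl (U := H.V.erase w) (H.V.erase w \ Z)
    Finset.sdiff_subset ?_
  · rw [Finset.sdiff_sdiff_eq_self hZ] at h
    refine h.trans (Finset.card_le_card fun e he => ?_)
    simp only [Finset.mem_filter, mem_touch] at he ⊢
    exact ⟨he.1, fun h => by simpa using he.2.1 h, he.2.2⟩
  · intro Q hQ hQU hQne
    have hQ0 : Q.Nonempty := by
      refine Finset.Nonempty.mono hQ (Finset.sdiff_nonempty.2 fun h => hne (hZ.antisymm h))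
    obtain ⟨e, heE, hwe, hq, hr⟩ := hH w hw Q hQU hQ0 hQne
    exact ⟨e, heE, fun z hz => Finset.mem_erase.2 ⟨by rintro rfl; exact hwe hz, H.ends_subset e heE hz⟩,
      hq, hr⟩

/-- If `w` has a non-empty hull, then no two edges with ends in its rim are parallel. -/
theorem TwoConn.not_parallel_of_rim (hH : H.TwoConn) {w : β} (hw : w ∈ H.V)
    (hne : (H.hull w).Nonempty) {a b : α} (ha : a ∈ H.E) (hb : b ∈ H.E) (hab : a ≠ b)
    (heq : H.ends a = H.ends b) (hsub : H.ends a ⊆ H.rim w) : False := by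
  have hhull : H.hull w ⊆ H.V.erase w := fun v hv => Finset.mem_erase.2
    ⟨by rintro rfl; exact H.notMem_hull _ hv, H.hull_subset w hv⟩
  -- A parallel edge is redundant for connectedness: growing outwards from the hull without `b`
  -- already gives as many edges as the rim has vertices, so `b` exceeds the bound
  -- `card_touch_rim_le`.
  have h := H.card_sdiff_le_card_filter (F := H.E.erase b) (Finset.erase_subset _ _) (U := H.V.erase w)
    (H.hull w) hhull ?_
  · have h1 := H.card_touch_rim_le w
    have h2 : ((H.E.erase b).filter fun e => H.ends e ⊆ H.V.erase w ∧
        ∃ u ∈ H.V.erase w \ H.hull w, u ∈ H.ends e) ⊆ (H.touch w (H.rim w)).erase b := by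
      intro e he
      simp only [Finset.mem_filter, Finset.mem_erase, mem_touch] at he ⊢
      exact ⟨he.1.1, he.1.2, fun h => by simpa using he.2.1 h, he.2.2⟩
    have h3 := h.trans (Finset.card_le_card h2)
    have hbt : b ∈ H.touch w (H.rim w) := by
      rw [mem_touch]
      obtain ⟨x, hx⟩ := H.ends_nonempty b hb
      refine ⟨hb, fun h => ?_, x, hsub (heq ▸ hx), hx⟩
      rw [← heq] at h
      exact (H.mem_rim.1 (hsub h)).2.1 rfl
    rw [Finset.card_erase_of_mem hbt] at h3
    have := Finset.card_pos.2 ⟨b, hbt⟩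
    unfold rim at h1 this
    unfold rim at h3
    omega
  · intro Q hQ hQU hQne
    obtain ⟨e, heE, hwe, hq, hr⟩ := hH w hw Q hQU (hne.mono hQ) hQne
    by_cases hbe : e = b
    · subst hbe
      exact ⟨a, Finset.mem_erase.2 ⟨hab, ha⟩, fun z hz => Finset.mem_erase.2
        ⟨fun h => hwe (by rw [← heq, ← h]; exact hz), H.ends_subset a ha hz⟩,
        by rw [heq]; exact hq, by rw [heq]; exact hr⟩
    · exact ⟨e, Finset.mem_erase.2 ⟨hbe, heE⟩, fun z hz => Finset.mem_erase.2
        ⟨by rintro rfl; exact hwe hz, H.ends_subset e heE hz⟩, hq, hr⟩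

end EndGraph

/-! ### Rims of distinct vertices are disjoint -/

namespace EndGraph
variable {α β : Type*} {H : EndGraph α β}

/-- Indicator form of the count, which turns the edge inequalities below into propositional case
analysis. -/
theorem card_ends_inter_le (H : EndGraph α β) {e : α} {x y : β} (h : H.ends e = {x, y})
    (Y : Finset β) : (H.ends e ∩ Y).card ≤
      (if x ∈ Y then 1 else 0) + if x = y then 0 else if y ∈ Y then 1 else 0 := by
  rw [h]
  by_cases hxy : x = y
  · subst hxy
    by_cases hx : x ∈ Y <;> simp [hx, Finset.singleton_inter_of_mem, Finset.singleton_inter_of_notMem]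
  · by_cases hx : x ∈ Y <;> by_cases hy : y ∈ Y <;>
      simp [hx, hy, hxy, Finset.insert_inter_of_mem, Finset.insert_inter_of_notMem,
        Finset.singleton_inter_of_mem, Finset.singleton_inter_of_notMem]

/-- Two vertices with the same hull: the number of vertices outside it is bounded, and almost no edge
leaves that part. -/
theorem three_mul_card_add_leaving_le (hdeg : ∀ v ∈ H.V, 3 ≤ H.deg v) {w w' : β}
    (hww : w ≠ w') (hS : H.hull w = H.hull w') (hwV : w ∈ H.V) (hwV' : w' ∈ H.V) {N : Finset β}
    (hN : N = (H.rim w).erase w') :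
    3 * N.card + (H.E.filter fun e => (∃ x ∈ H.hull w, x ∈ H.ends e) ∧ ¬ H.ends e ⊆ H.hull w).card
      ≤ 2 * N.card + 2 := by
  have hw'r : w' ∈ H.rim w := H.mem_rim.2 ⟨hwV', hww.symm, hS ▸ H.notMem_hull w'⟩
  have hwr' : w ∈ H.rim w' := H.mem_rim.2 ⟨hwV, hww, hS ▸ H.notMem_hull w⟩
  have hmem : ∀ v, v ∈ N ↔ v ∈ H.V ∧ v ≠ w ∧ v ≠ w' ∧ v ∉ H.hull w := by
    intro v; rw [hN, Finset.mem_erase, mem_rim]; tauto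
  have hN' : N = (H.rim w').erase w := by
    ext v; rw [hmem, Finset.mem_erase, mem_rim, hS]; tauto
  have hc : (H.rim w).card = N.card + 1 := by
    rw [hN, Finset.card_erase_of_mem hw'r]; have := Finset.card_pos.2 ⟨_, hw'r⟩; omega
  have hc' : (H.rim w').card = N.card + 1 := by
    rw [hN', Finset.card_erase_of_mem hwr']; have := Finset.card_pos.2 ⟨_, hwr'⟩; omega
  have h1 := H.card_touch_rim_le w
  have h2 := H.card_touch_rim_le w'
  -- Each of the two touch sets has at most `N.card + 1` edges. An edge with two ends in `N`, or one
  -- in `N` and one in the hull, lies in both; one from `N` or the hull to `w` or `w'` lies in one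
  -- of them.
  refine (H.three_mul_card_add_le (Y := N) (A := H.touch w (H.rim w)) (B := H.touch w' (H.rim w'))
    (fun v hv => hdeg v ((hmem v).1 hv).1) (H.touch_subset _ _) (H.touch_subset _ _)
    (Finset.filter_subset _ _) ?_).trans (by omega)
  intro e he
  obtain ⟨x, hx, y, hy, hxy⟩ := H.exists_ends he
  have hm : ∀ v, v ∈ H.rim w ↔ v ∈ H.V ∧ v ≠ w ∧ v ∉ H.hull w := fun v => H.mem_rim
  have hm' : ∀ v, v ∈ H.rim w' ↔ v ∈ H.V ∧ v ≠ w' ∧ v ∉ H.hull w := fun v => hS ▸ H.mem_rim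
  have hw0 := H.notMem_hull w
  have hw0' := H.notMem_hull w'
  rw [← hS] at hw0'
  have hcard := H.card_ends_inter_le hxy N
  simp only [mem_touch, Finset.mem_filter, he, true_and, hxy, hm, hm', hmem, Finset.mem_insert,
    Finset.mem_singleton, Finset.insert_subset_iff, Finset.singleton_subset_iff, and_or_left, exists_or,
    exists_eq_right, hx, hy] at hcard ⊢
  refine (Nat.add_le_add_right hcard _).trans ?_
  clear hcard h1 h2 hc hc' hN hN' hmem hm hm' hxy
  grind

/-- The rim is touched by at most `|rim|` edges avoiding `w`, while by connectedness of `H - w` the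
rest of the rim is touched by at least its own size; the difference is at most `|Y|`. -/
theorem TwoConn.card_touch_sdiff_le (hH : H.TwoConn) {w : β} (hw : w ∈ H.V) {Y : Finset β}
    (hY : Y ⊆ H.rim w) (hne : Y.Nonempty) :
    (H.touch w (H.rim w) \ H.touch w (H.rim w \ Y)).card ≤ Y.card := by
  have hrim : H.rim w ⊆ H.V.erase w := Finset.sdiff_subset
  have h1 := hH.card_le_card_touch hw (Z := H.rim w \ Y) (Finset.sdiff_subset.trans hrim) (by
    obtain ⟨y, hy⟩ := hne
    intro h
    have := hrim (hY hy)
    rw [← h, Finset.mem_sdiff] at this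
    exact this.2 hy)
  have h2 : H.touch w (H.rim w \ Y) ⊆ H.touch w (H.rim w) := by
    intro e he
    rw [mem_touch] at he ⊢
    obtain ⟨h1, h2, x, hx, hxe⟩ := he
    exact ⟨h1, h2, x, Finset.sdiff_subset hx, hxe⟩
  have h3 := Finset.card_sdiff_add_card_eq_card h2
  have h4 := Finset.card_sdiff_add_card_eq_card hY
  have h5 := H.card_touch_rim_le w
  omega

/-- Let `Y` be the common part of the rims. For each of the two vertices at most `|Y|` edges are
lost when `Y` leaves its rim. An edge with one end in `Y` is lost for at least one of them and an
edge with two ends in `Y` for both, so the degrees give `3|Y| ≤ 2|Y|`. -/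
theorem TwoConn.disjoint_rims_of_mem_hull (hH : H.TwoConn) (hdeg : ∀ v ∈ H.V, 3 ≤ H.deg v)
    {x w w' : β} (hw : w ∈ H.V) (hw' : w' ∈ H.V) (hx : x ∈ H.rim w) (hx' : x ∈ H.rim w')
    (h : w ∈ H.hull w') (h' : w' ∈ H.hull w) : False := by
  have hY : (H.rim w ∩ H.rim w').Nonempty := ⟨x, Finset.mem_inter.2 ⟨hx, hx'⟩⟩
  have h1 := hH.card_touch_sdiff_le hw Finset.inter_subset_left hY
  have h2 := hH.card_touch_sdiff_le hw' Finset.inter_subset_right hY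
  have h3 := H.three_mul_card_add_le (Y := H.rim w ∩ H.rim w')
    (A := H.touch w (H.rim w) \ H.touch w (H.rim w \ (H.rim w ∩ H.rim w')))
    (B := H.touch w' (H.rim w') \ H.touch w' (H.rim w' \ (H.rim w ∩ H.rim w'))) (X := ∅)
    (fun v hv => hdeg v (H.mem_rim.1 (Finset.mem_inter.1 hv).1).1)
    (Finset.sdiff_subset.trans (H.touch_subset _ _)) (Finset.sdiff_subset.trans (H.touch_subset _ _))
    (by simp) ?_
  · have := hY.card_pos
    simp only [Finset.card_empty] at h3
    omega
  · intro e he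
    obtain ⟨a, ha, b, hb, hab⟩ := H.exists_ends he
    have hcard := H.card_ends_inter_le hab (H.rim w ∩ H.rim w')
    have hw0 := H.notMem_hull w
    have hw0' := H.notMem_hull w'
    simp only [Finset.mem_sdiff, mem_touch, he, true_and, hab, Finset.mem_inter, mem_rim,
      Finset.mem_insert, Finset.mem_singleton, and_or_left, exists_or, exists_eq_right, ha, hb]
      at hcard ⊢
    refine (Nat.add_le_add_right hcard _).trans ?_
    clear hcard h1 h2 hY hx hx' hab
    grind

/-- The same count, now with `w` itself added to the part leaving the rim of `w'`, has a slack of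
one. So the common part is a single vertex `x` and the count is tight. This forces the rest of the
rim of `w` to be empty and then two parallel edges between `x` and `w` inside the rim of `w'`, which
`not_parallel_of_rim` excludes. -/
theorem TwoConn.disjoint_rims_of_mem_rim (hH : H.TwoConn) (hdeg : ∀ v ∈ H.V, 3 ≤ H.deg v)
    {x w w' : β} (hw' : w' ∈ H.V) (hne : (H.hull w').Nonempty) (hx : x ∈ H.rim w)
    (hx' : x ∈ H.rim w') (h : w ∈ H.rim w') (h' : w' ∈ H.hull w) : False := by
  have hw : w ∈ H.V := (H.mem_rim.1 h).1
  set Y := H.rim w ∩ H.rim w' with hYdef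
  have hxY : x ∈ Y := Finset.mem_inter.2 ⟨hx, hx'⟩
  have hwY : w ∉ Y := fun h => (H.mem_rim.1 (Finset.mem_inter.1 h).1).2.1 rfl
  set A := H.touch w' (H.rim w') \ H.touch w' (H.rim w' \ insert w Y) with hA
  set B := H.touch w (H.rim w) \ H.touch w (H.rim w \ Y) with hB
  set X := A.filter fun e => ¬ ∃ y ∈ Y, y ∈ H.ends e with hX
  have h1 : B.card ≤ Y.card := hH.card_touch_sdiff_le hw Finset.inter_subset_left ⟨x, hxY⟩
  have h2 : A.card ≤ Y.card + 1 := by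
    rw [← Finset.card_insert_of_notMem hwY]
    exact hH.card_touch_sdiff_le hw' (Finset.insert_subset h Finset.inter_subset_right) ⟨w, by simp⟩
  have hAE : A ⊆ H.E := Finset.sdiff_subset.trans (H.touch_subset _ _)
  have h3 := H.three_mul_card_add_le (Y := Y) (A := A) (B := B) (X := X)
    (fun v hv => hdeg v (H.mem_rim.1 (Finset.mem_inter.1 hv).1).1) hAE
    (Finset.sdiff_subset.trans (H.touch_subset _ _)) ((Finset.filter_subset _ _).trans hAE) (by
      intro e he
      obtain ⟨a, ha, b, hb, hab⟩ := H.exists_ends he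
      have hcard := H.card_ends_inter_le hab Y
      have hw0 := H.notMem_hull w
      have hw0' := H.notMem_hull w'
      rw [mem_rim] at h
      simp only [hX, hA, hB, hYdef, Finset.mem_filter, Finset.mem_sdiff, mem_touch, he, true_and, hab,
        Finset.mem_inter, mem_rim, Finset.mem_insert, Finset.mem_singleton, and_or_left, exists_or,
        exists_eq_right, ha, hb] at hcard ⊢
      refine (Nat.add_le_add_right hcard _).trans ?_
      clear hcard h1 h2 hx hx' hab hxY hwY hX hA hB
      clear_value A B X Y
      grind)
  have hYpos : 0 < Y.card := Finset.card_pos.2 ⟨x, hxY⟩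
  -- The bounds read `3|Y| + |X| ≤ (|Y| + 1) + |Y|`.
  have hY1 : Y.card = 1 := by omega
  have hYx : Y = {x} := by
    obtain ⟨z, hz⟩ := Finset.card_eq_one.1 hY1
    rw [hz, Finset.mem_singleton] at hxY
    rw [hz, hxY]
  have hX0 : X = ∅ := Finset.card_eq_zero.1 (by omega)
  -- An edge from `w` to the rest of its rim would be surplus, that is, an element of the empty set
  -- `X`.
  have hnone : ∀ e ∈ H.E, ∀ z ∈ H.rim w \ Y, z ∈ H.ends e → w ∉ H.ends e := by
    intro e he z hz hze hwe
    rw [Finset.mem_sdiff] at hz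
    have hzw := (H.mem_rim.1 hz.1).2.1
    have hends := H.ends_eq_pair he hze hwe hzw
    have hzr : z ∉ H.rim w' := fun hzr => hz.2 (Finset.mem_inter.2 ⟨hz.1, hzr⟩)
    have hzw' : z ≠ w' := by rintro rfl; exact (H.mem_rim.1 hz.1).2.2 h'
    have hww' : w ≠ w' := (H.mem_rim.1 h).2.1
    have : e ∈ X := by
      simp only [hX, hA, Finset.mem_filter, Finset.mem_sdiff, mem_touch, he, true_and, hends,
        Finset.mem_insert, Finset.mem_singleton, and_or_left, exists_or, exists_eq_right]
      simp only [not_and, not_or, hzr, hz.2, hwY, h]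
      tauto
    simp [hX0] at this
  -- Every edge at this remainder avoids `w`, so twice the number of such edges is at least three
  -- times its size. Tightness also makes `B` non-empty, which leaves at most as many of these edges
  -- as vertices.
  have hZ : H.rim w \ Y = ∅ := by
    have h4 := H.three_mul_card_add_le (Y := H.rim w \ Y) (A := H.touch w (H.rim w \ Y))
      (B := H.touch w (H.rim w \ Y)) (X := ∅)
      (fun v hv => hdeg v (H.mem_rim.1 (Finset.mem_sdiff.1 hv).1).1) (H.touch_subset _ _)
      (H.touch_subset _ _) (by simp) (by
        intro e he
        obtain ⟨a, ha, b, hb, hab⟩ := H.exists_ends he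
        have hcard := H.card_ends_inter_le hab (H.rim w \ Y)
        have hn := hnone e he
        simp only [mem_touch, he, true_and, hab,
          Finset.mem_insert, Finset.mem_singleton, and_or_left, exists_or,
          exists_eq_right] at hcard hn ⊢
        refine (Nat.add_le_add_right hcard _).trans ?_
        clear hcard h1 h2 hx hx' hab hxY hwY hX hA hB hnone
        generalize H.rim w \ Y = Z at *
        clear_value A B X Y
        grind)
    have h5 := H.card_touch_rim_le w
    have h6 : H.touch w (H.rim w \ Y) ⊆ H.touch w (H.rim w) := by
      intro e he
      rw [mem_touch] at he ⊢
      obtain ⟨h1, h2, x, hx, hxe⟩ := he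
      exact ⟨h1, h2, x, Finset.sdiff_subset hx, hxe⟩
    have h7 := Finset.card_sdiff_add_card_eq_card h6
    have h8 : (H.rim w \ Y).card + Y.card = (H.rim w).card :=
      Finset.card_sdiff_add_card_eq_card Finset.inter_subset_left
    rw [← hB] at h7
    rw [← Finset.card_eq_zero]
    simp only [Finset.card_empty] at h4
    omega
  have hrim : H.rim w = {x} := by
    rw [← hYx]
    exact (Finset.sdiff_eq_empty_iff_subset.1 hZ).antisymm Finset.inter_subset_left
  have ht := H.card_touch_rim_le w
  have hd := hdeg x (H.mem_rim.1 hx).1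
  rw [hrim] at ht
  have hsplit : (H.E.filter fun e => x ∈ H.ends e) ⊆
      (H.E.filter fun e => x ∈ H.ends e ∧ w ∈ H.ends e) ∪ H.touch w {x} := by
    intro e he
    simp only [Finset.mem_union, Finset.mem_filter, mem_touch, Finset.mem_singleton, exists_eq_left]
      at he ⊢
    tauto
  have hle := (Finset.card_le_card hsplit).trans (Finset.card_union_le _ _)
  unfold deg at hd
  rw [Finset.card_singleton] at ht
  -- Of the at least three edges at `x`, at most one avoids `w`.
  obtain ⟨a, ha, b, hb, hab⟩ := Finset.one_lt_card.1
    (show 1 < (H.E.filter fun e => x ∈ H.ends e ∧ w ∈ H.ends e).card by omega)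
  rw [Finset.mem_filter] at ha hb
  have hxw := (H.mem_rim.1 hx).2.1
  have ha' := H.ends_eq_pair ha.1 ha.2.1 ha.2.2 hxw
  have hb' := H.ends_eq_pair hb.1 hb.2.1 hb.2.2 hxw
  refine hH.not_parallel_of_rim hw' hne ha.1 hb.1 hab (ha'.trans hb'.symm) ?_
  rw [ha']
  intro z hz
  simp only [Finset.mem_insert, Finset.mem_singleton] at hz
  rcases hz with rfl | rfl <;> assumption

/-- If a third vertex lay outside the common hull, the count would leave at most one edge joining
the hull to its outside; its outer end would then be a cut-vertex. -/
theorem TwoConn.rim_subset_of_hull_eq (hH : H.TwoConn) (hdeg : ∀ v ∈ H.V, 3 ≤ H.deg v)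
    {w w' : β} (hw : w ∈ H.V) (hw' : w' ∈ H.V) (hww : w ≠ w') (hne : (H.hull w).Nonempty)
    (h : H.hull w = H.hull w') {x : β} (hx : x ∈ H.rim w) : x = w' := by
  by_contra hxw'
  have hxN : x ∈ (H.rim w).erase w' := Finset.mem_erase.2 ⟨hxw', hx⟩
  have h1 := three_mul_card_add_leaving_le hdeg hww h hw hw' rfl
  have h2 := Finset.card_pos.2 ⟨x, hxN⟩
  set Lv := H.E.filter fun e => (∃ x ∈ H.hull w, x ∈ H.ends e) ∧ ¬ H.ends e ⊆ H.hull w with hLv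
  have h3 : Lv.card ≤ 1 := by omega
  -- The outer end of the leaving edge, or `w` if there is no such edge.
  obtain ⟨y, hyV, hyS, hy⟩ : ∃ y ∈ H.V, y ∉ H.hull w ∧ ∀ e ∈ Lv, y ∈ H.ends e := by
    rcases Lv.eq_empty_or_nonempty with h0 | ⟨f, hf⟩
    · exact ⟨w, hw, H.notMem_hull w, by simp [h0]⟩
    · have hf' := hf
      rw [hLv, Finset.mem_filter, Finset.not_subset] at hf
      obtain ⟨hfE, -, y, hyf, hyS⟩ := hf
      refine ⟨y, H.ends_subset f hfE hyf, hyS, fun e he => ?_⟩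
      rwa [Finset.card_le_one.1 h3 e he f hf']
  obtain ⟨s, hs⟩ := hne
  rw [mem_rim] at hx
  obtain ⟨e, he, hye, ⟨q, hq, hqe⟩, r, hr, hre⟩ := hH y hyV (H.V.erase y \ H.hull w)
    Finset.sdiff_subset (by
      by_cases hyw : y = w
      · exact ⟨w', by simp [hw', hyw, hww.symm, h, H.notMem_hull w']⟩
      · exact ⟨w, by simp [hw, H.notMem_hull w, Ne.symm hyw]⟩) (by
      intro heq
      have : s ∈ H.V.erase y := Finset.mem_erase.2
        ⟨by rintro rfl; exact hyS hs, H.hull_subset w hs⟩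
      rw [← heq, Finset.mem_sdiff] at this
      exact this.2 hs)
  rw [Finset.mem_sdiff] at hq hr
  refine hye (hy e ?_)
  rw [hLv, Finset.mem_filter, Finset.not_subset]
  refine ⟨he, ⟨r, ?_, hre⟩, q, hqe, hq.2⟩
  by_contra hrS
  exact hr.2 (Finset.mem_sdiff.2 ⟨hr.1, hrS⟩)

/-- The rims of two vertices with non-empty hulls are disjoint. -/
theorem TwoConn.disjoint_rims (hH : H.TwoConn) (hdeg : ∀ v ∈ H.V, 3 ≤ H.deg v)
    {x w w' : β} (hw : w ∈ H.V) (hw' : w' ∈ H.V) (hww : w ≠ w') (hne : (H.hull w).Nonempty)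
    (hne' : (H.hull w').Nonempty) (hx : x ∈ H.rim w) (hx' : x ∈ H.rim w') : False := by
  by_cases h1 : w ∈ H.hull w' <;> by_cases h2 : w' ∈ H.hull w
  · exact hH.disjoint_rims_of_mem_hull hdeg hw hw' hx hx' h1 h2
  · exact hH.disjoint_rims_of_mem_rim hdeg hw hne hx' hx (H.mem_rim.2 ⟨hw', hww.symm, h2⟩) h1
  · exact hH.disjoint_rims_of_mem_rim hdeg hw' hne' hx hx' (H.mem_rim.2 ⟨hw, hww, h1⟩) h2
  · have h := (H.hull_subset_hull h2).antisymm (H.hull_subset_hull h1)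
    have := hH.rim_subset_of_hull_eq hdeg hw hw' hww hne h hx
    exact (H.mem_rim.1 hx').2.1 this

/-- At most one vertex has an empty hull. -/
theorem eq_of_hull_eq_empty (hdeg : ∀ v ∈ H.V, 3 ≤ H.deg v) (hV : 5 ≤ H.V.card)
    {w w' : β} (hw : w ∈ H.V) (hw' : w' ∈ H.V) (h : H.hull w = ∅) (h' : H.hull w' = ∅) : w = w' := by
  by_contra hww
  -- With empty hulls the counted set is all of `V` but two vertices, hence has at least three,
  -- whereas the inequality allows at most two. This is where five vertices are needed.
  have h1 := three_mul_card_add_leaving_le hdeg hww (h.trans h'.symm) hw hw' rfl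
  have h2 : (H.rim w).erase w' = (H.V.erase w).erase w' := by simp [rim, h]
  have h3 : ((H.rim w).erase w').card = H.V.card - 1 - 1 := by
    rw [h2, Finset.card_erase_of_mem (by simp [hw', Ne.symm hww]), Finset.card_erase_of_mem hw]
  omega

end EndGraph

/-! ### Sparse sets, circuits and cyclic flats -/

namespace EndGraph
variable {α β : Type*} (H : EndGraph α β)

/-- The vertices incident with an edge in `Y`. -/
noncomputable def span (Y : Finset α) : Finset β := Y.biUnion H.ends

/-- Independence in the bicircular matroid. -/
def Sparse (I : Finset α) : Prop := ∀ Y ⊆ I, Y.card ≤ (H.span Y).card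

/-- A minimal set that is not sparse. -/
def IsCirc (C : Finset α) : Prop := ¬ H.Sparse C ∧ ∀ J ⊂ C, H.Sparse J

variable {H}

theorem mem_span {Y : Finset α} {v : β} : v ∈ H.span Y ↔ ∃ e ∈ Y, v ∈ H.ends e := by simp [span]

theorem span_mono {Y Z : Finset α} (h : Y ⊆ Z) : H.span Y ⊆ H.span Z :=
  Finset.biUnion_subset_biUnion_of_subset_left _ h

theorem span_union (Y Z : Finset α) : H.span (Y ∪ Z) = H.span Y ∪ H.span Z :=
  Finset.union_biUnion

theorem span_subset_V {Y : Finset α} (hY : Y ⊆ H.E) : H.span Y ⊆ H.V := by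
  intro v hv
  obtain ⟨e, he, hve⟩ := mem_span.1 hv
  exact H.ends_subset e (hY he) hve

theorem span_within_subset (S : Finset β) {Y : Finset α} (hY : Y ⊆ H.within S) : H.span Y ⊆ S := by
  intro v hv
  obtain ⟨e, he, hve⟩ := mem_span.1 hv
  exact (H.mem_within.1 (hY he)).2 hve

theorem Sparse.mono {I J : Finset α} (hJ : H.Sparse J) (h : I ⊆ J) : H.Sparse I :=
  fun Y hY => hJ Y (hY.trans h)

theorem Sparse.card_le {I : Finset α} (hI : H.Sparse I) : I.card ≤ (H.span I).card := hI I subset_rfl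

theorem sparse_empty : H.Sparse ∅ := by
  intro Y hY
  simp [Finset.subset_empty.1 hY]

theorem sparse_singleton {e : α} (he : e ∈ H.E) : H.Sparse {e} := by
  intro Y hY
  rcases Finset.subset_singleton_iff.1 hY with rfl | rfl
  · simp
  · simpa [span] using H.ends_nonempty e he

theorem not_sparse_of_card_lt {Y I : Finset α} (hY : Y ⊆ I) (h : (H.span Y).card < Y.card) :
    ¬ H.Sparse I := fun hI => absurd (hI Y hY) (by omega)

theorem exists_isCirc_of_not_sparse {I : Finset α} (h : ¬ H.Sparse I) : ∃ C ⊆ I, H.IsCirc C := by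
  induction I using Finset.strongInduction with
  | H I ih =>
    by_cases hI : ∀ J ⊂ I, H.Sparse J
    · exact ⟨I, subset_rfl, h, hI⟩
    · push Not at hI
      obtain ⟨J, hJ, hJs⟩ := hI
      obtain ⟨C, hC, hCc⟩ := ih J hJ hJs
      exact ⟨C, hC.trans hJ.1, hCc⟩

theorem IsCirc.card_lt {C : Finset α} (hC : H.IsCirc C) : (H.span C).card < C.card := by
  have h := hC.1
  unfold Sparse at h
  push Not at h
  obtain ⟨Y, hY, hlt⟩ := h
  rcases hY.eq_or_ssubset with rfl | hss
  · exact hlt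
  · exact absurd (hC.2 Y hss Y subset_rfl) (by omega)

theorem IsCirc.nonempty {C : Finset α} (hC : H.IsCirc C) : C.Nonempty := by
  rw [← Finset.card_pos]
  have := hC.card_lt
  omega

/-- Hall's theorem: a sparse set of edges that is matched to all of `S`. -/
theorem exists_sparse_card_eq {S : Finset β} {A : Finset α}
    (h : ∀ Y ⊆ S, Y.card ≤ (A.filter fun e => ∃ y ∈ Y, y ∈ H.ends e).card) :
    ∃ I ⊆ A, H.Sparse I ∧ I.card = S.card := by
  obtain ⟨f, hf, hfm⟩ := (Finset.all_card_le_biUnion_card_iff_exists_injective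
    (fun s : S => A.filter fun e => (s : β) ∈ H.ends e)).1 (by
      intro s
      have := h (s.map (Function.Embedding.subtype _)) (by
        intro x hx
        simp only [Finset.mem_map, Function.Embedding.coe_subtype, Subtype.exists] at hx
        obtain ⟨a, ha, -, rfl⟩ := hx
        exact ha)
      rw [Finset.card_map] at this
      refine this.trans (Finset.card_le_card fun e he => ?_)
      simp only [Finset.mem_filter, Finset.mem_map, Finset.mem_biUnion] at he ⊢
      obtain ⟨heA, y, ⟨a, ha, rfl⟩, hy⟩ := he
      exact ⟨a, ha, heA, hy⟩)
  have hfm' : ∀ s : S, f s ∈ A ∧ (s : β) ∈ H.ends (f s) := fun s => Finset.mem_filter.1 (hfm s)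
  refine ⟨Finset.univ.image f, ?_, ?_, ?_⟩
  · intro e he
    obtain ⟨s, -, rfl⟩ := Finset.mem_image.1 he
    exact (hfm' s).1
  · intro Y hY
    have hYe : Y = (Finset.univ.filter fun s => f s ∈ Y).image f := by
      ext e
      constructor
      · intro he
        obtain ⟨s, -, rfl⟩ := Finset.mem_image.1 (hY he)
        exact Finset.mem_image.2 ⟨s, by simpa using he, rfl⟩
      · intro he
        obtain ⟨s, hs, rfl⟩ := Finset.mem_image.1 he
        simpa using hs
    calc Y.card = (Finset.univ.filter fun s => f s ∈ Y).card := by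
          rw [hYe, Finset.card_image_of_injective _ hf]; simp [Finset.mem_image, hf.eq_iff]
      _ = ((Finset.univ.filter fun s => f s ∈ Y).map (Function.Embedding.subtype _)).card := by
          rw [Finset.card_map]
      _ ≤ _ := Finset.card_le_card fun v hv => by
          obtain ⟨s, hs, rfl⟩ := Finset.mem_map.1 hv
          exact mem_span.2 ⟨f s, (Finset.mem_filter.1 hs).2, (hfm' s).2⟩
  · rw [Finset.card_image_of_injective _ hf]; simp

/-- The surplus of one in the definition of strength keeps Hall's condition true after any one edge
is deleted. -/
theorem Strong.exists_base {S : Finset β} (hS : H.Strong S) (e : α) :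
    ∃ I ⊆ (H.within S).erase e, H.Sparse I ∧ I.card = S.card := by
  refine exists_sparse_card_eq fun Y hY => ?_
  rcases Y.eq_empty_or_nonempty with rfl | hne
  · simp
  · have h := hS.2 Y hY hne
    have : ((H.within S).filter fun e => ∃ y ∈ Y, y ∈ H.ends e).erase e ⊆
        ((H.within S).erase e).filter fun e => ∃ y ∈ Y, y ∈ H.ends e := by
      intro f hf
      simp only [Finset.mem_erase, Finset.mem_filter] at hf ⊢
      tauto
    have h2 := Finset.card_le_card this
    have h3 := Finset.pred_card_le_card_erase (s := (H.within S).filter fun e => ∃ y ∈ Y, y ∈ H.ends e) (a := e)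
    omega

theorem Strong.span_within {S : Finset β} (hS : H.Strong S) : H.span (H.within S) = S := by
  refine (span_within_subset S subset_rfl).antisymm fun v hv => ?_
  have := hS.2 {v} (by simpa using hv) (by simp)
  obtain ⟨e, he⟩ := Finset.card_pos.1 ((Nat.succ_pos _).trans_le this)
  simp only [Finset.mem_filter, Finset.mem_singleton, exists_eq_left] at he
  exact mem_span.2 ⟨e, he⟩

theorem Strong.within_subset_iff {S T : Finset β} (hS : H.Strong S) :
    H.within S ⊆ H.within T ↔ S ⊆ T := by
  refine ⟨fun h => ?_, H.within_mono⟩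
  rw [← hS.span_within]
  exact span_within_subset T h

/-- Flats of the bicircular matroid in which no element is a coloop. -/
def CycFlat (H : EndGraph α β) (F : Finset α) : Prop :=
  F ⊆ H.E ∧ (∀ f ∈ F, ∃ I ⊆ F, f ∉ I ∧ H.Sparse I ∧ ¬ H.Sparse (insert f I)) ∧
    ∀ x ∈ H.E, x ∉ F → ∀ I ⊆ F, H.Sparse I → H.Sparse (insert x I)

/-- Every edge `f` inside `S` depends on a base avoiding it, since `S` has no room for `|S| + 1`
sparse edges. An edge not inside `S` has an end outside, so adding it enlarges the span as well. -/
theorem Strong.cycFlat_within {S : Finset β} (hS : H.Strong S) : H.CycFlat (H.within S) := by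
  refine ⟨H.within_subset S, fun f hf => ?_, fun x hx hxS I hI hIs => ?_⟩
  · obtain ⟨I, hI, hIs, hIc⟩ := hS.exists_base f
    have hfI : f ∉ I := fun h => (Finset.mem_erase.1 (hI h)).1 rfl
    have hIS := hI.trans (Finset.erase_subset _ _)
    refine ⟨I, hIS, hfI, hIs, not_sparse_of_card_lt subset_rfl ?_⟩
    rw [Finset.card_insert_of_notMem hfI, hIc, Nat.lt_succ_iff]
    exact Finset.card_le_card (span_within_subset S (Finset.insert_subset hf hIS))
  · intro Y hY
    by_cases hxY : x ∈ Y
    · have hYI : Y.erase x ⊆ I := by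
        intro y hy
        rw [Finset.mem_erase] at hy
        exact (Finset.mem_insert.1 (hY hy.2)).resolve_left hy.1
      obtain ⟨v, hv, hvS⟩ : ∃ v ∈ H.ends x, v ∉ S := by
        by_contra! hcon
        exact hxS (H.mem_within.2 ⟨hx, hcon⟩)
      have h1 := hIs _ hYI
      have h2 : insert v (H.span (Y.erase x)) ⊆ H.span Y := by
        refine Finset.insert_subset (mem_span.2 ⟨x, hxY, hv⟩) (span_mono (Finset.erase_subset _ _))
      have h3 : v ∉ H.span (Y.erase x) := fun h =>
        hvS (span_within_subset S (hYI.trans hI) h)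
      have h4 := Finset.card_le_card h2
      rw [Finset.card_insert_of_notMem h3] at h4
      rw [Finset.card_erase_of_mem hxY] at h1
      omega
    · exact hIs Y fun y hy => (Finset.mem_insert.1 (hY hy)).resolve_left
        (by rintro rfl; exact hxY hy)

/-- Choose a circuit `C` in `F` through an edge at `Y`. Its edges missing `Y` form a sparse set on
`span C \ Y`, so at least `|Y ∩ span C| + 1` of its edges touch `Y`. The vertices of `Y` off `C` are
handled by induction, with edges outside `C`. -/
theorem CycFlat.card_add_one_le {F : Finset α} (hF : H.CycFlat F) (Y : Finset β)
    (hY : Y ⊆ H.span F) (hne : Y.Nonempty) :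
    Y.card + 1 ≤ (F.filter fun e => ∃ y ∈ Y, y ∈ H.ends e).card := by
  induction Y using Finset.strongInduction with
  | H Y ih =>
    obtain ⟨y, hy⟩ := hne
    obtain ⟨f, hf, hyf⟩ := mem_span.1 (hY hy)
    obtain ⟨I, hI, hfI, hIs, hdep⟩ := hF.2.1 f hf
    obtain ⟨C, hCI, hC⟩ := exists_isCirc_of_not_sparse hdep
    have hfC : f ∈ C := by
      by_contra hfC
      exact hC.1 (hIs.mono fun c hc => (Finset.mem_insert.1 (hCI hc)).resolve_left
        (by rintro rfl; exact hfC hc))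
    have hCF : C ⊆ F := hCI.trans (Finset.insert_subset hf hI)
    have hyC : y ∈ H.span C := mem_span.2 ⟨f, hfC, hyf⟩
    set C₁ := C.filter fun e => ∃ y ∈ Y, y ∈ H.ends e with hC₁
    have hlt := hC.card_lt
    have h0 : (C \ C₁).card ≤ (H.span C \ Y).card := by
      refine (hC.2 (C \ C₁) ?_).card_le.trans (Finset.card_le_card fun v hv => ?_)
      · refine Finset.ssubset_iff_subset_ne.2 ⟨Finset.sdiff_subset, fun h => ?_⟩
        have : f ∈ C \ C₁ := by rw [h]; exact hfC
        rw [Finset.mem_sdiff, hC₁, Finset.mem_filter] at this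
        exact this.2 ⟨hfC, y, hy, hyf⟩
      · obtain ⟨e, he, hve⟩ := mem_span.1 hv
        rw [Finset.mem_sdiff] at he ⊢
        exact ⟨mem_span.2 ⟨e, he.1, hve⟩, fun hvY => he.2 (Finset.mem_filter.2 ⟨he.1, v, hvY, hve⟩)⟩
    have h1 : (C \ C₁).card + C₁.card = C.card :=
      Finset.card_sdiff_add_card_eq_card (Finset.filter_subset _ _)
    have h2 : (H.span C \ Y).card + (H.span C ∩ Y).card = (H.span C).card := by
      rw [add_comm]; exact Finset.card_inter_add_card_sdiff _ _
    have h3 : (Y ∩ H.span C).card + (Y \ H.span C).card = Y.card := Finset.card_inter_add_card_sdiff _ _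
    rw [Finset.inter_comm] at h3
    set N := F.filter fun e => ∃ y ∈ Y, y ∈ H.ends e with hN
    set N' := F.filter fun e => ∃ z ∈ Y \ H.span C, z ∈ H.ends e with hN'
    have h4 : (Y \ H.span C).card ≤ N'.card := by
      rcases (Y \ H.span C).eq_empty_or_nonempty with h0 | hne
      · simp [h0]
      · refine (Nat.le_succ _).trans (ih _ ?_ (Finset.sdiff_subset.trans hY) hne)
        refine Finset.ssubset_iff_subset_ne.2 ⟨Finset.sdiff_subset, fun h => ?_⟩
        exact (Finset.mem_sdiff.1 (by rw [h]; exact hy : y ∈ Y \ H.span C)).2 hyC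
    have h5 : C₁ ∪ N' ⊆ N := by
      intro e he
      simp only [hC₁, hN', hN, Finset.mem_union, Finset.mem_filter] at he ⊢
      rcases he with ⟨h1, h2⟩ | ⟨h1, z, hz, hze⟩
      · exact ⟨hCF h1, h2⟩
      · exact ⟨h1, z, Finset.sdiff_subset hz, hze⟩
    have h6 : Disjoint C₁ N' := by
      rw [Finset.disjoint_left]
      intro e he he'
      simp only [hC₁, hN', Finset.mem_filter, Finset.mem_sdiff] at he he'
      obtain ⟨-, z, hz, hze⟩ := he'
      exact hz.2 (mem_span.2 ⟨e, he.1, hze⟩)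
    have h7 := Finset.card_le_card h5
    rw [Finset.card_union_of_disjoint h6] at h7
    omega

/-- By Hall's theorem `F` contains a sparse set as large as `span F`; an edge inside that span is
then dependent on it, so the flat contains the edge. -/
theorem CycFlat.exists_strong {F : Finset α} (hF : H.CycFlat F) :
    ∃ S, H.Strong S ∧ F = H.within S := by
  have hFS : F = H.within (H.span F) := by
    refine Finset.Subset.antisymm (fun e he => H.mem_within.2
      ⟨hF.1 he, fun v hv => mem_span.2 ⟨e, he, hv⟩⟩) fun e he => ?_
    by_contra heF
    have heE := H.mem_within.1 he
    obtain ⟨I, hI, hIs, hIc⟩ := exists_sparse_card_eq (H := H) (S := H.span F) (A := F) fun Y hY => by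
      rcases Y.eq_empty_or_nonempty with rfl | hne
      · simp
      · exact (Nat.le_succ _).trans (hF.card_add_one_le Y hY hne)
    refine absurd (hF.2.2 e heE.1 heF I hI hIs).card_le ?_
    rw [Finset.card_insert_of_notMem fun h => heF (hI h), hIc, not_le, Nat.lt_succ_iff]
    refine Finset.card_le_card fun v hv => ?_
    obtain ⟨f, hf, hvf⟩ := mem_span.1 hv
    rcases Finset.mem_insert.1 hf with rfl | hf
    · exact heE.2 hvf
    · exact mem_span.2 ⟨f, hI hf, hvf⟩
  refine ⟨H.span F, ⟨span_subset_V hF.1, fun Y hY hne => ?_⟩, hFS⟩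
  rw [← hFS]
  exact hF.card_add_one_le Y hY hne

theorem cycFlat_iff {F : Finset α} : H.CycFlat F ↔ ∃ S, H.Strong S ∧ F = H.within S :=
  ⟨fun h => h.exists_strong, by rintro ⟨S, hS, rfl⟩; exact hS.cycFlat_within⟩

theorem Sparse.union_of_disjoint {I J : Finset α} (hI : H.Sparse I) (hJ : H.Sparse J)
    (h : Disjoint (H.span I) (H.span J)) : H.Sparse (I ∪ J) := by
  intro Y hY
  have h1 := hI _ (Finset.inter_subset_right : Y ∩ I ⊆ I)
  have h2 := hJ (Y \ I) (fun y hy => by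
    rw [Finset.mem_sdiff] at hy
    exact (Finset.mem_union.1 (hY hy.1)).resolve_left hy.2)
  have h3 : (Y ∩ I).card + (Y \ I).card = Y.card := Finset.card_inter_add_card_sdiff _ _
  have h4 : Disjoint (H.span (Y ∩ I)) (H.span (Y \ I)) :=
    h.mono (span_mono Finset.inter_subset_right) (span_mono fun y hy => by
      rw [Finset.mem_sdiff] at hy
      exact (Finset.mem_union.1 (hY hy.1)).resolve_left hy.2)
  have h5 := Finset.card_le_card (Finset.union_subset (span_mono (Finset.inter_subset_left))
    (span_mono Finset.sdiff_subset) : H.span (Y ∩ I) ∪ H.span (Y \ I) ⊆ H.span Y)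
  rw [Finset.card_union_of_disjoint h4] at h5
  omega

/-- If `S` meets the span of `K`, a base of the edges inside `S` already uses up the vertices of
`S`. Deleting one edge of `K` and all its edges inside `S` leaves a sparse set that has more edges
than `span K \ S` has vertices; if all of `K` lies inside `S`, one of its edges is enough. Either
union is too large to be sparse. -/
theorem Strong.skew_iff {S : Finset β} (hS : H.Strong S) {K : Finset α} (hKE : K ⊆ H.E)
    (hK : H.IsCirc K) :
    (∀ I ⊆ H.within S, ∀ J ⊆ K, H.Sparse I → H.Sparse J → H.Sparse (I ∪ J)) ↔
      Disjoint S (H.span K) := by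
  constructor
  · intro h
    by_contra hdisj
    obtain ⟨s, hsS, hsK⟩ := Finset.not_disjoint_iff.1 hdisj
    have hlt := hK.card_lt
    have hs1 : 1 ≤ (H.span K ∩ S).card := Finset.card_pos.2 ⟨s, by simp [hsS, hsK]⟩
    have hcard : (H.span K ∩ S).card + (H.span K \ S).card = (H.span K).card :=
      Finset.card_inter_add_card_sdiff _ _
    obtain ⟨k₀, hk₀⟩ := hK.nonempty
    have hers : ∀ k ∈ K, H.Sparse (K.erase k) := fun k hk => hK.2 _ (Finset.erase_ssubset hk)
    set C₀ := K.filter fun e => H.ends e ⊆ S with hC₀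
    by_cases hKS : C₀ = K
    · obtain ⟨I, hI, hIs, hIc⟩ := hS.exists_base k₀
      have hk₀I : k₀ ∉ I := fun h => (Finset.mem_erase.1 (hI h)).1 rfl
      have hIS := hI.trans (Finset.erase_subset _ _)
      have hk₀S : k₀ ∈ H.within S := H.mem_within.2
        ⟨hKE hk₀, (Finset.mem_filter.1 (hKS.symm ▸ hk₀ : k₀ ∈ C₀)).2⟩
      have := h I hIS {k₀} (by simpa using hk₀) hIs (sparse_singleton (hKE hk₀))
      refine absurd this.card_le ?_
      rw [Finset.union_comm, ← Finset.insert_eq, Finset.card_insert_of_notMem hk₀I, hIc, not_le,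
        Nat.lt_succ_iff]
      exact Finset.card_le_card (span_within_subset S (Finset.insert_subset hk₀S hIS))
    · have hss : C₀ ⊂ K := Finset.ssubset_iff_subset_ne.2 ⟨Finset.filter_subset _ _, hKS⟩
      have h1 : C₀.card ≤ (H.span K ∩ S).card := (hK.2 _ hss).card_le.trans
        (Finset.card_le_card fun v hv => by
          obtain ⟨e, he, hve⟩ := mem_span.1 hv
          rw [hC₀, Finset.mem_filter] at he
          exact Finset.mem_inter.2 ⟨mem_span.2 ⟨e, he.1, hve⟩, he.2 hve⟩)
      have h2 : (K \ C₀).card + C₀.card = K.card := Finset.card_sdiff_add_card_eq_card hss.1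
      -- An edge of `K` must be deleted for sparseness. If some edge of `K` lies inside `S` its
      -- deletion costs nothing; otherwise the common vertex of `S` and `span K` makes up for the
      -- loss.
      obtain ⟨k, hk, hkc⟩ : ∃ k ∈ K, (H.span K \ S).card + 1 ≤ ((K.erase k) \ C₀).card := by
        rcases C₀.eq_empty_or_nonempty with h0 | ⟨k, hk⟩
        · refine ⟨k₀, hk₀, ?_⟩
          rw [h0, Finset.sdiff_empty, Finset.card_erase_of_mem hk₀]
          omega
        · refine ⟨k, hss.1 hk, ?_⟩
          have : K.erase k \ C₀ = K \ C₀ := by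
            ext x
            simp only [Finset.mem_sdiff, Finset.mem_erase]
            exact ⟨fun h => ⟨h.1.2, h.2⟩, fun h => ⟨⟨by rintro rfl; exact h.2 hk, h.1⟩, h.2⟩⟩
          rw [this]
          omega
      obtain ⟨I, hI, hIs, hIc⟩ := hS.exists_base k₀
      have hIS := hI.trans (Finset.erase_subset _ _)
      have hu := h I hIS (K.erase k \ C₀) (Finset.sdiff_subset.trans (Finset.erase_subset _ _)) hIs
        ((hers k hk).mono Finset.sdiff_subset)
      refine absurd hu.card_le ?_
      have hd : Disjoint I (K.erase k \ C₀) := by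
        rw [Finset.disjoint_left]
        intro e he he'
        rw [Finset.mem_sdiff, hC₀, Finset.mem_filter] at he'
        exact he'.2 ⟨Finset.mem_of_mem_erase he'.1, (H.mem_within.1 (hIS he)).2⟩
      have hsp : H.span (I ∪ (K.erase k \ C₀)) ⊆ S ∪ (H.span K \ S) := by
        rw [Finset.union_sdiff_self_eq_union, span_union]
        exact Finset.union_subset_union (span_within_subset S hIS)
          (span_mono (Finset.sdiff_subset.trans (Finset.erase_subset _ _)))
      have h3 := (Finset.card_le_card hsp).trans (Finset.card_union_le _ _)
      rw [Finset.card_union_of_disjoint hd]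
      omega
  · intro hd I hI J hJ hIs hJs
    exact hIs.union_of_disjoint hJs (hd.mono (span_within_subset S hI) (span_mono hJ))

end EndGraph

/-! ### Degrees, cycles and bicycles -/

namespace EndGraph
variable {α β : Type*} {H : EndGraph α β}

/-- The degree of a vertex in the subgraph with edge-set `Y`; loops count twice. -/
noncomputable def degIn (H : EndGraph α β) (Y : Finset α) (v : β) : ℕ :=
  (Y.filter fun e => v ∈ H.ends e).card + (Y.filter fun e => H.ends e = {v}).card

theorem sum_degIn {Y : Finset α} (hY : Y ⊆ H.E) (Q : Finset β) :
    ∑ v ∈ Q, H.degIn Y v = 2 * (Y.filter fun e => H.ends e ⊆ Q).card +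
      (Y.filter fun e => (∃ q ∈ Q, q ∈ H.ends e) ∧ ¬ H.ends e ⊆ Q).card := by
  have h1 := Finset.sum_card_bipartiteAbove_eq_sum_card_bipartiteBelow (s := Q) (t := Y)
    (fun v e => v ∈ H.ends e)
  have h2 := Finset.sum_card_bipartiteAbove_eq_sum_card_bipartiteBelow (s := Q) (t := Y)
    (fun v e => H.ends e = {v})
  simp only [Finset.bipartiteAbove, Finset.bipartiteBelow] at h1 h2
  unfold degIn
  rw [Finset.sum_add_distrib, h1, h2, ← Finset.sum_add_distrib, Finset.card_filter,
    Finset.card_filter, Finset.mul_sum, ← Finset.sum_add_distrib]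
  refine Finset.sum_congr rfl fun e he => ?_
  obtain ⟨x, hx, y, hy, hxy⟩ := H.exists_ends (hY he)
  by_cases hne : x = y
  · subst hne
    by_cases hxQ : x ∈ Q
    · have ha : Q.filter (fun v => v ∈ H.ends e) = {x} := by
        ext v; simp only [hxy, Finset.mem_filter]; simp; rintro rfl; exact hxQ
      have hb : Q.filter (fun v => H.ends e = {v}) = {x} := by
        ext v; simp only [hxy, Finset.mem_filter]; simp; grind
      rw [ha, hb]; simp [hxy, hxQ]
    · have ha : Q.filter (fun v => v ∈ H.ends e) = ∅ := by
        ext v; simp only [hxy, Finset.mem_filter]; simp; rintro h rfl; exact hxQ h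
      have hb : Q.filter (fun v => H.ends e = {v}) = ∅ := by
        ext v; simp only [hxy, Finset.mem_filter]; simp; rintro h rfl; exact hxQ h
      rw [ha, hb]; simp [hxy, hxQ]
  · have hb : Q.filter (fun v => H.ends e = {v}) = ∅ := by
      ext v
      simp only [hxy, Finset.mem_filter, Finset.notMem_empty, iff_false, not_and]
      intro _ h
      have hx1 : x ∈ ({v} : Finset β) := h ▸ (by simp)
      have hy1 : y ∈ ({v} : Finset β) := h ▸ (by simp)
      simp only [Finset.mem_singleton] at hx1 hy1
      exact hne (hx1.trans hy1.symm)
    have ha : Q.filter (fun v => v ∈ H.ends e) = ({x, y} : Finset β).filter (· ∈ Q) := by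
      ext v; simp only [hxy, Finset.mem_filter]; tauto
    rw [ha, hb]
    by_cases hxQ : x ∈ Q <;> by_cases hyQ : y ∈ Q <;>
      simp [hxy, hxQ, hyQ, Finset.filter_insert, Finset.filter_singleton, hne, Finset.insert_subset_iff] <;>
      grind

theorem degIn_eq_zero {Y : Finset α} {v : β} (hv : v ∉ H.span Y) : H.degIn Y v = 0 := by
  unfold degIn
  rw [Nat.add_eq_zero_iff, Finset.card_eq_zero, Finset.card_eq_zero]
  refine ⟨Finset.filter_eq_empty_iff.2 fun e he h => hv (mem_span.2 ⟨e, he, h⟩),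
    Finset.filter_eq_empty_iff.2 fun e he h => hv (mem_span.2 ⟨e, he, by simp [h]⟩)⟩

theorem sum_degIn_span {Y : Finset α} (hY : Y ⊆ H.E) :
    ∑ v ∈ H.span Y, H.degIn Y v = 2 * Y.card := by
  rw [sum_degIn hY]
  have hsub : ∀ e ∈ Y, H.ends e ⊆ H.span Y := fun e he v hv => mem_span.2 ⟨e, he, hv⟩
  rw [Finset.filter_true_of_mem hsub, Finset.filter_false_of_mem (by
    intro e he h; exact h.2 (hsub e he))]
  simp

/-- A vertex of degree less than two is lost when its only edge is deleted. -/
theorem exists_erase_of_degIn_lt_two {Y : Finset α} {v : β} (hv : v ∈ H.span Y)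
    (h : H.degIn Y v < 2) : ∃ e ∈ Y, v ∈ H.ends e ∧ H.ends e ≠ {v} ∧
      (H.span (Y.erase e)).card + 1 ≤ (H.span Y).card := by
  obtain ⟨e, he, hve⟩ := mem_span.1 hv
  unfold degIn at h
  have h1 : 0 < (Y.filter fun e => v ∈ H.ends e).card := Finset.card_pos.2 ⟨e, by simp [he, hve]⟩
  have h2 : (Y.filter fun e => H.ends e = {v}).card = 0 := by omega
  have h3 : (Y.filter fun e => v ∈ H.ends e).card ≤ 1 := by omega
  refine ⟨e, he, hve, fun hl => ?_, ?_⟩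
  · rw [Finset.card_eq_zero, Finset.filter_eq_empty_iff] at h2
    exact h2 he hl
  · have hv' : v ∉ H.span (Y.erase e) := by
      intro hv'
      obtain ⟨f, hf, hvf⟩ := mem_span.1 hv'
      rw [Finset.mem_erase] at hf
      exact hf.1 (Finset.card_le_one.1 h3 f (by simp [hf.2, hvf]) e (by simp [he, hve]))
    rw [← Finset.card_insert_of_notMem hv']
    exact Finset.card_le_card (Finset.insert_subset hv (span_mono (Finset.erase_subset _ _)))

/-- All degrees are at least two, and some degree is at least three. -/
def DenseCore (H : EndGraph α β) (Y : Finset α) : Prop :=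
  (∃ v, 3 ≤ H.degIn Y v) ∧ ∀ v ∈ H.span Y, 2 ≤ H.degIn Y v

/-- A circuit has no vertex of degree below two, since losing its edge would leave a smaller set
that is not sparse, and its degree sum `2|C| > 2|span C|` forces a degree of three. Conversely such
degrees give more edges than vertices. The right-hand side is what the logic can express. -/
theorem not_sparse_iff_exists_denseCore {I : Finset α} (hI : I ⊆ H.E) :
    ¬ H.Sparse I ↔ ∃ Y ⊆ I, H.DenseCore Y := by
  constructor
  · intro h
    obtain ⟨C, hCI, hC⟩ := exists_isCirc_of_not_sparse h
    have h2 : ∀ v ∈ H.span C, 2 ≤ H.degIn C v := by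
      intro v hv
      by_contra! hlt
      obtain ⟨e, he, -, -, hle⟩ := exists_erase_of_degIn_lt_two hv hlt
      have h1 := (hC.2 _ (Finset.erase_ssubset he)).card_le
      have := hC.card_lt
      rw [Finset.card_erase_of_mem he] at h1
      omega
    refine ⟨C, hCI, ?_, h2⟩
    by_contra! hlt
    have h3 := Finset.sum_le_card_nsmul (H.span C) (H.degIn C) 2 fun v _ => by have := hlt v; omega
    rw [sum_degIn_span (hCI.trans hI), smul_eq_mul] at h3
    have := hC.card_lt
    omega
  · rintro ⟨Y, hYI, ⟨v, hv⟩, h2⟩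
    refine not_sparse_of_card_lt hYI ?_
    have hvs : v ∈ H.span Y := by
      by_contra hvs
      rw [degIn_eq_zero hvs] at hv
      omega
    have := Finset.sum_lt_sum (s := H.span Y) (f := fun _ => 2) (g := H.degIn Y) h2 ⟨v, hvs, hv⟩
    rw [sum_degIn_span (hYI.trans hI)] at this
    simp at this
    omega

/-- Every proper non-empty set of vertices of the subgraph is left by an edge. -/
def Linked (H : EndGraph α β) (X : Finset α) : Prop :=
  ∀ Q ⊆ H.span X, Q.Nonempty → Q ≠ H.span X →
    ∃ e ∈ X, (∃ q ∈ Q, q ∈ H.ends e) ∧ ∃ r ∈ H.span X \ Q, r ∈ H.ends e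

/-- The edge-sets of cycles. -/
def IsCyc (H : EndGraph α β) (C : Finset α) : Prop :=
  C ⊆ H.E ∧ C.Nonempty ∧ H.Linked C ∧ ∀ v ∈ H.span C, H.degIn C v = 2

theorem exists_split_of_not_linked {X : Finset α} (h : ¬ H.Linked X) :
    ∃ A B, A ⊂ X ∧ B ⊂ X ∧ A.Nonempty ∧ B.Nonempty ∧ A ∪ B = X ∧ Disjoint A B ∧
      Disjoint (H.span A) (H.span B) := by
  unfold Linked at h
  push Not at h
  obtain ⟨Q, hQ, ⟨q, hq⟩, hne, hno⟩ := h
  obtain ⟨r, hr, hrQ⟩ : ∃ r ∈ H.span X, r ∉ Q := by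
    by_contra! hcon
    exact hne (hQ.antisymm hcon)
  obtain ⟨a, ha, hqa⟩ := mem_span.1 (hQ hq)
  obtain ⟨b, hb, hrb⟩ := mem_span.1 hr
  set A := X.filter fun e => ∃ q ∈ Q, q ∈ H.ends e with hA
  set B := X.filter fun e => ¬ ∃ q ∈ Q, q ∈ H.ends e with hB
  have haA : a ∈ A := Finset.mem_filter.2 ⟨ha, q, hq, hqa⟩
  have hbB : b ∈ B := Finset.mem_filter.2 ⟨hb, by
    rintro ⟨q', hq', hqb⟩
    exact hno b hb ⟨q', hq', hqb⟩ r (Finset.mem_sdiff.2 ⟨hr, hrQ⟩) hrb⟩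
  have hAB : Disjoint A B := Finset.disjoint_filter_filter_not _ _ _
  refine ⟨A, B, ?_, ?_, ⟨a, haA⟩, ⟨b, hbB⟩, Finset.filter_union_filter_not_eq _ _, hAB, ?_⟩
  · exact Finset.ssubset_iff_subset_ne.2 ⟨Finset.filter_subset _ _, fun h =>
      Finset.disjoint_right.1 hAB hbB (h ▸ hb)⟩
  · exact Finset.ssubset_iff_subset_ne.2 ⟨Finset.filter_subset _ _, fun h =>
      Finset.disjoint_left.1 hAB haA (h ▸ ha)⟩
  · rw [Finset.disjoint_left]
    intro v hvA hvB
    obtain ⟨e, he, hve⟩ := mem_span.1 hvA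
    obtain ⟨f, hf, hvf⟩ := mem_span.1 hvB
    rw [hA, Finset.mem_filter] at he
    rw [hB, Finset.mem_filter] at hf
    refine hno e he.1 he.2 v (Finset.mem_sdiff.2 ⟨mem_span.2 ⟨e, he.1, hve⟩, fun hvQ => ?_⟩) hve
    exact hf.2 ⟨v, hvQ, hvf⟩

theorem IsCirc.linked {C : Finset α} (hC : H.IsCirc C) : H.Linked C := by
  by_contra h
  obtain ⟨A, B, hA, hB, -, -, hAB, -, hd⟩ := exists_split_of_not_linked h
  exact hC.1 (hAB ▸ (hC.2 A hA).union_of_disjoint (hC.2 B hB) hd)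

/-- A minimal non-empty set with at least as many edges as vertices is a cycle: it is connected, has
no pendant edge, and has exactly as many edges as vertices, so every degree is two. -/
theorem exists_isCyc {Z : Finset α} (hZE : Z ⊆ H.E) (hne : Z.Nonempty)
    (h : (H.span Z).card ≤ Z.card) : ∃ C ⊆ Z, H.IsCyc C := by
  induction Z using Finset.strongInduction with
  | H Z ih =>
    by_cases hmin : ∃ Z' ⊂ Z, Z'.Nonempty ∧ (H.span Z').card ≤ Z'.card
    · obtain ⟨Z', hZ', hne', h'⟩ := hmin
      obtain ⟨C, hC, hCc⟩ := ih Z' hZ' (hZ'.1.trans hZE) hne' h'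
      exact ⟨C, hC.trans hZ'.1, hCc⟩
    push Not at hmin
    refine ⟨Z, subset_rfl, hZE, hne, ?_, ?_⟩
    · by_contra hl
      obtain ⟨A, B, hA, hB, hAne, hBne, hAB, hdisj, hd⟩ := exists_split_of_not_linked hl
      have h1 := hmin A hA hAne
      have h2 := hmin B hB hBne
      rw [← hAB, span_union, Finset.card_union_of_disjoint hd, Finset.card_union_of_disjoint hdisj] at h
      omega
    · have hge : ∀ v ∈ H.span Z, 2 ≤ H.degIn Z v := by
        intro v hv
        by_contra! hlt
        obtain ⟨e, he, hve, hloop, hle⟩ := exists_erase_of_degIn_lt_two hv hlt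
        rcases (Z.erase e).eq_empty_or_nonempty with h0 | hne'
        · have hZ : Z = {e} := by
            rcases (Finset.erase_eq_empty_iff _ _).1 h0 with h | h
            · exact absurd h hne.ne_empty
            · exact h
          rw [hZ, Finset.card_singleton] at h
          simp only [span, Finset.singleton_biUnion] at h
          have : Nonempty β := ⟨v⟩
          exact hloop (Finset.card_le_one_iff_subset_singleton.1 h |>.elim fun x hx => by
            have := hx hve
            rw [Finset.mem_singleton] at this
            subst this
            exact (Finset.subset_singleton_iff.1 hx).resolve_left (by
              intro h0; rw [h0] at hve; simp at hve))
        · have h1 := hmin _ (Finset.erase_ssubset he) hne'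
          rw [Finset.card_erase_of_mem he] at h1
          omega
      have hle : Z.card ≤ (H.span Z).card := by
        by_contra! hlt
        obtain ⟨e, he⟩ := hne
        have hpos : 0 < (H.span Z).card := by
          obtain ⟨v, hv⟩ := H.ends_nonempty e (hZE he)
          exact Finset.card_pos.2 ⟨v, mem_span.2 ⟨e, he, hv⟩⟩
        have h1 := hmin (Z.erase e) (Finset.erase_ssubset he) (by
          rw [← Finset.card_pos, Finset.card_erase_of_mem he]; omega)
        have h2 := Finset.card_le_card (span_mono (H := H) (Finset.erase_subset e Z))
        rw [Finset.card_erase_of_mem he] at h1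
        omega
      intro v hv
      by_contra hne2
      have := Finset.sum_lt_sum (s := H.span Z) (f := fun _ => 2) (g := H.degIn Z) hge
        ⟨v, hv, lt_of_le_of_ne (hge v hv) (Ne.symm hne2)⟩
      rw [sum_degIn_span hZE] at this
      simp at this
      omega

theorem IsCyc.card_span {C : Finset α} (hC : H.IsCyc C) : (H.span C).card = C.card := by
  have h := sum_degIn_span hC.1
  rw [Finset.sum_congr rfl hC.2.2.2] at h
  simp at h
  omega

/-- A cycle does not cross a cut exactly once. -/
theorem IsCyc.exists_ne_crossing {C : Finset α} (hC : H.IsCyc C) {Q : Finset β} {e : α} (he : e ∈ C)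
    (h1 : ∃ q ∈ Q, q ∈ H.ends e) (h2 : ¬ H.ends e ⊆ Q) :
    ∃ f ∈ C, f ≠ e ∧ (∃ q ∈ Q, q ∈ H.ends f) ∧ ¬ H.ends f ⊆ Q := by
  by_contra! hno
  have h := sum_degIn hC.1 Q
  have hc : (C.filter fun e => (∃ q ∈ Q, q ∈ H.ends e) ∧ ¬ H.ends e ⊆ Q) = {e} := by
    ext f
    simp only [Finset.mem_filter, Finset.mem_singleton]
    constructor
    · rintro ⟨hf, hf1, hf2⟩
      by_contra hne
      exact hf2 (hno f hf hne hf1)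
    · rintro rfl; exact ⟨he, h1, h2⟩
  rw [hc, Finset.card_singleton] at h
  have heven : Even (∑ v ∈ Q, H.degIn C v) := by
    refine Finset.even_sum _ fun v _ => ?_
    by_cases hv : v ∈ H.span C
    · rw [hC.2.2.2 v hv]; exact even_two
    · rw [degIn_eq_zero hv]; exact Even.zero
  rw [h, Nat.even_add_one] at heven
  exact heven (even_two_mul _)

/-- Connected, with more than one cycle. -/
def TwoCyc (H : EndGraph α β) (X : Finset α) : Prop :=
  X ⊆ H.E ∧ X.Nonempty ∧ H.Linked X ∧ ∃ C₁ C₂, C₁ ⊆ X ∧ C₂ ⊆ X ∧ C₁ ≠ C₂ ∧ H.IsCyc C₁ ∧ H.IsCyc C₂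

/-- Let `e` be an edge of the cycle `D` outside the cycle `C`. As `D` never crosses a cut just once,
`X` without `e` still grows from `C` to all vertices. Together with `C` this gives as many edges as
vertices, and `e` is an extra one. -/
theorem TwoCyc.card_lt {X : Finset α} (hX : H.TwoCyc X) : (H.span X).card < X.card := by
  obtain ⟨hXE, -, hl, C, D, hCX, hDX, hne, hC, hD⟩ := hX
  wlog h : ∃ e ∈ D, e ∉ C generalizing C D with hw
  · refine hw D C hDX hCX hne.symm hD hC ?_
    push Not at h
    by_contra! h'
    exact hne (Finset.Subset.antisymm h' h)
  obtain ⟨e, heD, heC⟩ := h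
  have hg := H.card_sdiff_le_card_filter (F := X.erase e) ((Finset.erase_subset _ _).trans hXE)
    (H.span C) (span_mono hCX) (fun Q' hCQ hQX hQne => by
      have hsp : ∀ f ∈ X, H.ends f ⊆ H.span X := fun f hf v hv => mem_span.2 ⟨f, hf, hv⟩
      obtain ⟨f, hf, ⟨q, hq, hqf⟩, r, hr, hrf⟩ := hl Q' hQX (by
        obtain ⟨c, hc⟩ := hC.2.1
        obtain ⟨v, hv⟩ := H.ends_nonempty c (hC.1 hc)
        exact ⟨v, hCQ (mem_span.2 ⟨c, hc, hv⟩)⟩) hQne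
      by_cases hfe : f = e
      · subst hfe
        obtain ⟨f', hf', hne', hq', hr'⟩ := hD.exists_ne_crossing heD ⟨q, hq, hqf⟩
          (fun hsub => (Finset.mem_sdiff.1 hr).2 (hsub hrf))
        rw [Finset.not_subset] at hr'
        obtain ⟨r', hr', hrQ'⟩ := hr'
        exact ⟨f', Finset.mem_erase.2 ⟨hne', hDX hf'⟩, hsp f' (hDX hf'), hq', r',
          Finset.mem_sdiff.2 ⟨hsp f' (hDX hf') hr', hrQ'⟩, hr'⟩
      · exact ⟨f, Finset.mem_erase.2 ⟨hfe, hf⟩, hsp f hf, ⟨q, hq, hqf⟩, r, hr, hrf⟩)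
  set N := (X.erase e).filter fun e => H.ends e ⊆ H.span X ∧ ∃ u ∈ H.span X \ H.span C, u ∈ H.ends e
    with hN
  have hd : Disjoint C N := by
    rw [Finset.disjoint_left]
    intro f hf hfN
    rw [hN, Finset.mem_filter] at hfN
    obtain ⟨-, -, u, hu, huf⟩ := hfN
    exact (Finset.mem_sdiff.1 hu).2 (mem_span.2 ⟨f, hf, huf⟩)
  have hsub : C ∪ N ⊆ X.erase e := by
    refine Finset.union_subset (fun f hf => Finset.mem_erase.2 ⟨?_, hCX hf⟩) (Finset.filter_subset _ _)
    rintro rfl; exact heC hf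
  have h1 := Finset.card_le_card hsub
  rw [Finset.card_union_of_disjoint hd, Finset.card_erase_of_mem (hDX heD)] at h1
  have h2 := hC.card_span
  have h3 := Finset.card_sdiff_add_card_eq_card (span_mono (H := H) hCX)
  have h4 := Finset.card_pos.2 ⟨e, hDX heD⟩
  omega

/-- A circuit has more edges than vertices, so it contains a cycle, and it contains a second one
after an edge of the first is deleted. -/
theorem IsCirc.twoCyc {C : Finset α} (hCE : C ⊆ H.E) (hC : H.IsCirc C) : H.TwoCyc C := by
  have hlt := hC.card_lt
  obtain ⟨C₁, h₁, hc₁⟩ := exists_isCyc hCE hC.nonempty hlt.le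
  obtain ⟨e, he⟩ := hc₁.2.1
  have h2 := Finset.card_le_card (span_mono (H := H) (Finset.erase_subset e C))
  have h3 : 0 < (H.span C).card := by
    obtain ⟨v, hv⟩ := H.ends_nonempty e (hc₁.1 he)
    exact Finset.card_pos.2 ⟨v, mem_span.2 ⟨e, h₁ he, hv⟩⟩
  obtain ⟨C₂, h₂, hc₂⟩ := exists_isCyc (Z := C.erase e) ((Finset.erase_subset _ _).trans hCE) (by
    rw [← Finset.card_pos, Finset.card_erase_of_mem (h₁ he)]; omega) (by
    rw [Finset.card_erase_of_mem (h₁ he)]; omega)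
  refine ⟨hCE, hC.nonempty, hC.linked, C₁, C₂, h₁, h₂.trans (Finset.erase_subset _ _), ?_, hc₁, hc₂⟩
  rintro rfl
  exact (Finset.mem_erase.1 (h₂ he)).1 rfl

theorem isCirc_iff_minimal_twoCyc {X : Finset α} :
    X ⊆ H.E ∧ H.IsCirc X ↔ H.TwoCyc X ∧ ∀ Y ⊂ X, ¬ H.TwoCyc Y := by
  constructor
  · rintro ⟨hXE, hX⟩
    exact ⟨hX.twoCyc hXE, fun Y hY hY2 => not_sparse_of_card_lt subset_rfl hY2.card_lt (hX.2 Y hY)⟩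
  · rintro ⟨hX, hmin⟩
    refine ⟨hX.1, not_sparse_of_card_lt subset_rfl hX.card_lt, fun J hJ => ?_⟩
    by_contra hJs
    obtain ⟨C, hCJ, hC⟩ := exists_isCirc_of_not_sparse hJs
    exact hmin C (Finset.ssubset_of_subset_of_ssubset hCJ hJ) (hC.twoCyc (hCJ.trans (hJ.1.trans hX.1)))

end EndGraph

/-! ### Passage between graphs and incidence data -/

namespace EndGraph
variable {α β : Type*} {H : EndGraph α β}

/-- `H` describes the graph `G`, up to isolated vertices. -/
structure Models (H : EndGraph α β) (G : Graph β α) : Prop where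
  edgeSet : G.edgeSet = (H.E : Set α)
  inc : ∀ e ∈ H.E, ∀ v, G.Inc e v ↔ v ∈ H.ends e

theorem exists_models (G : Graph β α) (hE : G.edgeSet.Finite) :
    ∃ H : EndGraph α β, H.Models G ∧ H.V = H.span H.E := by
  have hfin : ∀ e, {v | G.Inc e v}.Finite := by
    intro e
    by_cases he : ∃ x y, G.IsLink e x y
    · obtain ⟨x, y, h⟩ := he
      refine (Set.toFinite {x, y}).subset fun v hv => ?_
      simpa using hv.eq_or_eq_of_isLink h
    · convert Set.finite_empty
      ext v
      simp only [Set.mem_ofPred_eq, Set.mem_empty_iff_false, iff_false]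
      rintro ⟨y, hy⟩
      exact he ⟨v, y, hy⟩
  refine ⟨⟨hE.toFinset, hE.toFinset.biUnion fun e => (hfin e).toFinset, fun e => (hfin e).toFinset,
    fun e he => Finset.subset_biUnion_of_mem (fun e => (hfin e).toFinset) he, fun e he => ?_,
    fun e he => ?_⟩, ⟨by simp, by simp⟩, rfl⟩
  · obtain ⟨x, y, h⟩ := G.exists_isLink_of_mem_edgeSet (hE.mem_toFinset.1 he)
    exact ⟨x, by simpa using h.inc_left⟩
  · obtain ⟨x, y, h⟩ := G.exists_isLink_of_mem_edgeSet (hE.mem_toFinset.1 he)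
    refine (Finset.card_le_card (t := {x, y}) fun v hv => ?_).trans Finset.card_le_two
    rw [Set.Finite.mem_toFinset] at hv
    simpa using Graph.Inc.eq_or_eq_of_isLink hv h

/-- The graph described by `H`. -/
def toGraph (H : EndGraph α β) : Graph β α where
  vertexSet := H.V
  IsLink e x y := e ∈ H.E ∧ H.ends e = {x, y}
  isLink_symm e _ := ⟨fun x y h => ⟨h.1, h.2.trans (Finset.pair_comm x y)⟩⟩
  eq_or_eq_of_isLink_of_isLink e x y v w h h' := by
    have : x ∈ ({v, w} : Finset β) := by rw [← h'.2, h.2]; simp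
    simpa using this
  left_mem_of_isLink e x y h := H.ends_subset e h.1 (by rw [h.2]; simp)

theorem models_toGraph (H : EndGraph α β) : H.Models H.toGraph := by
  refine ⟨?_, ?_⟩
  · ext e
    simp only [toGraph, Set.mem_ofPred_eq, Finset.mem_coe]
    constructor
    · rintro ⟨x, y, h, -⟩; exact h
    · intro h
      obtain ⟨x, -, y, -, hxy⟩ := H.exists_ends h
      exact ⟨x, y, h, hxy⟩
  · intro e he v
    constructor
    · rintro ⟨y, -, h⟩; rw [h]; simp
    · intro hv
      obtain ⟨x, -, y, -, hxy⟩ := H.exists_ends he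
      rw [hxy, Finset.mem_insert, Finset.mem_singleton] at hv
      rcases hv with rfl | rfl
      · exact ⟨y, he, hxy⟩
      · exact ⟨x, he, hxy.trans (Finset.pair_comm _ _)⟩

theorem isLoopAt_toGraph {e : α} {v : β} : H.toGraph.IsLoopAt e v ↔ e ∈ H.E ∧ H.ends e = {v} := by
  unfold Graph.IsLoopAt toGraph
  simp

namespace Models

variable {G : Graph β α} (hG : H.Models G)
include hG

theorem isLink {e : α} (he : e ∈ H.E) {x y : β} : G.IsLink e x y ↔ H.ends e = {x, y} := by
  rw [Graph.isLink_iff_inc]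
  simp only [hG.inc e he]
  constructor
  · rintro ⟨hx, hy, h⟩
    ext z
    simp only [Finset.mem_insert, Finset.mem_singleton]
    exact ⟨h z, by rintro (rfl | rfl) <;> assumption⟩
  · intro h
    simp [h]

theorem isLoopAt {e : α} (he : e ∈ H.E) {x : β} : G.IsLoopAt e x ↔ H.ends e = {x} := by
  rw [Graph.IsLoopAt, hG.isLink he, Finset.pair_eq_singleton]

theorem mem_vertsOf {X : Finset α} (hX : X ⊆ H.E) {v : β} :
    v ∈ G.vertsOf (X : Set α) ↔ v ∈ H.span X := by
  simp only [Graph.vertsOf, Set.mem_ofPred_eq, Finset.mem_coe, mem_span]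
  exact exists_congr fun e => and_congr_right fun he => hG.inc e (hX he) v

theorem connectedOn_iff {X : Finset α} :
    G.ConnectedOn (X : Set α) ↔ X ⊆ H.E ∧ X.Nonempty ∧ H.Linked X := by
  unfold Graph.ConnectedOn
  rw [hG.edgeSet, Finset.coe_subset, Finset.coe_nonempty]
  refine and_congr_right fun hX => and_congr_right fun _ => ?_
  simp only [hG.mem_vertsOf hX, Finset.mem_coe]
  constructor
  · intro h Q hQ ⟨q, hq⟩ hne
    obtain ⟨r, hr, hrQ⟩ : ∃ r ∈ H.span X, r ∉ Q := by
      by_contra! hcon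
      exact hne (hQ.antisymm hcon)
    have hpath := h q (hQ hq) r hr
    by_contra hno
    refine hrQ ?_
    clear hr hrQ
    induction hpath with
    | refl => exact hq
    | tail _ hab ih =>
      obtain ⟨e, he, hab⟩ := hab
      rw [hG.isLink (hX he)] at hab
      by_contra hrQ
      refine hno ⟨e, he, ⟨_, ih, by rw [hab]; simp⟩, _, Finset.mem_sdiff.2 ⟨?_, hrQ⟩, by rw [hab]; simp⟩
      exact mem_span.2 ⟨e, he, by rw [hab]; simp⟩
  · intro h u hu v hv
    by_contra hno
    obtain ⟨e, he, ⟨q, hq, hqe⟩, r, hr, hre⟩ := h ((H.span X).filter fun w =>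
      Relation.ReflTransGen (fun a b => ∃ e ∈ X, G.IsLink e a b) u w) (Finset.filter_subset _ _)
      ⟨u, Finset.mem_filter.2 ⟨hu, .refl⟩⟩ (fun heq => hno (by
        rw [← heq] at hv; exact (Finset.mem_filter.1 hv).2))
    rw [Finset.mem_filter] at hq
    rw [Finset.mem_sdiff, Finset.mem_filter, not_and] at hr
    refine hr.2 hr.1 (hq.2.tail ⟨e, he, (hG.isLink (hX he)).2 ?_⟩)
    refine H.ends_eq_pair (hX he) hqe hre ?_
    rintro rfl
    exact hr.2 hr.1 hq.2

theorem degreeOn_eq {X : Finset α} (hX : X ⊆ H.E) (v : β) :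
    G.degreeOn (X : Set α) v = (H.degIn X v : ℕ) := by
  have h1 : {e ∈ (X : Set α) | G.Inc e v} = ((X.filter fun e => v ∈ H.ends e : Finset α) : Set α) := by
    ext e
    simp only [Set.mem_ofPred_eq, Finset.mem_coe, Finset.mem_filter]
    exact and_congr_right fun he => hG.inc e (hX he) v
  have h2 : {e ∈ (X : Set α) | G.IsLoopAt e v} =
      ((X.filter fun e => H.ends e = {v} : Finset α) : Set α) := by
    ext e
    simp only [Set.mem_ofPred_eq, Finset.mem_coe, Finset.mem_filter]
    exact and_congr_right fun he => hG.isLoopAt (hX he)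
  rw [Graph.degreeOn, h1, h2, Set.encard_coe_eq_coe_finsetCard, Set.encard_coe_eq_coe_finsetCard,
    degIn, Nat.cast_add]

theorem isCycle_iff {C : Finset α} : G.IsCycle (C : Set α) ↔ H.IsCyc C := by
  unfold Graph.IsCycle IsCyc
  rw [hG.connectedOn_iff]
  constructor
  · rintro ⟨⟨h1, h2, h3⟩, -, h4⟩
    refine ⟨h1, h2, h3, fun v hv => ?_⟩
    have := h4 v ((hG.mem_vertsOf h1).2 hv)
    rw [hG.degreeOn_eq h1] at this
    exact_mod_cast this
  · rintro ⟨h1, h2, h3, h4⟩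
    refine ⟨⟨h1, h2, h3⟩, C.finite_toSet, fun v hv => ?_⟩
    rw [hG.degreeOn_eq h1, h4 v ((hG.mem_vertsOf h1).1 hv)]
    rfl

theorem twoCyc_iff {X : Finset α} : H.TwoCyc X ↔ G.ConnectedOn (X : Set α) ∧
    ∃ C₁ C₂, C₁ ⊆ (X : Set α) ∧ C₂ ⊆ (X : Set α) ∧ C₁ ≠ C₂ ∧ G.IsCycle C₁ ∧ G.IsCycle C₂ := by
  rw [hG.connectedOn_iff, TwoCyc, and_assoc, and_assoc]
  refine and_congr_right fun _ => and_congr_right fun _ => and_congr_right fun _ => ?_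
  constructor
  · rintro ⟨C, D, hC, hD, hne, h1, h2⟩
    exact ⟨C, D, by exact_mod_cast hC, by exact_mod_cast hD, by exact_mod_cast hne,
      hG.isCycle_iff.2 h1, hG.isCycle_iff.2 h2⟩
  · rintro ⟨C, D, hC, hD, hne, h1, h2⟩
    lift C to Finset α using h1.2.1
    lift D to Finset α using h2.2.1
    exact ⟨C, D, by exact_mod_cast hC, by exact_mod_cast hD, by exact_mod_cast hne,
      hG.isCycle_iff.1 h1, hG.isCycle_iff.1 h2⟩

theorem isBicycle_iff {X : Finset α} : G.IsBicycle (X : Set α) ↔ X ⊆ H.E ∧ H.IsCirc X := by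
  rw [isCirc_iff_minimal_twoCyc, Graph.IsBicycle, Set.minimal_iff_forall_ssubset, ← hG.twoCyc_iff]
  refine and_congr_right fun _ => ?_
  constructor
  · intro h Y hY hY2
    exact h (Finset.coe_ssubset.2 hY) (hG.twoCyc_iff.1 hY2)
  · intro h Y hY hY2
    have hfin : Y.Finite := X.finite_toSet.subset hY.subset
    lift Y to Finset α using hfin
    exact h Y (Finset.coe_ssubset.1 hY) (hG.twoCyc_iff.2 hY2)

/-- From here on bicycles are no longer needed: independence in `B(G)` is sparseness. -/
theorem isBicircularOf_iff {M : Matroid α} : M.IsBicircularOf G ↔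
    M.E = H.E ∧ ∀ I : Finset α, M.Indep I ↔ I ⊆ H.E ∧ H.Sparse I := by
  unfold Matroid.IsBicircularOf
  rw [hG.edgeSet]
  refine and_congr_right fun hE => ?_
  constructor
  · intro h I
    rw [Matroid.indep_iff_forall_subset_not_isCircuit']
    rw [hE, Finset.coe_subset, and_comm]
    refine and_congr_right fun hI => ?_
    constructor
    · intro h'
      by_contra hs
      obtain ⟨C, hCI, hC⟩ := exists_isCirc_of_not_sparse hs
      exact h' C (by exact_mod_cast hCI) ((h _).2 (hG.isBicycle_iff.2 ⟨hCI.trans hI, hC⟩))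
    · intro hs C hCI hC
      have hfin : C.Finite := I.finite_toSet.subset hCI
      lift C to Finset α using hfin
      exact (hG.isBicycle_iff.1 ((h _).1 hC)).2.1 (hs.mono (by exact_mod_cast hCI))
  · intro h C
    constructor
    · intro hC
      have hfin : C.Finite := H.E.finite_toSet.subset (hE ▸ hC.subset_ground)
      lift C to Finset α using hfin
      have hCE : C ⊆ H.E := by
        have := hC.subset_ground
        rw [hE] at this
        exact_mod_cast this
      refine hG.isBicycle_iff.2 ⟨hCE, fun hs => hC.not_indep ((h _).2 ⟨hCE, hs⟩), fun J hJ => ?_⟩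
      exact ((h J).1 (hC.ssubset_indep (Finset.coe_ssubset.2 hJ))).2
    · intro hC
      have hfin : C.Finite := by
        have := hC.1.1.1
        rw [hG.edgeSet] at this
        exact H.E.finite_toSet.subset this
      lift C to Finset α using hfin
      obtain ⟨hCE, hC⟩ := hG.isBicycle_iff.1 hC
      rw [Matroid.isCircuit_iff_forall_ssubset, Matroid.Dep, h, hE]
      refine ⟨⟨fun h' => hC.1 h'.2, by exact_mod_cast hCE⟩, fun J hJ => ?_⟩
      have hfin : J.Finite := C.finite_toSet.subset hJ.subset
      lift J to Finset α using hfin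
      rw [Finset.coe_ssubset] at hJ
      exact (h J).2 ⟨hJ.1.trans hCE, hC.2 J hJ⟩

end Models

/-- Relabelling the vertices. -/
noncomputable def map {γ : Type*} (H : EndGraph α β) (f : β → γ) : EndGraph α γ where
  E := H.E
  V := H.V.image f
  ends e := (H.ends e).image f
  ends_subset e he := Finset.image_subset_image (H.ends_subset e he)
  ends_nonempty e he := (H.ends_nonempty e he).image f
  card_ends_le e he := Finset.card_image_le.trans (H.card_ends_le e he)

theorem sparse_map {γ : Type*} {f : β → γ} (hf : Set.InjOn f H.V) {I : Finset α} (hI : I ⊆ H.E) :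
    (H.map f).Sparse I ↔ H.Sparse I := by
  refine forall_congr' fun Y => imp_congr_right fun hY => ?_
  have : (H.map f).span Y = (H.span Y).image f := by
    simp only [span, map]
    rw [Finset.biUnion_image]
  rw [this, Finset.card_image_of_injOn (hf.mono (Finset.coe_subset.2 (span_subset_V (hY.trans hI))))]

/-- A matroid whose independent sets are the sparse sets of a multigraph is bicircular. -/
theorem isRootedBicircular {M : Matroid α} (hE : M.E = H.E)
    (hI : ∀ I : Finset α, M.Indep I ↔ I ⊆ H.E ∧ H.Sparse I) {L : Set α} (hLE : L ⊆ M.E)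
    (hL : ∀ e ∈ L, ∃ v, H.ends e = {v}) : M.IsRootedBicircular L := by
  -- Being bicircular asks for vertices in a type of the lowest universe, so the finitely many
  -- vertices are relabelled by natural numbers.
  obtain ⟨f, hf⟩ : ∃ f : β → ℕ, Set.InjOn f H.V :=
    (Set.countable_iff_exists_injOn).1 (H.V.finite_toSet.countable)
  refine ⟨ℕ, (H.map f).toGraph, (H.map f).V.finite_toSet, (H.map f).models_toGraph.isBicircularOf_iff.2
    ⟨hE, fun I => ?_⟩, fun e he => ?_⟩
  · rw [hI]
    exact and_congr_right fun h => (sparse_map hf h).symm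
  · obtain ⟨v, hv⟩ := hL e he
    refine ⟨f v, isLoopAt_toGraph.2 ⟨?_, by simp [map, hv]⟩⟩
    have := hLE he
    rw [hE] at this
    exact_mod_cast this

theorem _root_.Matroid.IsRootedBicircular.exists_endGraph {M : Matroid α} {L : Set α}
    (h : M.IsRootedBicircular L) (hE : M.E.Finite) (hLE : L ⊆ M.E) :
    ∃ (β : Type) (H : EndGraph α β), H.V = H.span H.E ∧ M.E = H.E ∧
      (∀ I : Finset α, M.Indep I ↔ I ⊆ H.E ∧ H.Sparse I) ∧ ∀ e ∈ L, ∃ v, H.ends e = {v} := by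
  obtain ⟨β, G, -, hG, hL⟩ := h
  obtain ⟨H, hH, hV⟩ := exists_models G (hG.1 ▸ hE)
  obtain ⟨hME, hI⟩ := hH.isBicircularOf_iff.1 hG
  refine ⟨β, H, hV, hME, hI, fun e he => ?_⟩
  have heE : e ∈ H.E := by have := hLE he; rw [hME] at this; exact_mod_cast this
  obtain ⟨v, hv⟩ := hL e he
  exact ⟨v, (hH.isLoopAt heE).1 hv⟩

end EndGraph

/-! ### Rank, and what 3-connectedness says about the graph -/

namespace EndGraph
variable {α β : Type*} {H : EndGraph α β}

/-- The rank of a set of edges in the bicircular matroid. -/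
noncomputable def rk (H : EndGraph α β) (A : Finset α) : ℕ := (A.powerset.filter H.Sparse).sup Finset.card

theorem Sparse.card_le_rk {I A : Finset α} (hI : H.Sparse I) (h : I ⊆ A) : I.card ≤ H.rk A :=
  Finset.le_sup (f := Finset.card) (by simp [h, hI])

theorem exists_card_eq_rk (A : Finset α) : ∃ I ⊆ A, H.Sparse I ∧ I.card = H.rk A := by
  obtain ⟨I, hI, h⟩ := Finset.exists_mem_eq_sup (A.powerset.filter H.Sparse)
    ⟨∅, by simp [sparse_empty]⟩ Finset.card
  rw [Finset.mem_filter, Finset.mem_powerset] at hI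
  exact ⟨I, hI.1, hI.2, h.symm⟩

theorem rk_le_card (A : Finset α) : H.rk A ≤ A.card := by
  obtain ⟨I, hI, -, h⟩ := exists_card_eq_rk (H := H) A
  exact h ▸ Finset.card_le_card hI

theorem rk_le_card_of_span_subset {A : Finset α} {S : Finset β} (hA : H.span A ⊆ S) :
    H.rk A ≤ S.card := by
  obtain ⟨I, hI, hs, h⟩ := exists_card_eq_rk (H := H) A
  exact h ▸ hs.card_le.trans (Finset.card_le_card ((span_mono hI).trans hA))

/-- The bicircular matroid is `3`-connected. -/
def ThreeConn (H : EndGraph α β) : Prop :=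
  ∀ k, 0 < k → k < 3 → ∀ A ⊆ H.E, k ≤ A.card → k ≤ (H.E \ A).card →
    H.rk H.E + k ≤ H.rk A + H.rk (H.E \ A)

theorem eRk_eq_rk {M : Matroid α} (hI : ∀ I : Finset α, M.Indep I ↔ I ⊆ H.E ∧ H.Sparse I)
    {A : Finset α} (hA : A ⊆ H.E) (hE : M.E = H.E) : M.eRk (A : Set α) = H.rk A := by
  apply le_antisymm
  · obtain ⟨I, hIA⟩ := M.exists_isBasis (A : Set α) (by rw [hE]; exact_mod_cast hA)
    have hfin : I.Finite := A.finite_toSet.subset hIA.subset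
    lift I to Finset α using hfin
    rw [← hIA.encard_eq_eRk, Set.encard_coe_eq_coe_finsetCard]
    exact_mod_cast Sparse.card_le_rk ((hI I).1 hIA.indep).2 (by exact_mod_cast hIA.subset)
  · obtain ⟨I, hIA, hs, h⟩ := exists_card_eq_rk (H := H) A
    rw [← h, ← Set.encard_coe_eq_coe_finsetCard]
    exact ((hI I).2 ⟨hIA.trans hA, hs⟩).encard_le_eRk_of_subset (by exact_mod_cast hIA)

theorem isNConnected_three_iff {M : Matroid α}
    (hI : ∀ I : Finset α, M.Indep I ↔ I ⊆ H.E ∧ H.Sparse I) (hE : M.E = H.E) :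
    M.IsNConnected 3 ↔ H.ThreeConn := by
  have key : ∀ k (A : Finset α), A ⊆ H.E → (¬ M.IsSeparation k A ↔ (k ≤ A.card → k ≤ (H.E \ A).card →
      H.rk H.E + k ≤ H.rk A + H.rk (H.E \ A))) := by
    intro k A hA
    unfold Matroid.IsSeparation
    rw [Matroid.eRank_def, hE, ← Finset.coe_sdiff, eRk_eq_rk hI hA hE, eRk_eq_rk hI Finset.sdiff_subset hE,
      eRk_eq_rk hI subset_rfl hE, Set.encard_coe_eq_coe_finsetCard, Set.encard_coe_eq_coe_finsetCard,
      Finset.coe_subset]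
    norm_cast
    simp only [hA, true_and, not_and, not_lt]
  constructor
  · intro h k hk hk3 A hA
    exact (key k A hA).1 (h k hk hk3 A)
  · intro h k hk hk3 A hA
    have hfin : A.Finite := H.E.finite_toSet.subset (hE ▸ hA.1)
    lift A to Finset α using hfin
    have hAE : A ⊆ H.E := by have := hA.1; rw [hE] at this; exact_mod_cast this
    exact (key k A hAE).2 (h k hk hk3 A hAE) hA

/-- Otherwise the edges touching `Q` and the remaining ones share no vertex, their ranks add up, and
they form a 1-separation. -/
theorem ThreeConn.exists_leaving (h : H.ThreeConn) (hV : H.V = H.span H.E) {Q : Finset β} (hQ : Q ⊆ H.V)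
    (hne : Q.Nonempty) (hne' : Q ≠ H.V) :
    ∃ e ∈ H.E, (∃ q ∈ Q, q ∈ H.ends e) ∧ ∃ r ∈ H.V \ Q, r ∈ H.ends e := by
  by_contra! hno
  obtain ⟨r, hr, hrQ⟩ : ∃ r ∈ H.V, r ∉ Q := by
    by_contra! hcon
    exact hne' (hQ.antisymm hcon)
  obtain ⟨q, hq⟩ := hne
  set A := H.E.filter fun e => ∃ q ∈ Q, q ∈ H.ends e with hA
  obtain ⟨e, he, hqe⟩ := mem_span.1 (hV ▸ hQ hq)
  obtain ⟨f, hf, hrf⟩ := mem_span.1 (hV ▸ hr)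
  have hfA : f ∉ A := by
    rw [hA, Finset.mem_filter]
    rintro ⟨-, q', hq', hqf⟩
    exact hno f hf ⟨q', hq', hqf⟩ r (Finset.mem_sdiff.2 ⟨hr, hrQ⟩) hrf
  have h1 := h 1 one_pos (by norm_num) A (Finset.filter_subset _ _)
    (Finset.card_pos.2 ⟨e, Finset.mem_filter.2 ⟨he, q, hq, hqe⟩⟩)
    (Finset.card_pos.2 ⟨f, Finset.mem_sdiff.2 ⟨hf, hfA⟩⟩)
  obtain ⟨I, hIA, hIs, hI⟩ := exists_card_eq_rk (H := H) A
  obtain ⟨J, hJA, hJs, hJ⟩ := exists_card_eq_rk (H := H) (H.E \ A)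
  have hd : Disjoint (H.span I) (H.span J) := by
    rw [Finset.disjoint_left]
    intro v hv hv'
    obtain ⟨a, ha, hva⟩ := mem_span.1 hv
    obtain ⟨b, hb, hvb⟩ := mem_span.1 hv'
    have ha' := Finset.mem_filter.1 (hIA ha)
    have hb' := Finset.mem_sdiff.1 (hJA hb)
    by_cases hvQ : v ∈ Q
    · exact hb'.2 (Finset.mem_filter.2 ⟨hb'.1, v, hvQ, hvb⟩)
    · obtain ⟨q', hq', hqa⟩ := ha'.2
      exact hno a ha'.1 ⟨q', hq', hqa⟩ v (Finset.mem_sdiff.2 ⟨H.ends_subset a ha'.1 hva, hvQ⟩) hva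
  have hu := (hIs.union_of_disjoint hJs hd).card_le_rk (Finset.union_subset
    (hIA.trans (Finset.filter_subset _ _)) (hJA.trans Finset.sdiff_subset))
  rw [Finset.card_union_of_disjoint (by
    rw [Finset.disjoint_left]
    intro x hx hx'
    exact (Finset.mem_sdiff.1 (hJA hx')).2 (hIA hx))] at hu
  omega

theorem ThreeConn.card_touching (h : H.ThreeConn) (hV : H.V = H.span H.E) {Y : Finset β} (hY : Y ⊆ H.V)
    (hne : Y ≠ H.V) : Y.card ≤ (H.E.filter fun e => ∃ y ∈ Y, y ∈ H.ends e).card := by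
  have h1 := H.card_sdiff_le_card_filter (F := H.E) subset_rfl (U := H.V) (H.V \ Y) Finset.sdiff_subset
    fun Q hQ hQV hQne => by
      obtain ⟨e, he, hq, hr⟩ := h.exists_leaving hV hQV
        ((Finset.sdiff_nonempty.2 fun h' => hne (hY.antisymm h')).mono hQ) hQne
      exact ⟨e, he, H.ends_subset e he, hq, hr⟩
  rw [Finset.sdiff_sdiff_eq_self hY] at h1
  refine h1.trans (Finset.card_le_card fun e he => ?_)
  rw [Finset.mem_filter] at he ⊢
  exact ⟨he.1, he.2.2⟩

/-- If all edges were sparse, a single one would be a coloop and give a 1-separation. So there is a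
circuit, with more edges than vertices, and connectedness adds an edge for each further vertex. -/
theorem ThreeConn.card_lt_card (h : H.ThreeConn) (hV : H.V = H.span H.E) (h2 : 2 ≤ H.E.card) :
    H.V.card < H.E.card := by
  have hns : ¬ H.Sparse H.E := by
    intro hs
    obtain ⟨e, he⟩ := Finset.card_pos.1 (by omega : 0 < H.E.card)
    have h1 := h 1 one_pos (by norm_num) {e} (by simpa using he) (by simp) (by
      rw [Finset.sdiff_singleton_eq_erase, Finset.card_erase_of_mem he]; omega)
    have h3 := H.rk_le_card {e}
    have h4 := H.rk_le_card (H.E \ {e})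
    have h5 := hs.card_le_rk subset_rfl
    rw [Finset.sdiff_singleton_eq_erase, Finset.card_erase_of_mem he] at h4
    rw [Finset.card_singleton] at h3
    rw [Finset.sdiff_singleton_eq_erase] at h1
    omega
  obtain ⟨C, hCE, hC⟩ := exists_isCirc_of_not_sparse hns
  have hsub := span_subset_V (H := H) hCE
  have h1 := H.card_sdiff_le_card_filter (F := H.E) subset_rfl (U := H.V) (H.span C) hsub
    fun Q hQ hQV hQne => by
      obtain ⟨c, hc⟩ := hC.nonempty
      obtain ⟨v, hv⟩ := H.ends_nonempty c (hCE hc)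
      obtain ⟨e, he, hq, hr⟩ := h.exists_leaving hV hQV ⟨v, hQ (mem_span.2 ⟨c, hc, hv⟩)⟩ hQne
      exact ⟨e, he, H.ends_subset e he, hq, hr⟩
  set N := H.E.filter fun e => H.ends e ⊆ H.V ∧ ∃ u ∈ H.V \ H.span C, u ∈ H.ends e with hN
  have hd : Disjoint C N := by
    rw [Finset.disjoint_left]
    intro f hf hfN
    rw [hN, Finset.mem_filter] at hfN
    obtain ⟨-, -, u, hu, huf⟩ := hfN
    exact (Finset.mem_sdiff.1 hu).2 (mem_span.2 ⟨f, hf, huf⟩)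
  have h3 := Finset.card_le_card (Finset.union_subset hCE (Finset.filter_subset _ _) : C ∪ N ⊆ H.E)
  rw [Finset.card_union_of_disjoint hd] at h3
  have h4 := hC.card_lt
  have h5 := Finset.card_sdiff_add_card_eq_card hsub
  omega

theorem ThreeConn.rk_eq (h : H.ThreeConn) (hV : H.V = H.span H.E) (h2 : 2 ≤ H.E.card) :
    H.rk H.E = H.V.card := by
  refine le_antisymm (rk_le_card_of_span_subset hV.symm.subset) ?_
  obtain ⟨I, hI, hs, hc⟩ := exists_sparse_card_eq (H := H) (S := H.V) (A := H.E) fun Y hY => by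
    by_cases hYV : Y = H.V
    · subst hYV
      rw [Finset.filter_true_of_mem]
      · exact (h.card_lt_card hV h2).le
      · intro e he
        obtain ⟨v, hv⟩ := H.ends_nonempty e he
        exact ⟨v, H.ends_subset e he hv, hv⟩
    · exact h.card_touching hV hY hYV
  exact hc ▸ hs.card_le_rk hI

theorem three_le_card_edges (hV : H.V = H.span H.E) (h5 : 5 ≤ H.V.card) : 3 ≤ H.E.card := by
  have : H.V.card ≤ H.E.card * 2 := by
    rw [hV]
    exact Finset.card_biUnion_le_card_mul _ _ _ H.card_ends_le
  omega

/-- Deleting the star of `v` lowers the rank, so a star of one or two edges is a separation of order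
its own size. -/
theorem ThreeConn.three_le_deg (h : H.ThreeConn) (hV : H.V = H.span H.E) (h5 : 5 ≤ H.V.card) :
    ∀ v ∈ H.V, 3 ≤ H.deg v := by
  intro v hv
  by_contra! hlt
  have h3 := three_le_card_edges hV h5
  have hE := h.card_lt_card hV (by omega)
  have hr := h.rk_eq hV (by omega)
  set A := H.E.filter fun e => v ∈ H.ends e with hA
  have hAd : H.deg v = A.card := rfl
  obtain ⟨e, he, hve⟩ := mem_span.1 (hV ▸ hv)
  have hpos : 0 < A.card := Finset.card_pos.2 ⟨e, Finset.mem_filter.2 ⟨he, hve⟩⟩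
  have hsub : A ⊆ H.E := Finset.filter_subset _ _
  have hc := Finset.card_sdiff_add_card_eq_card hsub
  have h1 := h A.card hpos (by omega) A hsub le_rfl (by omega)
  have h2 := H.rk_le_card A
  have h4 : H.rk (H.E \ A) ≤ (H.V.erase v).card := rk_le_card_of_span_subset fun x hx => by
    obtain ⟨f, hf, hxf⟩ := mem_span.1 hx
    rw [Finset.mem_sdiff, hA, Finset.mem_filter] at hf
    refine Finset.mem_erase.2 ⟨?_, H.ends_subset f hf.1 hxf⟩
    rintro rfl
    exact hf.2 ⟨hf.1, hxf⟩
  rw [Finset.card_erase_of_mem hv] at h4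
  omega

/-- A cut-vertex would split the edges into two parts sharing only that vertex. Their ranks sum to
at most `|V| + 1`, and minimum degree three makes both parts large enough for a 2-separation. -/
theorem ThreeConn.twoConn (h : H.ThreeConn) (hV : H.V = H.span H.E) (h5 : 5 ≤ H.V.card) :
    H.TwoConn := by
  have hdeg := h.three_le_deg hV h5
  have h3 := three_le_card_edges hV h5
  have hr := h.rk_eq hV (by omega)
  intro w hw Q hQ hne hne'
  by_contra! hno
  obtain ⟨r, hr', hrQ⟩ : ∃ r ∈ H.V.erase w, r ∉ Q := by
    by_contra! hcon
    exact hne' (hQ.antisymm hcon)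
  obtain ⟨q, hq⟩ := hne
  set A := H.E.filter fun e => ∃ q ∈ Q, q ∈ H.ends e with hA
  have hwQ : w ∉ Q := fun h => (Finset.mem_erase.1 (hQ h)).1 rfl
  have hrw := Finset.mem_erase.1 hr'
  have hAq : (H.E.filter fun e => q ∈ H.ends e) ⊆ A := fun e he => by
    rw [Finset.mem_filter] at he
    exact Finset.mem_filter.2 ⟨he.1, q, hq, he.2⟩
  have hsep : ∀ e ∈ H.E, ∀ q ∈ Q, q ∈ H.ends e → ∀ x ∈ H.ends e, x ∈ insert w Q := by
    intro e he q hq hqe x hxe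
    by_contra hx
    rw [Finset.mem_insert, not_or] at hx
    by_cases hwe : w ∈ H.ends e
    · have := H.ends_eq_pair he hwe hxe (Ne.symm hx.1)
      rw [this, Finset.mem_insert, Finset.mem_singleton] at hqe
      rcases hqe with rfl | rfl
      · exact hwQ hq
      · exact hx.2 hq
    · exact hno e he hwe ⟨q, hq, hqe⟩ x (Finset.mem_sdiff.2 ⟨Finset.mem_erase.2
        ⟨hx.1, H.ends_subset e he hxe⟩, hx.2⟩) hxe
  have hBr : (H.E.filter fun e => r ∈ H.ends e) ⊆ H.E \ A := fun e he => by
    rw [Finset.mem_filter] at he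
    rw [Finset.mem_sdiff, hA, Finset.mem_filter, not_and]
    refine ⟨he.1, fun _ ⟨q', hq', hqe⟩ => ?_⟩
    have := hsep e he.1 q' hq' hqe r he.2
    rw [Finset.mem_insert] at this
    exact this.elim hrw.1 hrQ
  have c1 := (hdeg q (Finset.mem_of_mem_erase (hQ hq))).trans (Finset.card_le_card hAq)
  have c2 := (hdeg r hrw.2).trans (Finset.card_le_card hBr)
  have h1 := h 2 two_pos (by norm_num) A (Finset.filter_subset _ _) (by omega) (by omega)
  have r1 : H.rk A ≤ (insert w Q).card := rk_le_card_of_span_subset fun x hx => by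
    obtain ⟨e, he, hxe⟩ := mem_span.1 hx
    rw [hA, Finset.mem_filter] at he
    obtain ⟨he, q', hq', hqe⟩ := he
    exact hsep e he q' hq' hqe x hxe
  have r2 : H.rk (H.E \ A) ≤ (H.V \ Q).card := rk_le_card_of_span_subset fun x hx => by
    obtain ⟨e, he, hxe⟩ := mem_span.1 hx
    rw [Finset.mem_sdiff, hA, Finset.mem_filter] at he
    exact Finset.mem_sdiff.2 ⟨H.ends_subset e he.1 hxe, fun hxQ => he.2 ⟨he.1, x, hxQ, hxe⟩⟩
  have c3 := Finset.card_sdiff_add_card_eq_card (hQ.trans (Finset.erase_subset _ _))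
  rw [Finset.card_insert_of_notMem hwQ] at r1
  omega

end EndGraph

/-! ### Definability in monadic second-order logic -/

namespace MS0

universe u

/-- The variables standing for `n` sets (even numbers) and `m` elements (odd numbers). -/
def Avail (n m x : ℕ) : Prop := x % 2 = 0 ∧ x / 2 < n ∨ x % 2 = 1 ∧ x / 2 < m

/-- The predicate `P` of `n` sets and `m` elements is defined by a formula. The sets are the values of the
first even variables; the elements are given as singletons by the first odd variables. -/
def Definable (n m : ℕ) (P : ∀ α : Type u, SetSystem α → (Fin n → Set α) → (Fin m → α) → Prop) : Prop :=
  ∃ φ : Expr, φ.IsFormula ∧ (∀ x ∈ φ.free, Avail n m x) ∧ (∀ x ∈ φ.bound, ¬ Avail n m x) ∧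
    ∀ (α : Type u) (M : SetSystem α) (θ : ℕ → Set α) (v : Fin n → Set α) (e : Fin m → α),
      (∀ i, v i ⊆ M.E) → (∀ j, e j ∈ M.E) → (∀ i : Fin n, θ (2 * i) = v i) →
      (∀ j : Fin m, θ (2 * j + 1) = {e j}) → (Sat M φ θ ↔ P α M v e)

namespace Definable

variable {n m : ℕ} {P Q : ∀ α : Type u, SetSystem α → (Fin n → Set α) → (Fin m → α) → Prop}

theorem ind (i : Fin n) : Definable n m fun (α : Type u) (M : SetSystem α) v _ => v i ∈ M.indep := by
  refine ⟨.ind (2 * i), trivial, ?_, by simp [Expr.bound], ?_⟩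
  · simp only [Expr.free, Finset.mem_singleton, forall_eq, Avail]; omega
  · intro α M θ v e _ _ hv _
    simp [Sat, hv]

theorem mem (j : Fin m) (i : Fin n) :
    Definable n m fun (α : Type u) (_ : SetSystem α) v e => e j ∈ v i := by
  refine ⟨.sub (2 * j + 1) (2 * i), trivial, ?_, by simp [Expr.bound], ?_⟩
  · simp only [Expr.free, Finset.mem_insert, Finset.mem_singleton, Avail]; omega
  · intro α M θ v e _ _ hv he
    simp [Sat, hv, he]

theorem eq (j k : Fin m) : Definable n m fun (α : Type u) (_ : SetSystem α) _ e => e j = e k := by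
  refine ⟨.sub (2 * j + 1) (2 * k + 1), trivial, ?_, by simp [Expr.bound], ?_⟩
  · simp only [Expr.free, Finset.mem_insert, Finset.mem_singleton, Avail]; omega
  · intro α M θ v e _ _ _ he
    simp [Sat, he]

theorem subset (i k : Fin n) :
    Definable n m fun (α : Type u) (_ : SetSystem α) v _ => v i ⊆ v k := by
  refine ⟨.sub (2 * i) (2 * k), trivial, ?_, by simp [Expr.bound], ?_⟩
  · simp only [Expr.free, Finset.mem_insert, Finset.mem_singleton, Avail]; omega
  · intro α M θ v e _ _ hv _
    simp [Sat, hv]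

theorem not (hP : Definable n m P) : Definable n m fun α M v e => ¬ P α M v e := by
  obtain ⟨φ, h1, h2, h3, h4⟩ := hP
  exact ⟨.neg φ, h1, h2, h3, fun α M θ v e a b c d => not_congr (h4 α M θ v e a b c d)⟩

/-- The formation rule for conjunctions holds automatically, since free variables are always
available ones and bound variables never are. -/
theorem and (hP : Definable n m P) (hQ : Definable n m Q) :
    Definable n m fun α M v e => P α M v e ∧ Q α M v e := by
  obtain ⟨φ, h1, h2, h3, h4⟩ := hP
  obtain ⟨ψ, k1, k2, k3, k4⟩ := hQ
  refine ⟨.conj φ ψ, ⟨h1, k1, ?_, ?_⟩, ?_, ?_, fun α M θ v e a b c d =>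
    and_congr (h4 α M θ v e a b c d) (k4 α M θ v e a b c d)⟩
  · exact Finset.disjoint_left.2 fun x hx hx' => k3 x hx' (h2 x hx)
  · exact Finset.disjoint_left.2 fun x hx hx' => h3 x hx (k2 x hx')
  · intro x hx
    exact (Finset.mem_union.1 hx).elim (h2 x) (k2 x)
  · intro x hx
    exact (Finset.mem_union.1 hx).elim (h3 x) (k3 x)

theorem congr (hP : Definable n m P)
    (h : ∀ (α : Type u) (M : SetSystem α) v e, (∀ i, v i ⊆ M.E) → (∀ j, e j ∈ M.E) →
      (P α M v e ↔ Q α M v e)) : Definable n m Q := by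
  obtain ⟨φ, h1, h2, h3, h4⟩ := hP
  exact ⟨φ, h1, h2, h3, fun α M θ v e a b c d => (h4 α M θ v e a b c d).trans (h α M v e a b)⟩

theorem or (hP : Definable n m P) (hQ : Definable n m Q) :
    Definable n m fun α M v e => P α M v e ∨ Q α M v e :=
  (hP.not.and hQ.not).not.congr fun _ _ _ _ _ _ => by tauto

theorem imp (hP : Definable n m P) (hQ : Definable n m Q) :
    Definable n m fun α M v e => P α M v e → Q α M v e :=
  (hP.and hQ.not).not.congr fun _ _ _ _ _ _ => by tauto

theorem iff (hP : Definable n m P) (hQ : Definable n m Q) :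
    Definable n m fun α M v e => P α M v e ↔ Q α M v e :=
  ((hP.imp hQ).and (hQ.imp hP)).congr fun _ _ _ _ _ _ => by tauto

theorem existsSet
    {P : ∀ α : Type u, SetSystem α → (Fin n → Set α) → (Fin m → α) → Set α → Prop}
    (hP : Definable (n + 1) m fun α M v e => P α M (fun i => v i.castSucc) e (v (Fin.last n))) :
    Definable n m fun α M v e => ∃ Y ⊆ M.E, P α M v e Y := by
  obtain ⟨φ, h1, h2, h3, h4⟩ := hP
  have hav : Avail (n + 1) m (2 * n) := by unfold Avail; omega
  -- Only a free variable may be quantified; the trivial conjunct makes it free even when `φ` does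
  -- not mention it.
  refine ⟨.ex (2 * n) (.conj (.sub (2 * n) (2 * n)) φ), ⟨⟨trivial, h1, ?_, ?_⟩, ?_⟩, ?_, ?_, ?_⟩
  · refine Finset.disjoint_left.2 fun x hx hx' => h3 x hx' ?_
    simp only [Expr.free, Finset.mem_insert, Finset.mem_singleton, or_self] at hx
    exact hx ▸ hav
  · simp [Expr.bound]
  · simp [Expr.free]
  · intro x hx
    simp only [Expr.free, Finset.mem_erase, Finset.mem_union, Finset.mem_insert, Finset.mem_singleton,
      or_self] at hx
    have := h2 x (hx.2.resolve_left hx.1)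
    have := hx.1
    unfold Avail at *
    omega
  · intro x hx
    simp only [Expr.bound, Finset.mem_insert, Finset.empty_union] at hx
    rcases hx with rfl | hx
    · unfold Avail; omega
    · intro h
      refine h3 x hx ?_
      unfold Avail at *
      omega
  · intro α M θ v e hv he hθ hθe
    simp only [Sat, subset_rfl, true_and]
    refine exists_congr fun Y => and_congr_right fun hY => ?_
    rw [h4 α M _ (Fin.snoc (α := fun _ => Set α) v Y) e]
    · simp
    · intro i
      refine Fin.lastCases ?_ (fun i => ?_) i
      · simpa using hY
      · simpa using hv i
    · exact he
    · intro i
      refine Fin.lastCases ?_ (fun i => ?_) i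
      · simp
      · have : 2 * (i : ℕ) ≠ 2 * n := by omega
        simp [hθ, this]
    · intro j
      have : 2 * (j : ℕ) + 1 ≠ 2 * n := by omega
      rw [Function.update_of_ne this, hθe]

theorem allSet
    {P : ∀ α : Type u, SetSystem α → (Fin n → Set α) → (Fin m → α) → Set α → Prop}
    (hP : Definable (n + 1) m fun α M v e => P α M (fun i => v i.castSucc) e (v (Fin.last n))) :
    Definable n m fun α M v e => ∀ Y ⊆ M.E, P α M v e Y :=
  (existsSet (P := fun α M v e Y => ¬ P α M v e Y) hP.not).not.congr fun _ _ _ _ _ _ => by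
    push Not; rfl

theorem existsElem
    {P : ∀ α : Type u, SetSystem α → (Fin n → Set α) → (Fin m → α) → α → Prop}
    (hP : Definable n (m + 1) fun α M v e => P α M v (fun j => e j.castSucc) (e (Fin.last m))) :
    Definable n m fun α M v e => ∃ x ∈ M.E, P α M v e x := by
  obtain ⟨φ, h1, h2, h3, h4⟩ := hP
  have hav : Avail n (m + 1) (2 * m + 1) := by unfold Avail; omega
  -- Elements are represented by singletons: `σ` says that the set is non-empty and has no non-empty
  -- proper subset, where a set is non-empty if it fails to be contained in some set.
  have key : ∃ σ : Expr, σ.IsFormula ∧ σ.free = {2 * m + 1} ∧ σ.bound = {2 * n, 2 * n + 2} ∧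
      ∀ (α : Type u) (M : SetSystem α) (θ : ℕ → Set α), θ (2 * m + 1) ⊆ M.E →
        (Sat M σ θ ↔ ∃ x ∈ M.E, θ (2 * m + 1) = {x}) := by
    have a1 : 2 * m + 1 ≠ 2 * n := by omega
    have a2 : 2 * m + 1 ≠ 2 * n + 2 := by omega
    have a3 : 2 * n ≠ 2 * n + 2 := by omega
    refine ⟨.conj (.ex (2 * n) (.neg (.sub (2 * m + 1) (2 * n)))) (.neg (.ex (2 * n) (.conj
      (.conj (.sub (2 * n) (2 * m + 1)) (.neg (.sub (2 * m + 1) (2 * n))))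
      (.ex (2 * n + 2) (.neg (.sub (2 * n) (2 * n + 2))))))), ?_, ?_, ?_, ?_⟩
    · simp [Expr.IsFormula, Expr.free, Expr.bound]; grind
    · simp [Expr.free]; grind
    · simp [Expr.bound]
    · intro α M θ hθ
      simp only [Sat, Function.update_self, Function.update_of_ne a1, Function.update_of_ne a3]
      generalize θ (2 * m + 1) = X at *
      constructor
      · rintro ⟨⟨Y, hY, hXY⟩, h⟩
        obtain ⟨x, hx, -⟩ := Set.not_subset.1 hXY
        refine ⟨x, hθ hx, ?_⟩
        by_contra hne
        refine h ⟨{x}, by simpa using hθ hx, ⟨by simpa using hx, fun hsub => hne ?_⟩, ∅, by simp, by simp⟩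
        exact hsub.antisymm (by simpa using hx)
      · rintro ⟨x, hx, rfl⟩
        refine ⟨⟨∅, by simp, by simp⟩, ?_⟩
        rintro ⟨Y, -, ⟨hY, hxY⟩, Z, -, hYZ⟩
        rcases Set.subset_singleton_iff_eq.1 hY with rfl | rfl
        · exact hYZ (Set.empty_subset _)
        · exact hxY subset_rfl
  obtain ⟨σ, s1, s2, s3, s4⟩ := key
  refine ⟨.ex (2 * m + 1) (.conj σ φ), ⟨⟨s1, h1, ?_, ?_⟩, ?_⟩, ?_, ?_, ?_⟩
  · refine Finset.disjoint_left.2 fun x hx hx' => h3 x hx' ?_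
    rw [s2, Finset.mem_singleton] at hx
    exact hx ▸ hav
  · refine Finset.disjoint_left.2 fun x hx hx' => ?_
    have := h2 x hx'
    rw [s3, Finset.mem_insert, Finset.mem_singleton] at hx
    unfold Avail at this
    omega
  · simp [Expr.free, s2]
  · intro x hx
    simp only [Expr.free, s2, Finset.mem_erase, Finset.mem_union, Finset.mem_singleton] at hx
    have := h2 x (hx.2.resolve_left hx.1)
    have := hx.1
    unfold Avail at *
    omega
  · intro x hx
    simp only [Expr.bound, s3, Finset.mem_insert, Finset.mem_union, Finset.mem_singleton] at hx
    rcases hx with rfl | (rfl | rfl) | hx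
    · unfold Avail; omega
    · unfold Avail; omega
    · unfold Avail; omega
    · intro h
      refine h3 x hx ?_
      unfold Avail at *
      omega
  · intro α M θ v e hv he hθ hθe
    have hsat : ∀ x ∈ M.E, (Sat M φ (Function.update θ (2 * m + 1) {x}) ↔ P α M v e x) := by
      intro x hx
      rw [h4 α M _ v (Fin.snoc (α := fun _ => α) e x)]
      · simp
      · exact hv
      · intro j
        refine Fin.lastCases ?_ (fun j => ?_) j
        · simpa using hx
        · simpa using he j
      · intro i
        have : 2 * (i : ℕ) ≠ 2 * m + 1 := by omega
        rw [Function.update_of_ne this, hθ]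
      · intro j
        refine Fin.lastCases ?_ (fun j => ?_) j
        · simp
        · have : 2 * (j : ℕ) + 1 ≠ 2 * m + 1 := by omega
          simp only [Fin.val_castSucc, Fin.snoc_castSucc]
          rw [Function.update_of_ne this, hθe]
    simp only [Sat]
    constructor
    · rintro ⟨Y, hY, h, h'⟩
      rw [s4 α M _ (by simpa using hY)] at h
      simp only [Function.update_self] at h
      obtain ⟨x, hx, rfl⟩ := h
      exact ⟨x, hx, (hsat x hx).1 h'⟩
    · rintro ⟨x, hx, h⟩
      refine ⟨{x}, by simpa using hx, ?_, (hsat x hx).2 h⟩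
      rw [s4 α M _ (by simpa using hx)]
      exact ⟨x, hx, by simp⟩

theorem allElem
    {P : ∀ α : Type u, SetSystem α → (Fin n → Set α) → (Fin m → α) → α → Prop}
    (hP : Definable n (m + 1) fun α M v e => P α M v (fun j => e j.castSucc) (e (Fin.last m))) :
    Definable n m fun α M v e => ∀ x ∈ M.E, P α M v e x :=
  (existsElem (P := fun α M v e x => ¬ P α M v e x) hP.not).not.congr fun _ _ _ _ _ _ => by
    push Not; rfl

theorem exists_formula {P : ∀ α : Type u, SetSystem α → Set α → Prop}
    (hP : Definable 1 0 fun α M v _ => P α M (v 0)) :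
    ∃ (φ : Expr) (X : ℕ), φ.IsFormula ∧ φ.free = {X} ∧
      ∀ (α : Type u) (M : SetSystem α) (L : Set α), L ⊆ M.E → (SatAt M φ X L ↔ P α M L) := by
  obtain ⟨φ, h1, h2, h3, h4⟩ := hP
  -- The trivial conjunct guarantees that the variable is free.
  refine ⟨.conj (.sub 0 0) φ, 0, ⟨trivial, h1, ?_, by simp [Expr.bound]⟩, ?_, ?_⟩
  · simp only [Expr.free, Finset.mem_singleton, Finset.insert_eq_of_mem, Finset.disjoint_singleton_left]
    exact fun h => h3 0 h (by simp [Avail])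
  · ext x
    simp only [Expr.free, Finset.mem_union, Finset.mem_insert, Finset.mem_singleton, or_self]
    refine ⟨fun h => h.elim id fun h => ?_, Or.inl⟩
    have := h2 x h
    unfold Avail at this
    omega
  · intro α M L hL
    simp only [SatAt, Sat, subset_rfl, true_and]
    refine h4 α M _ (fun _ => L) Fin.elim0 (fun _ => hL) (fun j => j.elim0) (fun i => ?_) (fun j => j.elim0)
    rw [Subsingleton.elim i 0]
    simp

end Definable

end MS0

/-! ### The property expressed by the formula -/

namespace SetSystem

variable {α : Type*} (M : SetSystem α)

/-- A maximal member of the family. -/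
def MaxIndep (I : Set α) : Prop := I ∈ M.indep ∧ ∀ J ⊆ M.E, J ∈ M.indep → I ⊆ J → J ⊆ I

/-- The independence axioms. -/
def MatroidAxioms : Prop :=
  (∃ Y ⊆ M.E, Y ∈ M.indep) ∧
  (∀ I ⊆ M.E, ∀ J ⊆ M.E, I ⊆ J → J ∈ M.indep → I ∈ M.indep) ∧
  ∀ I ⊆ M.E, ∀ B ⊆ M.E, I ∈ M.indep → ¬ M.MaxIndep I → M.MaxIndep B →
    ∃ x ∈ M.E, x ∈ B ∧ x ∉ I ∧ insert x I ∈ M.indep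

/-- Independent subsets of `A` and of its complement have an independent union. -/
def Separates (A : Set α) : Prop :=
  ∀ I ⊆ M.E, ∀ J ⊆ M.E, I ∈ M.indep → J ∈ M.indep → I ⊆ A → (∀ x ∈ M.E, x ∈ J → x ∉ A) →
    I ∪ J ∈ M.indep

/-- Unions of independent subsets of `A` and of its complement are independent up to one element. -/
def AlmostSeparates (A : Set α) : Prop :=
  ∀ I ⊆ M.E, ∀ J ⊆ M.E, I ∈ M.indep → J ∈ M.indep → I ⊆ A → (∀ x ∈ M.E, x ∈ J → x ∉ A) →
    ∃ x ∈ M.E, (I ∪ J) \ {x} ∈ M.indep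

/-- `3`-connectedness in terms of independent sets. -/
def Unseparated : Prop :=
  ∀ A ⊆ M.E,
    ((∃ a ∈ M.E, a ∈ A) → (∃ b ∈ M.E, b ∉ A) → ¬ M.Separates A) ∧
    ((∃ a ∈ M.E, ∃ a' ∈ M.E, a ∈ A ∧ a' ∈ A ∧ a ≠ a') →
      (∃ b ∈ M.E, ∃ b' ∈ M.E, b ∉ A ∧ b' ∉ A ∧ b ≠ b') → ¬ M.AlmostSeparates A)

/-- The edge `e` is a loop at `W`, with respect to an incidence relation between elements and sets. -/
def LoopCode (inc : α → Set α → Prop) (e : α) (W : Set α) : Prop :=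
  inc e W ∧ ∀ W' ⊆ M.E, inc e W' → W' = W

/-- The degree of `W` in `Y` is at least two. -/
def TwoLeDeg (inc : α → Set α → Prop) (Y W : Set α) : Prop :=
  ∃ f ∈ M.E, f ∈ Y ∧ inc f W ∧ (M.LoopCode inc f W ∨ ∃ g ∈ M.E, g ∈ Y ∧ g ≠ f ∧ inc g W)

/-- The degree of `W` in `Y` is at least three. -/
def ThreeLeDeg (inc : α → Set α → Prop) (Y W : Set α) : Prop :=
  ∃ f ∈ M.E, ∃ g ∈ M.E, f ∈ Y ∧ g ∈ Y ∧ g ≠ f ∧ inc f W ∧ inc g W ∧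
    (M.LoopCode inc f W ∨ ∃ h ∈ M.E, h ∈ Y ∧ h ≠ f ∧ h ≠ g ∧ inc h W)

/-- `M` is the bicircular matroid of the graph whose incidences are given by `inc`, in which the elements
of `L` are loops. -/
def Represents (inc : α → Set α → Prop) (L : Set α) : Prop :=
  (∀ e ∈ M.E, ∃ W ⊆ M.E, inc e W) ∧
  (∀ e ∈ M.E, ∀ W₁ ⊆ M.E, ∀ W₂ ⊆ M.E, ∀ W₃ ⊆ M.E, inc e W₁ → inc e W₂ → inc e W₃ →
    W₁ = W₂ ∨ W₁ = W₃ ∨ W₂ = W₃) ∧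
  (∀ e ∈ M.E, e ∈ L → ∀ W₁ ⊆ M.E, ∀ W₂ ⊆ M.E, inc e W₁ → inc e W₂ → W₁ = W₂) ∧
  ∀ I ⊆ M.E, I ∈ M.indep ↔ ¬ ∃ Y ⊆ M.E, Y ⊆ I ∧ (∃ W ⊆ M.E, M.ThreeLeDeg inc Y W) ∧
    ∀ W ⊆ M.E, (∃ f ∈ M.E, f ∈ Y ∧ inc f W) → M.TwoLeDeg inc Y W

/-- The incidence relation of a graph with at most four vertices, given by the vertex codes `Cᵢ` and the
stars `Sᵢ`. -/
def FewInc (C₀ S₀ C₁ S₁ C₂ S₂ C₃ S₃ : Set α) (e : α) (W : Set α) : Prop :=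
  (W = C₀ ∧ e ∈ S₀) ∨ (W = C₁ ∧ e ∈ S₁) ∨ (W = C₂ ∧ e ∈ S₂) ∨ (W = C₃ ∧ e ∈ S₃)

/-- Cyclic flats. -/
def CyclicFlat (F : Set α) : Prop :=
  (∀ f ∈ M.E, f ∈ F → ∃ I ⊆ M.E, I ⊆ F ∧ f ∉ I ∧ I ∈ M.indep ∧ insert f I ∉ M.indep) ∧
  ∀ x ∈ M.E, x ∉ F → ∀ I ⊆ M.E, I ⊆ F → I ∈ M.indep → insert x I ∈ M.indep

/-- `F` is a maximal cyclic flat avoiding `e`. -/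
def AvoidMax (e : α) (F : Set α) : Prop :=
  M.CyclicFlat F ∧ e ∉ F ∧ ∀ F' ⊆ M.E, M.CyclicFlat F' → e ∉ F' → F ⊆ F' → F' ⊆ F

/-- `F` is the largest cyclic flat avoiding `e`. -/
def AvoidTop (e : α) (F : Set α) : Prop :=
  M.CyclicFlat F ∧ e ∉ F ∧ ∀ F' ⊆ M.E, M.CyclicFlat F' → e ∉ F' → F' ⊆ F

/-- `K` is a minimal set outside the family. -/
def Circ (K : Set α) : Prop := K ∉ M.indep ∧ ∀ J ⊆ M.E, J ⊆ K → ¬ K ⊆ J → J ∈ M.indep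

/-- `F` is a cyclic flat skew to `K`. -/
def Skew (K F : Set α) : Prop :=
  M.CyclicFlat F ∧ ∀ I ⊆ M.E, ∀ J ⊆ M.E, I ⊆ F → J ⊆ K → I ∈ M.indep → J ∈ M.indep → I ∪ J ∈ M.indep

/-- `F` is a maximal cyclic flat skew to `K`. -/
def SkewMax (K F : Set α) : Prop := M.Skew K F ∧ ∀ F' ⊆ M.E, M.Skew K F' → F ⊆ F' → F' ⊆ F

/-- The non-empty cyclic flats that correspond to vertices. -/
def Code (Ω F : Set α) : Prop :=
  (∃ x ∈ M.E, x ∈ F) ∧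
    ((∃ e ∈ M.E, M.AvoidMax e F) ∨ ∃ K ⊆ M.E, K ⊆ Ω ∧ M.Circ K ∧ M.SkewMax K F)

/-- The incidence relation of a graph with many vertices. Here `Z` is the set of loops, `P` consists of the
edges between twins, `Ω` is a union of circuits through vertices that no edge exhibits, and `R` is the star
of the vertex without a non-empty cyclic flat. -/
def ManyInc (Z P Ω R : Set α) (e : α) (W : Set α) : Prop :=
  ((∀ x ∈ M.E, x ∈ W) ∧ e ∈ R) ∨ (e ∈ W ∧ ∃ F ⊆ M.E, M.Code Ω F ∧
    (((∀ x ∈ M.E, x ∈ P → x ∈ F) ∧ (∀ x ∈ M.E, x ∈ W ↔ x ∉ F) ∧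
      (M.AvoidMax e F ∨ (e ∉ Z ∧ e ∉ R ∧ ∃ F' ⊆ M.E, M.AvoidTop e F' ∧ F ⊆ F' ∧ ¬ F' ⊆ F))) ∨
    ((∃ x ∈ M.E, x ∈ P ∧ x ∉ F) ∧ ∃ s ∈ M.E, s ∉ F ∧ s ∉ P ∧ ∀ x ∈ M.E, x ∈ W ↔ x ∉ F ∧ x ≠ s)))

/-- The property expressed by the formula. -/
def BicircularLoops (L : Set α) : Prop :=
  M.MatroidAxioms ∧ M.Unseparated ∧
    ((∃ C₀ ⊆ M.E, ∃ S₀ ⊆ M.E, ∃ C₁ ⊆ M.E, ∃ S₁ ⊆ M.E, ∃ C₂ ⊆ M.E, ∃ S₂ ⊆ M.E, ∃ C₃ ⊆ M.E, ∃ S₃ ⊆ M.E,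
      M.Represents (FewInc C₀ S₀ C₁ S₁ C₂ S₂ C₃ S₃) L) ∨
    ∃ Z ⊆ M.E, ∃ P ⊆ M.E, ∃ Ω ⊆ M.E, ∃ R ⊆ M.E, M.Represents (M.ManyInc Z P Ω R) L)

end SetSystem

/-! ### Definability of the property -/

namespace MS0.Definable

open SetSystem

universe u

variable {n m : ℕ}

theorem setEq (i k : Fin n) : Definable n m fun (α : Type u) (_ : SetSystem α) v _ => v i = v k :=
  ((subset i k).and (subset k i)).congr fun _ _ _ _ _ _ => Set.Subset.antisymm_iff.symm

/-- The logic has no terms for set operations; a composite set is named by a quantified set with the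
same elements. -/
theorem indSet {T : ∀ α : Type u, SetSystem α → (Fin n → Set α) → (Fin m → α) → Set α}
    (hT : ∀ (α : Type u) (M : SetSystem α) v e, (∀ i, v i ⊆ M.E) → (∀ j, e j ∈ M.E) → T α M v e ⊆ M.E)
    (h : Definable (n + 1) (m + 1) fun α M v e =>
      e (Fin.last m) ∈ T α M (fun i => v i.castSucc) (fun j => e j.castSucc)) :
    Definable n m fun α M v e => T α M v e ∈ M.indep :=
  (existsSet (P := fun α M v e Y => (∀ x ∈ M.E, x ∈ Y ↔ x ∈ T α M v e) ∧ Y ∈ M.indep)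
    (.and (.allElem (.iff (.mem _ _) h)) (.ind _))).congr fun α M v e hv he => by
    constructor
    · rintro ⟨Y, hY, h1, h2⟩
      convert h2
      ext x
      exact ⟨fun hx => (h1 x (hT _ _ _ _ hv he hx)).2 hx, fun hx => (h1 x (hY hx)).1 hx⟩
    · intro h
      exact ⟨_, hT _ _ _ _ hv he, fun _ _ => Iff.rfl, h⟩

theorem indInsert (j : Fin m) (i : Fin n) :
    Definable n m fun (α : Type u) (M : SetSystem α) v e => insert (e j) (v i) ∈ M.indep :=
  indSet (T := fun _ _ v e => insert (e j) (v i))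
    (fun _ _ _ _ hv he => Set.insert_subset (he j) (hv i))
    ((Definable.or (.eq _ _) (.mem _ _)).congr fun _ _ _ _ _ _ => Iff.rfl)

theorem indUnion (i k : Fin n) :
    Definable n m fun (α : Type u) (M : SetSystem α) v _ => v i ∪ v k ∈ M.indep :=
  indSet (T := fun _ _ v _ => v i ∪ v k)
    (fun _ _ _ _ hv _ => Set.union_subset (hv i) (hv k))
    ((Definable.or (.mem _ _) (.mem _ _)).congr fun _ _ _ _ _ _ => Iff.rfl)

theorem indUnionSdiff (i k : Fin n) (j : Fin m) :
    Definable n m fun (α : Type u) (M : SetSystem α) v e => (v i ∪ v k) \ {e j} ∈ M.indep :=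
  indSet (T := fun _ _ v e => (v i ∪ v k) \ {e j})
    (fun _ _ _ _ hv _ => Set.sdiff_subset.trans (Set.union_subset (hv i) (hv k)))
    ((Definable.and (.or (.mem _ _) (.mem _ _)) (.not (.eq _ _))).congr fun _ _ _ _ _ _ => Iff.rfl)

theorem maxIndep (i : Fin n) : Definable n m fun (α : Type u) (M : SetSystem α) v _ => M.MaxIndep (v i) :=
  .and (.ind _) (.allSet (.imp (.ind _) (.imp (.subset _ _) (.subset _ _))))

theorem matroidAxioms : Definable n m fun (α : Type u) (M : SetSystem α) _ _ => M.MatroidAxioms :=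
  .and (.existsSet (.ind _)) (.and (.allSet (.allSet (.imp (.subset _ _) (.imp (.ind _) (.ind _)))))
    (.allSet (.allSet (.imp (.ind _) (.imp (.not (maxIndep _)) (.imp (maxIndep _)
      (.existsElem (.and (.mem _ _) (.and (.not (.mem _ _)) (indInsert _ _))))))))))

theorem separates (i : Fin n) :
    Definable n m fun (α : Type u) (M : SetSystem α) v _ => M.Separates (v i) :=
  .allSet (.allSet (.imp (.ind _) (.imp (.ind _) (.imp (.subset _ _)
    (.imp (.allElem (.imp (.mem _ _) (.not (.mem _ _)))) (indUnion _ _))))))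

theorem almostSeparates (i : Fin n) :
    Definable n m fun (α : Type u) (M : SetSystem α) v _ => M.AlmostSeparates (v i) :=
  .allSet (.allSet (.imp (.ind _) (.imp (.ind _) (.imp (.subset _ _)
    (.imp (.allElem (.imp (.mem _ _) (.not (.mem _ _)))) (.existsElem (indUnionSdiff _ _ _)))))))

theorem unseparated : Definable n m fun (α : Type u) (M : SetSystem α) _ _ => M.Unseparated :=
  .allSet (.and
    (.imp (.existsElem (.mem _ _)) (.imp (.existsElem (.not (.mem _ _))) (.not (separates _))))
    (.imp (.existsElem (.existsElem (.and (.mem _ _) (.and (.mem _ _) (.not (.eq _ _))))))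
      (.imp (.existsElem (.existsElem (.and (.not (.mem _ _)) (.and (.not (.mem _ _)) (.not (.eq _ _))))))
        (.not (almostSeparates _)))))

section Represents

variable {k : ℕ} {inc : ∀ α : Type u, SetSystem α → (Fin k → Set α) → α → Set α → Prop}
  (h : ∀ n m (σ : Fin k → Fin n) (j : Fin m) (i : Fin n), Definable n m fun α M v e =>
    inc α M (fun t => v (σ t)) (e j) (v i))
include h

/-- The incidence relation has `k` set parameters, and `σ` says which variables of the current
context hold them. Definability is assumed in every context because the relation recurs under
further quantifiers. -/
theorem loopCode (σ : Fin k → Fin n) (j : Fin m) (i : Fin n) : Definable n m fun α M v e =>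
    M.LoopCode (inc α M (fun t => v (σ t))) (e j) (v i) :=
  .and (h _ _ _ _ _) (.allSet (.imp (h _ _ (fun t => (σ t).castSucc) _ _) (setEq _ _)))

theorem twoLeDeg (σ : Fin k → Fin n) (j i : Fin n) : Definable n m fun α M v _ =>
    M.TwoLeDeg (inc α M (fun t => v (σ t))) (v j) (v i) :=
  .existsElem (.and (.mem _ _) (.and (h _ _ _ _ _) (.or (loopCode h _ _ _)
    (.existsElem (.and (.mem _ _) (.and (.not (.eq _ _)) (h _ _ _ _ _)))))))

theorem threeLeDeg (σ : Fin k → Fin n) (j i : Fin n) : Definable n m fun α M v _ =>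
    M.ThreeLeDeg (inc α M (fun t => v (σ t))) (v j) (v i) :=
  .existsElem (.existsElem (.and (.mem _ _) (.and (.mem _ _) (.and (.not (.eq _ _))
    (.and (h _ _ _ _ _) (.and (h _ _ _ _ _) (.or (loopCode h _ _ _)
      (.existsElem (.and (.mem _ _) (.and (.not (.eq _ _)) (.and (.not (.eq _ _))
        (h _ _ _ _ _))))))))))))

theorem represents (σ : Fin k → Fin n) (i : Fin n) : Definable n m fun α M v _ =>
    M.Represents (inc α M (fun t => v (σ t))) (v i) :=
  .and (.allElem (.existsSet (h _ _ (fun t => (σ t).castSucc) _ _))) (.and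
    (.allElem (.allSet (.allSet (.allSet (.imp (h _ _ (fun t => (σ t).castSucc.castSucc.castSucc) _ _)
      (.imp (h _ _ (fun t => (σ t).castSucc.castSucc.castSucc) _ _)
      (.imp (h _ _ (fun t => (σ t).castSucc.castSucc.castSucc) _ _)
        (.or (setEq _ _) (.or (setEq _ _) (setEq _ _))))))))))
    (.and
      (.allElem (.imp (.mem _ _) (.allSet (.allSet (.imp (h _ _ (fun t => (σ t).castSucc.castSucc) _ _)
        (.imp (h _ _ (fun t => (σ t).castSucc.castSucc) _ _) (setEq _ _)))))))
      (.allSet (.iff (.ind _) (.not (.existsSet (.and (.subset _ _) (.and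
        (.existsSet (threeLeDeg h (fun t => (σ t).castSucc.castSucc.castSucc) _ _))
        (.allSet (.imp (.existsElem (.and (.mem _ _)
          (h _ _ (fun t => (σ t).castSucc.castSucc.castSucc) _ _)))
          (twoLeDeg h (fun t => (σ t).castSucc.castSucc.castSucc) _ _)))))))))))

end Represents

theorem fewInc (i₀ i₁ i₂ i₃ i₄ i₅ i₆ i₇ i : Fin n) (j : Fin m) :
    Definable n m fun (α : Type u) (_ : SetSystem α) v e =>
      FewInc (v i₀) (v i₁) (v i₂) (v i₃) (v i₄) (v i₅) (v i₆) (v i₇) (e j) (v i) :=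
  .or (.and (setEq _ _) (.mem _ _)) (.or (.and (setEq _ _) (.mem _ _))
    (.or (.and (setEq _ _) (.mem _ _)) (.and (setEq _ _) (.mem _ _))))

theorem cyclicFlat (i : Fin n) :
    Definable n m fun (α : Type u) (M : SetSystem α) v _ => M.CyclicFlat (v i) :=
  .and (.allElem (.imp (.mem _ _) (.existsSet (.and (.subset _ _) (.and (.not (.mem _ _))
    (.and (.ind _) (.not (indInsert _ _))))))))
    (.allElem (.imp (.not (.mem _ _)) (.allSet (.imp (.subset _ _) (.imp (.ind _) (indInsert _ _))))))

theorem avoidMax (j : Fin m) (i : Fin n) :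
    Definable n m fun (α : Type u) (M : SetSystem α) v e => M.AvoidMax (e j) (v i) :=
  .and (cyclicFlat _) (.and (.not (.mem _ _)) (.allSet (.imp (cyclicFlat _) (.imp (.not (.mem _ _))
    (.imp (.subset _ _) (.subset _ _))))))

theorem avoidTop (j : Fin m) (i : Fin n) :
    Definable n m fun (α : Type u) (M : SetSystem α) v e => M.AvoidTop (e j) (v i) :=
  .and (cyclicFlat _) (.and (.not (.mem _ _)) (.allSet (.imp (cyclicFlat _) (.imp (.not (.mem _ _))
    (.subset _ _)))))

theorem circ (i : Fin n) : Definable n m fun (α : Type u) (M : SetSystem α) v _ => M.Circ (v i) :=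
  .and (.not (.ind _)) (.allSet (.imp (.subset _ _) (.imp (.not (.subset _ _)) (.ind _))))

theorem skew (k i : Fin n) :
    Definable n m fun (α : Type u) (M : SetSystem α) v _ => M.Skew (v k) (v i) :=
  .and (cyclicFlat _) (.allSet (.allSet (.imp (.subset _ _) (.imp (.subset _ _) (.imp (.ind _)
    (.imp (.ind _) (indUnion _ _)))))))

theorem skewMax (k i : Fin n) :
    Definable n m fun (α : Type u) (M : SetSystem α) v _ => M.SkewMax (v k) (v i) :=
  .and (skew _ _) (.allSet (.imp (skew _ _) (.imp (.subset _ _) (.subset _ _))))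

theorem code (k i : Fin n) :
    Definable n m fun (α : Type u) (M : SetSystem α) v _ => M.Code (v k) (v i) :=
  .and (.existsElem (.mem _ _)) (.or (.existsElem (avoidMax _ _))
    (.existsSet (.and (.subset _ _) (.and (circ _) (skewMax _ _)))))

theorem manyInc (i₀ i₁ i₂ i₃ i : Fin n) (j : Fin m) :
    Definable n m fun (α : Type u) (M : SetSystem α) v e =>
      M.ManyInc (v i₀) (v i₁) (v i₂) (v i₃) (e j) (v i) :=
  .or (.and (.allElem (.mem _ _)) (.mem _ _)) (.and (.mem _ _) (.existsSet (.and (code _ _) (.or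
    (.and (.allElem (.imp (.mem _ _) (.mem _ _))) (.and (.allElem (.iff (.mem _ _) (.not (.mem _ _))))
      (.or (avoidMax _ _) (.and (.not (.mem _ _)) (.and (.not (.mem _ _))
        (.existsSet (.and (avoidTop _ _) (.and (.subset _ _) (.not (.subset _ _))))))))))
    (.and (.existsElem (.and (.mem _ _) (.not (.mem _ _)))) (.existsElem (.and (.not (.mem _ _))
      (.and (.not (.mem _ _)) (.allElem (.iff (.mem _ _) (.and (.not (.mem _ _))
        (.not (.eq _ _))))))))))))) 

theorem bicircularLoops (i : Fin n) :
    Definable n m fun (α : Type u) (M : SetSystem α) v _ => M.BicircularLoops (v i) :=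
  .and matroidAxioms (.and unseparated (.or
    (.existsSet (.existsSet (.existsSet (.existsSet (.existsSet (.existsSet (.existsSet (.existsSet
      (represents (k := 8)
        (inc := fun _ _ p => FewInc (p 0) (p 1) (p 2) (p 3) (p 4) (p 5) (p 6) (p 7))
        (fun _ _ _ _ _ => fewInc _ _ _ _ _ _ _ _ _ _) ![_, _, _, _, _, _, _, _] _)))))))))
    (.existsSet (.existsSet (.existsSet (.existsSet
      (represents (k := 4) (inc := fun _ M p => M.ManyInc (p 0) (p 1) (p 2) (p 3))
        (fun _ _ _ _ _ => manyInc _ _ _ _ _ _) ![_, _, _, _] _)))))))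

end MS0.Definable

/-! ### Matroid axioms and connectivity through independent sets -/

namespace Matroid

variable {α : Type*} {N : Matroid α}

/-- The connectivity of `A` in terms of independent sets. -/
theorem eRk_add_eRk_sdiff_lt_iff (hN : N.E.Finite) {A : Set α} (hA : A ⊆ N.E) (t : ℕ) :
    N.eRk A + N.eRk (N.E \ A) < N.eRank + (t + 1 : ℕ) ↔
      ∀ I ⊆ A, ∀ J ⊆ N.E \ A, N.Indep I → N.Indep J → ∃ X : Set α, X.encard ≤ (t : ℕ∞) ∧ N.Indep ((I ∪ J) \ X) := by
  have hfin : ∀ X ⊆ N.E, X.encard ≠ ⊤ := fun X hX => Set.encard_ne_top_iff.2 (hN.subset hX)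
  have hdis : ∀ I J, I ⊆ A → J ⊆ N.E \ A → (I ∪ J).encard = I.encard + J.encard := fun I J hI hJ =>
    Set.encard_union_eq (Set.disjoint_of_subset hI hJ Set.disjoint_sdiff_right)
  constructor
  · intro h I hI J hJ hIi hJi
    obtain ⟨I', hI', hII'⟩ := hIi.subset_isBasis_of_subset hI
    obtain ⟨J', hJ', hJJ'⟩ := hJi.subset_isBasis_of_subset hJ
    obtain ⟨K, hK⟩ := N.exists_isBasis (I' ∪ J')
      (Set.union_subset hI'.indep.subset_ground hJ'.indep.subset_ground)
    have hr : N.eRk (I' ∪ J') = N.eRank := by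
      rw [hI'.eRk_eq_eRk_union, Set.union_comm, hJ'.eRk_eq_eRk_union, Set.sdiff_union_of_subset hA,
        eRk_ground]
    -- Here `I'` and `J'` are bases of the two sides and `K` is a basis of their union, so the
    -- number of discarded elements is exactly `r(A) + r(E - A) - r(M)`.
    refine ⟨(I' ∪ J') \ K, ?_, hK.indep.subset ?_⟩
    · have h1 := Set.encard_sdiff_add_encard_of_subset hK.subset
      rw [hdis I' J' hI'.subset hJ'.subset, hI'.encard_eq_eRk, hJ'.encard_eq_eRk, hK.encard_eq_eRk, hr] at h1
      have hr' : N.eRank ≠ ⊤ := by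
        rw [← hr, ← hK.encard_eq_eRk]; exact hfin _ hK.indep.subset_ground
      rw [← h1, add_comm] at h
      obtain ⟨r, hr⟩ := ENat.ne_top_iff_exists.1 hr'
      obtain ⟨x, hx⟩ := ENat.ne_top_iff_exists.1 (hfin ((I' ∪ J') \ K)
        (Set.sdiff_subset.trans (Set.union_subset hI'.indep.subset_ground hJ'.indep.subset_ground)))
      rw [← hr, ← hx] at h
      rw [← hx]
      norm_cast at h ⊢
      omega
    · rintro x ⟨hx, hx'⟩
      by_contra hxK
      exact hx' ⟨Set.union_subset_union hII' hJJ' hx, hxK⟩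
  · intro h
    obtain ⟨I, hI⟩ := N.exists_isBasis A hA
    obtain ⟨J, hJ⟩ := N.exists_isBasis (N.E \ A) Set.sdiff_subset
    obtain ⟨X, hX, hi⟩ := h I hI.subset J hJ.subset hI.indep hJ.indep
    rw [← hI.encard_eq_eRk, ← hJ.encard_eq_eRk, ← hdis I J hI.subset hJ.subset]
    have h1 : (I ∪ J).encard ≤ N.eRank + t :=
      (Set.encard_le_encard_sdiff_add_encard _ X).trans (add_le_add hi.encard_le_eRank hX)
    have h2 : N.eRank + t ≠ ⊤ := by
      rw [← eRk_ground]
      exact fun h => (ENat.add_eq_top.1 h).elim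
        (ne_top_of_le_ne_top (hfin _ subset_rfl) (N.eRk_le_encard _)) (ENat.natCast_ne_top t)
    refine h1.trans_lt ?_
    rw [Nat.cast_add, ← add_assoc]
    exact (ENat.lt_add_one_iff h2).2 le_rfl

end Matroid

namespace SetSystem

variable {α : Type*} {M : SetSystem α}

theorem MatroidAxioms.exists_isMatroid (h : M.MatroidAxioms) : ∃ N, M.IsMatroid N := by
  obtain ⟨⟨Y, hY, hYi⟩, h2, h3⟩ := h
  have hmax : ∀ I, Maximal (· ∈ M.indep) I ↔ M.MaxIndep I := fun I =>
    ⟨fun h => ⟨h.1, fun J _ hJ hIJ => h.2 hJ hIJ⟩, fun h => ⟨h.1, fun J hJ hIJ =>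
      h.2 J (M.subset_E _ hJ) hJ hIJ⟩⟩
  refine ⟨(IndepMatroid.ofBdd M.E (· ∈ M.indep) (h2 ∅ (Set.empty_subset _) Y hY (Set.empty_subset _) hYi)
    (fun I J hJ hIJ => h2 I (hIJ.trans (M.subset_E _ hJ)) J (M.subset_E _ hJ) hIJ hJ)
    (fun I B hI hIm hB => ?_) M.subset_E ⟨M.E.ncard, fun I hI => ?_⟩).matroid, rfl, fun I => Iff.rfl⟩
  · rw [hmax] at hIm hB
    obtain ⟨x, -, hxB, hxI, hx⟩ := h3 I (M.subset_E _ hI) B (M.subset_E _ hB.1) hI hIm hB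
    exact ⟨x, ⟨hxB, hxI⟩, hx⟩
  · rw [M.finite_E.cast_ncard_eq]
    exact Set.encard_le_encard (M.subset_E _ hI)

theorem IsMatroid.matroidAxioms {N : Matroid α} (h : M.IsMatroid N) : M.MatroidAxioms := by
  obtain ⟨hE, hI⟩ := h
  have hbase : ∀ I, M.MaxIndep I ↔ N.IsBase I := fun I => by
    rw [Matroid.isBase_iff_maximal_indep]
    simp only [MaxIndep, ← hI, ← hE]
    exact ⟨fun h => ⟨h.1, fun J hJ hIJ => h.2 J hJ.subset_ground hJ hIJ⟩, fun h => ⟨h.1, fun J _ hJ hIJ =>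
      h.2 hJ hIJ⟩⟩
  refine ⟨⟨∅, Set.empty_subset _, (hI _).1 N.empty_indep⟩, fun I _ J _ hIJ hJ =>
    (hI I).1 (((hI J).2 hJ).subset hIJ), fun I _ B _ hIi hIm hB => ?_⟩
  rw [hbase] at hIm hB
  obtain ⟨x, hx, hxi⟩ := ((hI I).2 hIi).exists_insert_of_not_isBase hIm hB
  exact ⟨x, hE ▸ hB.subset_ground hx.1, hx.1, hx.2, (hI _).1 hxi⟩

theorem IsMatroid.separates_iff {N : Matroid α} (h : M.IsMatroid N) {A : Set α} (hA : A ⊆ N.E) :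
    M.Separates A ↔ N.eRk A + N.eRk (N.E \ A) < N.eRank + (0 + 1 : ℕ) := by
  obtain ⟨hE, hI⟩ := h
  rw [Matroid.eRk_add_eRk_sdiff_lt_iff (hE ▸ M.finite_E) hA]
  simp only [Separates, ← hI, ← hE]
  constructor
  · intro h I hIA J hJA hIi hJi
    exact ⟨∅, by simp, by
      simpa using h I hIi.subset_ground J hJi.subset_ground hIi hJi hIA fun x _ hx => (hJA hx).2⟩
  · intro h I _ J hJ hIi hJi hIA hJA
    obtain ⟨X, hX, hi⟩ := h I hIA J (fun x hx => ⟨hJ hx, hJA x (hJ hx) hx⟩) hIi hJi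
    have : X = ∅ := by simpa using hX
    simpa [this] using hi

/-- The set-system version always deletes some element of the ground set; non-emptiness of `A`
supplies one when nothing has to be deleted. -/
theorem IsMatroid.almostSeparates_iff {N : Matroid α} (h : M.IsMatroid N) {A : Set α} (hA : A ⊆ N.E)
    (hne : A.Nonempty) :
    M.AlmostSeparates A ↔ N.eRk A + N.eRk (N.E \ A) < N.eRank + (1 + 1 : ℕ) := by
  obtain ⟨hE, hI⟩ := h
  rw [Matroid.eRk_add_eRk_sdiff_lt_iff (hE ▸ M.finite_E) hA]
  simp only [AlmostSeparates, ← hI, ← hE]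
  constructor
  · intro h I hIA J hJA hIi hJi
    obtain ⟨x, -, hx⟩ := h I hIi.subset_ground J hJi.subset_ground hIi hJi hIA fun x _ hx => (hJA hx).2
    exact ⟨{x}, by simp, hx⟩
  · intro h I _ J hJ hIi hJi hIA hJA
    obtain ⟨X, hX, hi⟩ := h I hIA J (fun x hx => ⟨hJ hx, hJA x (hJ hx) hx⟩) hIi hJi
    obtain ⟨a, ha⟩ := hne
    rcases Set.encard_le_one_iff_eq.1 hX with rfl | ⟨x, rfl⟩
    · exact ⟨a, hA ha, hi.subset (Set.sdiff_subset_sdiff_right (Set.empty_subset _))⟩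
    · by_cases hx : x ∈ N.E
      · exact ⟨x, hx, hi⟩
      · refine ⟨a, hA ha, hi.subset fun y hy => ⟨hy.1, ?_⟩⟩
        rintro rfl
        exact hx ((Set.union_subset (hIi.subset_ground) hJ) hy.1)

theorem IsMatroid.unseparated_iff {N : Matroid α} (h : M.IsMatroid N) :
    M.Unseparated ↔ N.IsNConnected 3 := by
  have one : ∀ X : Set α, (1 : ℕ) ≤ X.encard ↔ ∃ a, a ∈ X := fun X => by
    rw [Nat.cast_one, Set.one_le_encard_iff_nonempty]; rfl
  have two : ∀ X : Set α, (2 : ℕ) ≤ X.encard ↔ ∃ a, ∃ b, a ∈ X ∧ b ∈ X ∧ a ≠ b := fun X => by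
    rw [← Set.one_lt_encard_iff, ← Order.add_one_le_iff_of_not_isMax (by simp)]; norm_num
  unfold Unseparated Matroid.IsNConnected Matroid.IsSeparation
  constructor
  · rintro hU k hk hk3 A ⟨hA, h1, h2, h3⟩
    obtain ⟨u1, u2⟩ := hU A (h.1 ▸ hA)
    obtain rfl | rfl : k = 1 ∨ k = 2 := by omega
    · obtain ⟨a, ha⟩ := (one _).1 h1
      obtain ⟨b, hb, hbA⟩ := (one _).1 h2
      exact u1 ⟨a, h.1 ▸ hA ha, ha⟩ ⟨b, h.1 ▸ hb, hbA⟩ ((h.separates_iff hA).2 h3)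
    · obtain ⟨a, a', ha, ha', hne⟩ := (two _).1 h1
      obtain ⟨b, b', hb, hb', hne'⟩ := (two _).1 h2
      exact u2 ⟨a, h.1 ▸ hA ha, a', h.1 ▸ hA ha', ha, ha', hne⟩
        ⟨b, h.1 ▸ hb.1, b', h.1 ▸ hb'.1, hb.2, hb'.2, hne'⟩ ((h.almostSeparates_iff hA ⟨a, ha⟩).2 h3)
  · rintro hN A hA
    rw [← h.1] at hA
    constructor
    · rintro ⟨a, -, ha⟩ ⟨b, hb, hbA⟩ hs
      exact hN 1 one_pos (by norm_num) A ⟨hA, (one _).2 ⟨a, ha⟩, (one _).2 ⟨b, h.1 ▸ hb, hbA⟩,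
        (h.separates_iff hA).1 hs⟩
    · rintro ⟨a, -, a', -, ha, ha', hne⟩ ⟨b, hb, b', hb', hbA, hb'A, hne'⟩ hs
      exact hN 2 two_pos (by norm_num) A ⟨hA, (two _).2 ⟨a, a', ha, ha', hne⟩,
        (two _).2 ⟨b, b', ⟨h.1 ▸ hb, hbA⟩, ⟨h.1 ▸ hb', hb'A⟩, hne'⟩,
        (h.almostSeparates_iff hA ⟨a, ha⟩).1 hs⟩

end SetSystem

/-! ### Coded incidences and degrees -/

/-- In the application `A` consists of the edges at a vertex and `B` of the loops among them, so the
sum is a degree. -/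
theorem Finset.two_le_card_add_card_iff {α : Type*} {A B : Finset α} (h : B ⊆ A) :
    2 ≤ A.card + B.card ↔ ∃ f ∈ A, f ∈ B ∨ ∃ g ∈ A, g ≠ f := by
  constructor
  · intro h2
    rcases B.eq_empty_or_nonempty with rfl | ⟨f, hf⟩
    · obtain ⟨f, hf, g, hg, hne⟩ := Finset.one_lt_card.1 (by rw [Finset.card_empty] at h2; omega : 1 < A.card)
      exact ⟨f, hf, Or.inr ⟨g, hg, hne.symm⟩⟩
    · exact ⟨f, h hf, Or.inl hf⟩
  · rintro ⟨f, hf, hfB | ⟨g, hg, hne⟩⟩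
    · have := Finset.card_pos.2 ⟨f, hf⟩
      have := Finset.card_pos.2 ⟨f, hfB⟩
      omega
    · have := Finset.one_lt_card.2 ⟨g, hg, f, hf, hne⟩
      omega

theorem Finset.three_le_card_add_card_iff {α : Type*} {A B : Finset α} (h : B ⊆ A) :
    3 ≤ A.card + B.card ↔ ∃ f ∈ A, ∃ g ∈ A, g ≠ f ∧ (f ∈ B ∨ ∃ h ∈ A, h ≠ f ∧ h ≠ g) := by
  constructor
  · intro h2
    rcases B.eq_empty_or_nonempty with rfl | ⟨f, hf⟩
    · obtain ⟨f, g, k, hf, hg, hk, h1, h2, h3⟩ := Finset.two_lt_card_iff.1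
        (by rw [Finset.card_empty] at h2; omega : 2 < A.card)
      exact ⟨f, hf, g, hg, h1.symm, Or.inr ⟨k, hk, h2.symm, h3.symm⟩⟩
    · have := Finset.card_le_card h
      obtain ⟨g, hg, hne⟩ := Finset.exists_mem_ne (by omega : 1 < A.card) f
      exact ⟨f, h hf, g, hg, hne, Or.inl hf⟩
  · rintro ⟨f, hf, g, hg, hne, hfB | ⟨k, hk, h1, h2⟩⟩
    · have := Finset.one_lt_card.2 ⟨g, hg, f, hf, hne⟩
      have := Finset.card_pos.2 ⟨f, hfB⟩
      omega
    · have := Finset.two_lt_card_iff.2 ⟨f, g, k, hf, hg, hk, hne.symm, h1.symm, h2.symm⟩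
      omega

namespace EndGraph

variable {α β : Type*} {H : EndGraph α β} {M : SetSystem α}

/-- The sets `c v` encode the vertices of `H`, and `inc` their incidences. -/
structure Encodes (H : EndGraph α β) (M : SetSystem α) (inc : α → Set α → Prop) (c : β → Set α) : Prop where
  ground : M.E = H.E
  injOn : Set.InjOn c H.V
  subset : ∀ v ∈ H.V, c v ⊆ M.E
  inc_iff : ∀ e ∈ H.E, ∀ W ⊆ M.E, inc e W ↔ ∃ v ∈ H.ends e, W = c v

namespace Encodes

variable {inc : α → Set α → Prop} {c : β → Set α} (hc : H.Encodes M inc c)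
include hc

theorem inc_code {e : α} (he : e ∈ H.E) {v : β} (hv : v ∈ H.V) : inc e (c v) ↔ v ∈ H.ends e := by
  rw [hc.inc_iff e he _ (hc.subset v hv)]
  constructor
  · rintro ⟨w, hw, h⟩
    rwa [hc.injOn hv (H.ends_subset e he hw) h]
  · intro h
    exact ⟨v, h, rfl⟩

theorem loopCode_iff {e : α} (he : e ∈ H.E) {v : β} (hv : v ∈ H.V) :
    M.LoopCode inc e (c v) ↔ H.ends e = {v} := by
  unfold SetSystem.LoopCode
  rw [hc.inc_code he hv]
  constructor
  · rintro ⟨h1, h2⟩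
    refine Finset.eq_singleton_iff_unique_mem.2 ⟨h1, fun w hw => ?_⟩
    have hwV := H.ends_subset e he hw
    exact hc.injOn hwV hv (h2 _ (hc.subset w hwV) ((hc.inc_code he hwV).2 hw))
  · intro h
    refine ⟨by simp [h], fun W hW hi => ?_⟩
    obtain ⟨w, hw, rfl⟩ := (hc.inc_iff e he W hW).1 hi
    rw [h, Finset.mem_singleton] at hw
    rw [hw]

theorem twoLeDeg_iff {Y : Finset α} (hY : Y ⊆ H.E) {v : β} (hv : v ∈ H.V) :
    M.TwoLeDeg inc Y (c v) ↔ 2 ≤ H.degIn Y v := by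
  rw [degIn, Finset.two_le_card_add_card_iff (fun e he => by
    rw [Finset.mem_filter] at he ⊢; exact ⟨he.1, by simp [he.2]⟩)]
  simp only [SetSystem.TwoLeDeg, hc.ground, Finset.mem_coe, Finset.mem_filter]
  constructor
  · rintro ⟨f, hf, hfY, h1, h2⟩
    refine ⟨f, ⟨hfY, (hc.inc_code hf hv).1 h1⟩, ?_⟩
    rcases h2 with h2 | ⟨g, hg, hgY, hne, h2⟩
    · exact Or.inl ⟨hfY, (hc.loopCode_iff hf hv).1 h2⟩
    · exact Or.inr ⟨g, ⟨hgY, (hc.inc_code hg hv).1 h2⟩, hne⟩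
  · rintro ⟨f, ⟨hf, h1⟩, h2⟩
    refine ⟨f, hY hf, hf, (hc.inc_code (hY hf) hv).2 h1, ?_⟩
    rcases h2 with ⟨-, h2⟩ | ⟨g, ⟨hg, h2⟩, hne⟩
    · exact Or.inl ((hc.loopCode_iff (hY hf) hv).2 h2)
    · exact Or.inr ⟨g, hY hg, hg, hne, (hc.inc_code (hY hg) hv).2 h2⟩

theorem threeLeDeg_iff {Y : Finset α} (hY : Y ⊆ H.E) {v : β} (hv : v ∈ H.V) :
    M.ThreeLeDeg inc Y (c v) ↔ 3 ≤ H.degIn Y v := by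
  rw [degIn, Finset.three_le_card_add_card_iff (fun e he => by
    rw [Finset.mem_filter] at he ⊢; exact ⟨he.1, by simp [he.2]⟩)]
  simp only [SetSystem.ThreeLeDeg, hc.ground, Finset.mem_coe, Finset.mem_filter]
  constructor
  · rintro ⟨f, hf, g, hg, hfY, hgY, hne, h1, h2, h3⟩
    refine ⟨f, ⟨hfY, (hc.inc_code hf hv).1 h1⟩, g, ⟨hgY, (hc.inc_code hg hv).1 h2⟩, hne, ?_⟩
    rcases h3 with h3 | ⟨k, hk, hkY, hne1, hne2, h3⟩
    · exact Or.inl ⟨hfY, (hc.loopCode_iff hf hv).1 h3⟩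
    · exact Or.inr ⟨k, ⟨hkY, (hc.inc_code hk hv).1 h3⟩, hne1, hne2⟩
  · rintro ⟨f, ⟨hf, h1⟩, g, ⟨hg, h2⟩, hne, h3⟩
    refine ⟨f, hY hf, g, hY hg, hf, hg, hne, (hc.inc_code (hY hf) hv).2 h1,
      (hc.inc_code (hY hg) hv).2 h2, ?_⟩
    rcases h3 with ⟨-, h3⟩ | ⟨k, ⟨hk, h3⟩, hne1, hne2⟩
    · exact Or.inl ((hc.loopCode_iff (hY hf) hv).2 h3)
    · exact Or.inr ⟨k, hY hk, hk, hne1, hne2, (hc.inc_code (hY hk) hv).2 h3⟩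

theorem denseCore_iff {Y : Finset α} (hY : Y ⊆ H.E) : H.DenseCore Y ↔
    (∃ W ⊆ M.E, M.ThreeLeDeg inc Y W) ∧
      ∀ W ⊆ M.E, (∃ f ∈ M.E, f ∈ (Y : Set α) ∧ inc f W) → M.TwoLeDeg inc Y W := by
  refine and_congr ⟨?_, ?_⟩ ⟨?_, ?_⟩
  · rintro ⟨v, hv⟩
    have hvs : v ∈ H.span Y := by
      by_contra hvs
      rw [degIn_eq_zero hvs] at hv
      omega
    have hvV := span_subset_V hY hvs
    exact ⟨c v, hc.subset v hvV, (hc.threeLeDeg_iff hY hvV).2 hv⟩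
  · rintro ⟨W, hW, h⟩
    obtain ⟨f, hf, -, -, -, -, -, hfW, -⟩ := id h
    rw [hc.ground] at hf
    obtain ⟨v, hv, rfl⟩ := (hc.inc_iff f hf W hW).1 hfW
    exact ⟨v, (hc.threeLeDeg_iff hY (H.ends_subset f hf hv)).1 h⟩
  · rintro h W hW ⟨f, hf, hfY, hfW⟩
    rw [hc.ground] at hf
    obtain ⟨v, hv, rfl⟩ := (hc.inc_iff f hf W hW).1 hfW
    exact (hc.twoLeDeg_iff hY (H.ends_subset f hf hv)).2 (h v (mem_span.2 ⟨f, hfY, hv⟩))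
  · rintro h v hv
    obtain ⟨f, hf, hvf⟩ := mem_span.1 hv
    have hvV := H.ends_subset f (hY hf) hvf
    exact (hc.twoLeDeg_iff hY hvV).1 (h _ (hc.subset v hvV)
      ⟨f, by rw [hc.ground]; exact hY hf, hf, (hc.inc_code (hY hf) hvV).2 hvf⟩)

theorem sparse_iff {I : Finset α} (hI : I ⊆ H.E) : H.Sparse I ↔
    ¬ ∃ Y ⊆ M.E, Y ⊆ (I : Set α) ∧ (∃ W ⊆ M.E, M.ThreeLeDeg inc Y W) ∧
      ∀ W ⊆ M.E, (∃ f ∈ M.E, f ∈ Y ∧ inc f W) → M.TwoLeDeg inc Y W := by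
  rw [← not_iff_not, not_not, not_sparse_iff_exists_denseCore hI]
  constructor
  · rintro ⟨Y, hY, h⟩
    exact ⟨Y, by rw [hc.ground]; exact_mod_cast hY.trans hI, by exact_mod_cast hY,
      (hc.denseCore_iff (hY.trans hI)).1 h⟩
  · rintro ⟨Y, -, hY, h⟩
    have hfin : Y.Finite := I.finite_toSet.subset hY
    lift Y to Finset α using hfin
    have hY' : Y ⊆ I := by exact_mod_cast hY
    exact ⟨Y, hY', (hc.denseCore_iff (hY'.trans hI)).2 h⟩

theorem represents {L : Set α} (hL : ∀ e ∈ L, ∃ v, H.ends e = {v})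
    (hI : ∀ I : Finset α, I ⊆ H.E → ((I : Set α) ∈ M.indep ↔ H.Sparse I)) : M.Represents inc L := by
  refine ⟨fun e he => ?_, fun e he W₁ h₁ W₂ h₂ W₃ h₃ i₁ i₂ i₃ => ?_, fun e he heL W₁ h₁ W₂ h₂ i₁ i₂ => ?_,
    fun I hIE => ?_⟩
  · rw [hc.ground] at he
    obtain ⟨v, hv⟩ := H.ends_nonempty e he
    exact ⟨c v, hc.subset v (H.ends_subset e he hv), (hc.inc_code he (H.ends_subset e he hv)).2 hv⟩
  · rw [hc.ground] at he
    obtain ⟨v₁, hv₁, rfl⟩ := (hc.inc_iff e he _ h₁).1 i₁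
    obtain ⟨v₂, hv₂, rfl⟩ := (hc.inc_iff e he _ h₂).1 i₂
    obtain ⟨v₃, hv₃, rfl⟩ := (hc.inc_iff e he _ h₃).1 i₃
    obtain ⟨x, -, y, -, hxy⟩ := H.exists_ends he
    rw [hxy, Finset.mem_insert, Finset.mem_singleton] at hv₁ hv₂ hv₃
    grind
  · rw [hc.ground] at he
    obtain ⟨v₁, hv₁, rfl⟩ := (hc.inc_iff e he _ h₁).1 i₁
    obtain ⟨v₂, hv₂, rfl⟩ := (hc.inc_iff e he _ h₂).1 i₂
    obtain ⟨x, hx⟩ := hL e heL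
    rw [hx, Finset.mem_singleton] at hv₁ hv₂
    rw [hv₁, hv₂]
  · have hfin : I.Finite := M.finite_E.subset hIE
    lift I to Finset α using hfin
    rw [hc.ground, Finset.coe_subset] at hIE
    rw [hI I hIE, hc.sparse_iff hIE]

end Encodes

end EndGraph

/-! ### Soundness of the formula -/

namespace SetSystem

variable {α : Type*} {M : SetSystem α}

/-- All subsets of the ground set serve as vertices, the ends of an edge being the sets incident
with it; unused subsets are harmless isolated vertices. Nothing is assumed about the origin of
`inc`. -/
theorem Represents.exists_endGraph {inc : α → Set α → Prop} {L : Set α} (h : M.Represents inc L)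
    (hLE : L ⊆ M.E) : ∃ H : EndGraph α (Set α), M.E = H.E ∧
      (∀ I : Finset α, I ⊆ H.E → ((I : Set α) ∈ M.indep ↔ H.Sparse I)) ∧ ∀ e ∈ L, ∃ v, H.ends e = {v} := by
  obtain ⟨h1, h2, h3, h4⟩ := h
  have hfin : ∀ e, {W | W ⊆ M.E ∧ inc e W}.Finite := fun e =>
    M.finite_E.finite_subsets.subset fun W hW => hW.1
  have hmem : ∀ e W, W ∈ (hfin e).toFinset ↔ W ⊆ M.E ∧ inc e W := fun e W => by simp
  let H : EndGraph α (Set α) :=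
    { E := M.finite_E.toFinset
      V := M.finite_E.finite_subsets.toFinset
      ends := fun e => (hfin e).toFinset
      ends_subset := fun e _ W hW => by simpa using ((hmem e W).1 hW).1
      ends_nonempty := fun e he => by
        obtain ⟨W, hW, hi⟩ := h1 e (by simpa using he)
        exact ⟨W, (hmem e W).2 ⟨hW, hi⟩⟩
      card_ends_le := fun e he => by
        by_contra! hlt
        obtain ⟨a, b, d, ha, hb, hd, hab, had, hbd⟩ := Finset.two_lt_card_iff.1 hlt
        rw [hmem] at ha hb hd
        rcases h2 e (by simpa using he) a ha.1 b hb.1 d hd.1 ha.2 hb.2 hd.2 with h | h | h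
        · exact hab h
        · exact had h
        · exact hbd h }
  have hE : M.E = H.E := by simp [H]
  have hc : H.Encodes M inc id :=
    { ground := hE
      injOn := Function.injective_id.injOn
      subset := fun v hv => by simpa [H] using hv
      inc_iff := fun e he W hW => by simp [H, hW] }
  refine ⟨H, hE, fun I hI => ?_, fun e he => ?_⟩
  · rw [h4 I (by rw [hE]; exact_mod_cast hI), hc.sparse_iff hI]
  · obtain ⟨W, hW, hi⟩ := h1 e (hLE he)
    refine ⟨W, Finset.eq_singleton_iff_unique_mem.2 ⟨(hmem e W).2 ⟨hW, hi⟩, fun W' hW' => ?_⟩⟩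
    rw [hmem] at hW'
    exact h3 e (hLE he) he W' hW'.1 W hW hW'.2 hi

theorem BicircularLoops.isThreeConnectedRootedBicircular {L : Set α} (h : M.BicircularLoops L)
    (hLE : L ⊆ M.E) : M.IsThreeConnectedRootedBicircular L := by
  obtain ⟨h1, h2, h3⟩ := h
  obtain ⟨N, hN⟩ := h1.exists_isMatroid
  obtain ⟨inc, h⟩ : ∃ inc, M.Represents inc L := by
    rcases h3 with ⟨C₀, -, S₀, -, C₁, -, S₁, -, C₂, -, S₂, -, C₃, -, S₃, -, h⟩ | ⟨Z, -, P, -, Ω, -, R, -, h⟩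
    · exact ⟨_, h⟩
    · exact ⟨_, h⟩
  obtain ⟨H, hE, hI, hL⟩ := h.exists_endGraph hLE
  refine ⟨N, hN, hN.unseparated_iff.1 h2, EndGraph.isRootedBicircular (hN.1.trans hE) (fun I => ?_)
    (hN.1 ▸ hLE) hL⟩
  constructor
  · intro hi
    have hIE : I ⊆ H.E := by
      have := hi.subset_ground
      rw [hN.1, hE] at this
      exact_mod_cast this
    exact ⟨hIE, (hI I hIE).1 ((hN.2 I).1 hi)⟩
  · rintro ⟨hIE, hs⟩
    exact (hN.2 I).2 ((hI I hIE).2 hs)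

end SetSystem

/-! ### Few vertices, and reading flats from the matroid -/

namespace EndGraph

variable {α β : Type*} {H : EndGraph α β} {M : SetSystem α}

/-- Without isolated vertices `|V| ≤ 2|E| ≤ 2 ^ |E|`, so there are enough sets of edges to name the
vertices. -/
theorem exists_injOn_subsets (hV : H.V = H.span H.E) :
    ∃ c : β → Set α, Set.InjOn c H.V ∧ ∀ v ∈ H.V, c v ⊆ H.E := by
  have h1 : H.V.card ≤ H.E.powerset.card := by
    have h2 : H.V.card ≤ H.E.card * 2 := by
      rw [hV]
      exact Finset.card_biUnion_le_card_mul _ _ _ H.card_ends_le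
    rw [Finset.card_powerset]
    refine h2.trans ?_
    rcases H.E.card with - | n
    · simp
    · rw [pow_succ]
      exact Nat.mul_le_mul_right 2 n.lt_two_pow_self
  obtain ⟨f⟩ := Function.Embedding.nonempty_of_card_le (α := H.V) (β := H.E.powerset) (by simpa using h1)
  refine ⟨fun v => if h : v ∈ H.V then ((f ⟨v, h⟩ : Finset α) : Set α) else ∅, ?_, ?_⟩
  · intro v hv w hw h
    rw [Finset.mem_coe] at hv hw
    simp only [hv, hw, dif_pos, Finset.coe_inj, Subtype.coe_inj, f.injective.eq_iff] at h
    simpa using h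
  · intro v hv
    simp only [hv, dif_pos]
    exact_mod_cast Finset.mem_powerset.1 (f ⟨v, hv⟩).2

/-- Number the vertices injectively by `Fin 4` and guess name and star for each number; an unused
number gets an empty star and creates no incidence. -/
theorem exists_encodes_fewInc (hV : H.V = H.span H.E) (hE : M.E = H.E) (h4 : H.V.card ≤ 4) :
    ∃ C₀ ⊆ M.E, ∃ S₀ ⊆ M.E, ∃ C₁ ⊆ M.E, ∃ S₁ ⊆ M.E, ∃ C₂ ⊆ M.E, ∃ S₂ ⊆ M.E, ∃ C₃ ⊆ M.E, ∃ S₃ ⊆ M.E,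
      ∃ c, H.Encodes M (SetSystem.FewInc C₀ S₀ C₁ S₁ C₂ S₂ C₃ S₃) c := by
  obtain ⟨c, hc, hcE⟩ := exists_injOn_subsets hV
  obtain ⟨f, hf⟩ : ∃ f : β → Fin 4, Set.InjOn f H.V := by
    obtain ⟨f⟩ := Function.Embedding.nonempty_of_card_le (α := H.V) (β := Fin 4) (by simpa using h4)
    refine ⟨fun v => if h : v ∈ H.V then f ⟨v, h⟩ else 0, fun v hv w hw h => ?_⟩
    rw [Finset.mem_coe] at hv hw
    simp only [hv, hw, dif_pos, f.injective.eq_iff] at h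
    simpa using h
  let C : Fin 4 → Set α := fun i => {x | ∃ v ∈ H.V, f v = i ∧ x ∈ c v}
  let S : Fin 4 → Set α := fun i => {e | e ∈ H.E ∧ ∃ v ∈ H.ends e, f v = i}
  have hC : ∀ i, C i ⊆ M.E := by
    rintro i x ⟨v, hv, -, hx⟩
    rw [hE]; exact hcE v hv hx
  have hS : ∀ i, S i ⊆ M.E := by
    rintro i x ⟨hx, -⟩
    rw [hE]; exact hx
  have hCc : ∀ v ∈ H.V, C (f v) = c v := by
    intro v hv
    ext x
    constructor
    · rintro ⟨w, hw, hwv, hx⟩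
      rwa [← hf hw hv hwv]
    · intro hx
      exact ⟨v, hv, rfl, hx⟩
  refine ⟨C 0, hC 0, S 0, hS 0, C 1, hC 1, S 1, hS 1, C 2, hC 2, S 2, hS 2, C 3, hC 3, S 3, hS 3, c,
    hE, hc, fun v hv => hE ▸ hcE v hv, fun e he W _ => ?_⟩
  have : SetSystem.FewInc (C 0) (S 0) (C 1) (S 1) (C 2) (S 2) (C 3) (S 3) e W ↔ ∃ i, W = C i ∧ e ∈ S i := by
    simp [SetSystem.FewInc, Fin.exists_fin_succ]
  rw [this]
  constructor
  · rintro ⟨i, rfl, -, v, hv, rfl⟩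
    exact ⟨v, hv, hCc v (H.ends_subset e he hv)⟩
  · rintro ⟨v, hv, rfl⟩
    exact ⟨f v, (hCc v (H.ends_subset e he hv)).symm, he, v, hv, rfl⟩

/-- `M` is the family of sparse sets of edges of `H`. -/
def Realizes (H : EndGraph α β) (M : SetSystem α) : Prop :=
  M.E = H.E ∧ ∀ I : Finset α, I ⊆ H.E → ((I : Set α) ∈ M.indep ↔ H.Sparse I)

/-- The largest cyclic flat avoiding the edges at `v`. -/
noncomputable def flat (H : EndGraph α β) (v : β) : Set α := H.within (H.hull v)

theorem flat_subset_flat {v w : β} : H.flat v ⊆ H.flat w ↔ H.hull v ⊆ H.hull w := by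
  unfold flat
  rw [Finset.coe_subset, (H.hull_spec v).1.within_subset_iff]

theorem flat_inj {v w : β} : H.flat v = H.flat w ↔ H.hull v = H.hull w := by
  rw [Set.Subset.antisymm_iff, flat_subset_flat, flat_subset_flat, Finset.Subset.antisymm_iff]

theorem mem_flat {v : β} {e : α} : e ∈ H.flat v ↔ e ∈ H.E ∧ H.ends e ⊆ H.hull v := by
  unfold flat
  rw [Finset.mem_coe, mem_within]

theorem notMem_flat {v : β} {e : α} (h : v ∈ H.ends e) : e ∉ H.flat v := fun he =>
  H.notMem_hull v ((mem_flat.1 he).2 h)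

theorem flat_nonempty {v : β} : (H.flat v).Nonempty ↔ (H.hull v).Nonempty := by
  constructor
  · rintro ⟨e, he⟩
    obtain ⟨x, hx⟩ := H.ends_nonempty e (mem_flat.1 he).1
    exact ⟨x, (mem_flat.1 he).2 hx⟩
  · rintro ⟨x, hx⟩
    rw [← (H.hull_spec v).1.span_within] at hx
    obtain ⟨e, he, -⟩ := mem_span.1 hx
    exact ⟨e, he⟩

namespace Realizes

variable (hM : H.Realizes M)
include hM

theorem flat_subset (v : β) : H.flat v ⊆ M.E := by
  rw [hM.1]; exact Finset.coe_subset.2 (H.within_subset _)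

theorem cyclicFlat_iff {F : Set α} (hF : F ⊆ M.E) :
    M.CyclicFlat F ↔ ∃ S, H.Strong S ∧ F = H.within S := by
  have hfin : F.Finite := M.finite_E.subset hF
  lift F to Finset α using hfin
  rw [hM.1, Finset.coe_subset] at hF
  simp only [Finset.coe_inj]
  rw [← cycFlat_iff]
  unfold SetSystem.CyclicFlat CycFlat
  simp only [hF, true_and, hM.1, Finset.mem_coe]
  refine and_congr ?_ ?_
  · constructor
    · intro h f hf
      obtain ⟨I, -, hIF, hfI, hi, hd⟩ := h f (hF hf) hf
      have hfin : I.Finite := F.finite_toSet.subset hIF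
      lift I to Finset α using hfin
      rw [Finset.coe_subset] at hIF
      rw [← Finset.coe_insert, hM.2 _ (Finset.insert_subset (hF hf) (hIF.trans hF))] at hd
      exact ⟨I, hIF, by simpa using hfI, (hM.2 _ (hIF.trans hF)).1 hi, hd⟩
    · intro h f _ hf
      obtain ⟨I, hIF, hfI, hi, hd⟩ := h f hf
      refine ⟨I, by exact_mod_cast hIF.trans hF, by exact_mod_cast hIF, by simpa using hfI,
        (hM.2 _ (hIF.trans hF)).2 hi, ?_⟩
      rw [← Finset.coe_insert, hM.2 _ (Finset.insert_subset (hF hf) (hIF.trans hF))]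
      exact hd
  · refine forall_congr' fun x => imp_congr_right fun hx => imp_congr_right fun hxF => ?_
    constructor
    · intro h I hI hi
      have := h I (by exact_mod_cast hI.trans hF) (by exact_mod_cast hI) ((hM.2 _ (hI.trans hF)).2 hi)
      rwa [← Finset.coe_insert, hM.2 _ (Finset.insert_subset hx (hI.trans hF))] at this
    · intro h I _ hI hi
      have hfin : I.Finite := F.finite_toSet.subset hI
      lift I to Finset α using hfin
      rw [Finset.coe_subset] at hI
      rw [← Finset.coe_insert, hM.2 _ (Finset.insert_subset hx (hI.trans hF))]
      exact h I hI ((hM.2 _ (hI.trans hF)).1 hi)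

theorem cyclicFlat_flat (v : β) : M.CyclicFlat (H.flat v) :=
  (hM.cyclicFlat_iff (hM.flat_subset v)).2 ⟨_, (H.hull_spec v).1, rfl⟩

/-- A strong set inducing a cyclic flat without `e` misses an end of `e`, hence lies in the hull of
that end. So only flats of ends compete for maximality. -/
theorem exists_subset_flat {F : Set α} (hF : F ⊆ M.E) (hc : M.CyclicFlat F) {e : α} (he : e ∈ H.E)
    (heF : e ∉ F) : ∃ a ∈ H.ends e, F ⊆ H.flat a := by
  obtain ⟨S, hS, rfl⟩ := (hM.cyclicFlat_iff hF).1 hc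
  rw [Finset.mem_coe, mem_within, not_and, Finset.not_subset] at heF
  obtain ⟨a, ha, haS⟩ := heF he
  exact ⟨a, ha, Finset.coe_subset.2 (H.within_mono (H.subset_hull hS haS))⟩

theorem eq_flat_of_avoidMax {F : Set α} (hF : F ⊆ M.E) {e : α} (he : e ∈ H.E) (h : M.AvoidMax e F) :
    ∃ a ∈ H.ends e, F = H.flat a := by
  obtain ⟨a, ha, hFa⟩ := hM.exists_subset_flat hF h.1 he h.2.1
  exact ⟨a, ha, hFa.antisymm (h.2.2 _ (hM.flat_subset a) (hM.cyclicFlat_flat a) (notMem_flat ha) hFa)⟩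

theorem eq_flat_of_avoidTop {F : Set α} (hF : F ⊆ M.E) {e : α} (he : e ∈ H.E) (h : M.AvoidTop e F) :
    ∃ a ∈ H.ends e, F = H.flat a ∧ ∀ b ∈ H.ends e, H.flat b ⊆ F := by
  obtain ⟨a, ha, hFa⟩ := hM.exists_subset_flat hF h.1 he h.2.1
  have := fun b (hb : b ∈ H.ends e) => h.2.2 _ (hM.flat_subset b) (hM.cyclicFlat_flat b) (notMem_flat hb)
  exact ⟨a, ha, hFa.antisymm (this a ha), this⟩

theorem exists_hull_ssubset {v : β} {e : α} (he : e ∈ H.E) (hv : v ∈ H.ends e)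
    (h : ¬ M.AvoidMax e (H.flat v)) : ∃ b, H.ends e = {v, b} ∧ v ≠ b ∧ H.hull v ⊆ H.hull b ∧
      H.hull v ≠ H.hull b := by
  unfold SetSystem.AvoidMax at h
  push Not at h
  obtain ⟨F, hF, hc, heF, hvF, hFv⟩ := h (hM.cyclicFlat_flat v) (notMem_flat hv)
  obtain ⟨b, hb, hFb⟩ := hM.exists_subset_flat hF hc he heF
  have hne : H.hull v ≠ H.hull b := by
    intro heq
    rw [← flat_inj] at heq
    exact hFv (heq ▸ hFb)
  have hvb : v ≠ b := by rintro rfl; exact hne rfl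
  exact ⟨b, H.ends_eq_pair he hv hb hvb, hvb, flat_subset_flat.1 (hvF.trans hFb), hne⟩

theorem avoidTop_flat {v b : β} {e : α} (he : e ∈ H.E) (h : H.ends e = {v, b})
    (hvb : H.hull v ⊆ H.hull b) : M.AvoidTop e (H.flat b) := by
  refine ⟨hM.cyclicFlat_flat b, notMem_flat (by simp [h]), fun F hF hc heF => ?_⟩
  obtain ⟨a, ha, hFa⟩ := hM.exists_subset_flat hF hc he heF
  rw [h, Finset.mem_insert, Finset.mem_singleton] at ha
  rcases ha with rfl | rfl
  · exact hFa.trans (flat_subset_flat.2 hvb)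
  · exact hFa

theorem circ_iff {K : Finset α} (hK : K ⊆ H.E) : M.Circ K ↔ H.IsCirc K := by
  unfold SetSystem.Circ IsCirc
  rw [hM.2 K hK]
  refine and_congr_right fun _ => ?_
  constructor
  · intro h J hJ
    exact (hM.2 J (hJ.1.trans hK)).1 (h J (by rw [hM.1]; exact_mod_cast hJ.1.trans hK)
      (by exact_mod_cast hJ.1) (by exact_mod_cast hJ.2))
  · intro h J _ hJ hKJ
    have hfin : J.Finite := K.finite_toSet.subset hJ
    lift J to Finset α using hfin
    rw [Finset.coe_subset] at hJ hKJ
    exact (hM.2 J (hJ.trans hK)).2 (h J ⟨hJ, hKJ⟩)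

theorem skew_iff {K : Finset α} (hKE : K ⊆ H.E) (hK : H.IsCirc K) {F : Set α} (hF : F ⊆ M.E) :
    M.Skew K F ↔ ∃ S, H.Strong S ∧ F = H.within S ∧ Disjoint S (H.span K) := by
  unfold SetSystem.Skew
  rw [hM.cyclicFlat_iff hF]
  have key : ∀ S, H.Strong S → ((∀ I ⊆ M.E, ∀ J ⊆ M.E, I ⊆ (H.within S : Set α) → J ⊆ (K : Set α) →
      I ∈ M.indep → J ∈ M.indep → I ∪ J ∈ M.indep) ↔ Disjoint S (H.span K)) := by
    intro S hS
    rw [← hS.skew_iff hKE hK]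
    constructor
    · intro h I hI J hJ hi hj
      have hIE := hI.trans (H.within_subset S)
      have hJE := hJ.trans hKE
      have := h I (by rw [hM.1]; exact_mod_cast hIE) J (by rw [hM.1]; exact_mod_cast hJE)
        (by exact_mod_cast hI) (by exact_mod_cast hJ) ((hM.2 I hIE).2 hi) ((hM.2 J hJE).2 hj)
      rwa [← Finset.coe_union, hM.2 _ (Finset.union_subset hIE hJE)] at this
    · intro h I _ J _ hI hJ hi hj
      have hfin : I.Finite := (H.within S).finite_toSet.subset hI
      have hfin' : J.Finite := K.finite_toSet.subset hJ
      lift I to Finset α using hfin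
      lift J to Finset α using hfin'
      rw [Finset.coe_subset] at hI hJ
      have hIE := hI.trans (H.within_subset S)
      have hJE := hJ.trans hKE
      rw [← Finset.coe_union, hM.2 _ (Finset.union_subset hIE hJE)]
      exact h I hI J hJ ((hM.2 I hIE).1 hi) ((hM.2 J hJE).1 hj)
  constructor
  · rintro ⟨⟨S, hS, rfl⟩, h⟩
    exact ⟨S, hS, rfl, (key S hS).1 h⟩
  · rintro ⟨S, hS, rfl, h⟩
    exact ⟨⟨S, hS, rfl⟩, (key S hS).2 h⟩

/-- A strong set disjoint from `span K` avoids `v` and so lies in the hull of `v`, which is itself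
disjoint from `span K`. The circuit therefore determines the flat of `v`. -/
theorem skewMax_iff {K : Finset α} (hKE : K ⊆ H.E) (hK : H.IsCirc K) {v : β} (hv : v ∈ H.span K)
    (hd : Disjoint (H.hull v) (H.span K)) {F : Set α} (hF : F ⊆ M.E) :
    M.SkewMax K F ↔ F = H.flat v := by
  have h1 : M.Skew K (H.flat v) := (hM.skew_iff hKE hK (hM.flat_subset v)).2
    ⟨_, (H.hull_spec v).1, rfl, hd⟩
  have h2 : ∀ F' ⊆ M.E, M.Skew K F' → F' ⊆ H.flat v := by
    intro F' hF' h
    obtain ⟨S, hS, rfl, hdS⟩ := (hM.skew_iff hKE hK hF').1 h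
    exact Finset.coe_subset.2 (H.within_mono (H.subset_hull hS fun hvS => Finset.disjoint_left.1 hdS hvS hv))
  constructor
  · rintro ⟨h, hmax⟩
    exact (h2 F hF h).antisymm (hmax _ (hM.flat_subset v) h1 (h2 F hF h))
  · rintro rfl
    exact ⟨h1, fun F' hF' h _ => h2 F' hF' h⟩

end Realizes

end EndGraph

/-! ### Twins, and circuits through a vertex outside its hull -/

namespace EndGraph

variable {α β : Type*} {H : EndGraph α β} {M : SetSystem α}

/-- A standing assumption: minimum degree three, no cut-vertex, at least five vertices. -/
structure Robust (H : EndGraph α β) : Prop where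
  twoConn : H.TwoConn
  three_le_deg : ∀ v ∈ H.V, 3 ≤ H.deg v
  five_le_card : 5 ≤ H.V.card

/-- Distinct vertices with the same non-empty hull. -/
def Twin (H : EndGraph α β) (v w : β) : Prop :=
  v ∈ H.V ∧ w ∈ H.V ∧ v ≠ w ∧ H.hull v = H.hull w ∧ (H.hull v).Nonempty

theorem Twin.symm {v w : β} (h : H.Twin v w) : H.Twin w v :=
  ⟨h.2.1, h.1, h.2.2.1.symm, h.2.2.2.1.symm, h.2.2.2.1 ▸ h.2.2.2.2⟩

/-- The edges at a vertex. -/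
def star (H : EndGraph α β) (v : β) : Set α := {e | e ∈ H.E ∧ v ∈ H.ends e}

/-- The edges that join twins. -/
def twinEdges (H : EndGraph α β) : Set α := {e | e ∈ H.E ∧ ∃ v w, H.Twin v w ∧ H.ends e = {v, w}}

/-- The edges at the vertex with empty hull. -/
def rootStar (H : EndGraph α β) : Set α := {e | e ∈ H.E ∧ ∃ v ∈ H.ends e, H.hull v = ∅}

/-- The loops. -/
def loops (H : EndGraph α β) : Set α := {e | e ∈ H.E ∧ ∃ v, H.ends e = {v}}

namespace Robust

variable (hH : H.Robust)
include hH

theorem eq_or_eq_of_twin {v w : β} (h : H.Twin v w) {x : β} (hx : x ∈ H.V) (hxv : x ∉ H.hull v) :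
    x = v ∨ x = w := by
  by_cases hxe : x = v
  · exact Or.inl hxe
  · exact Or.inr (hH.twoConn.rim_subset_of_hull_eq hH.three_le_deg h.1 h.2.1 h.2.2.1 h.2.2.2.2 h.2.2.2.1
      (H.mem_rim.2 ⟨hx, hxe, hxv⟩))

theorem exists_edge_avoiding {v w : β} (hv : v ∈ H.V) (hw : w ∈ H.V) (hne : v ≠ w) :
    ∃ e ∈ H.E, v ∈ H.ends e ∧ w ∉ H.ends e := by
  have h1 := hH.twoConn.card_le_card_touch hw (Z := {v}) (by simp [hv, hne]) (by
    intro h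
    have := congrArg Finset.card h
    rw [Finset.card_erase_of_mem hw, Finset.card_singleton] at this
    have := hH.five_le_card
    omega)
  rw [Finset.card_singleton] at h1
  obtain ⟨e, he⟩ := Finset.card_pos.1 h1
  rw [mem_touch] at he
  obtain ⟨he, hwe, x, hx, hxe⟩ := he
  rw [Finset.mem_singleton] at hx
  exact ⟨e, he, hx ▸ hxe, hwe⟩

/-- The rim of `v` is just its twin `w`, so `card_touch_rim_le` allows a single edge. -/
theorem eq_of_twin_avoiding {v w : β} (h : H.Twin v w) {e f : α} (he : e ∈ H.E) (hf : f ∈ H.E)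
    (hwe : w ∈ H.ends e) (hwf : w ∈ H.ends f) (hve : v ∉ H.ends e) (hvf : v ∉ H.ends f) : e = f := by
  have h1 : H.rim v ⊆ {w} := fun x hx => by
    have hx' := H.mem_rim.1 hx
    rw [Finset.mem_singleton]
    exact (hH.eq_or_eq_of_twin h hx'.1 hx'.2.2).resolve_left hx'.2.1
  have hw : w ∈ H.rim v := H.mem_rim.2 ⟨h.2.1, h.2.2.1.symm, h.2.2.2.1 ▸ H.notMem_hull w⟩
  have h2 := (H.card_touch_rim_le v).trans (Finset.card_le_card h1)
  rw [Finset.card_singleton] at h2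
  exact Finset.card_le_one.1 h2 e (H.mem_touch.2 ⟨he, hve, w, hw, hwe⟩) f
    (H.mem_touch.2 ⟨hf, hvf, w, hw, hwf⟩)

/-- Otherwise every edge at `v` avoids `w`; there is at most one such edge, but `v` has degree at
least three. -/
theorem exists_twinEdge {v w : β} (h : H.Twin v w) : ∃ e ∈ H.E, H.ends e = {v, w} := by
  by_contra! hno
  have h1 : (H.E.filter fun e => v ∈ H.ends e).card ≤ 1 := by
    rw [Finset.card_le_one]
    intro e he f hf
    rw [Finset.mem_filter] at he hf
    refine hH.eq_of_twin_avoiding h.symm he.1 hf.1 he.2 hf.2 (fun hw => ?_) (fun hw => ?_)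
    · exact hno e he.1 (H.ends_eq_pair he.1 he.2 hw h.2.2.1)
    · exact hno f hf.1 (H.ends_eq_pair hf.1 hf.2 hw h.2.2.1)
  have h2 := hH.three_le_deg v h.1
  unfold deg at h2
  omega

/-- If `v` were a third vertex, `w` would lie in the rims of both `u` and `v`. -/
theorem eq_or_eq_of_twin_of_notMem_hull {u w : β} (h : H.Twin u w) {v : β} (hv : v ∈ H.V)
    (hne : (H.hull v).Nonempty) (hu : u ∉ H.hull v) : v = u ∨ v = w := by
  by_contra! hvuw
  have hw : w ∉ H.hull v := fun hw => H.notMem_hull w (h.2.2.2.1 ▸ H.hull_subset_hull hu hw)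
  exact hH.twoConn.disjoint_rims hH.three_le_deg hv h.1 hvuw.1 hne h.2.2.2.2
    (H.mem_rim.2 ⟨h.2.1, hvuw.2.symm, hw⟩)
    (H.mem_rim.2 ⟨h.2.1, h.2.2.1.symm, h.2.2.2.1 ▸ H.notMem_hull w⟩)

/-- This is how the formula recognises from the flat alone whether `v` has a twin, given the set of
twin edges. -/
theorem exists_twin_iff {v : β} (hv : v ∈ H.V) (hne : (H.hull v).Nonempty) :
    (∃ w, H.Twin v w) ↔ ∃ x ∈ H.E, x ∈ H.twinEdges ∧ x ∉ H.flat v := by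
  constructor
  · rintro ⟨w, h⟩
    obtain ⟨x, hx, hxe⟩ := hH.exists_twinEdge h
    exact ⟨x, hx, ⟨hx, v, w, h, hxe⟩, notMem_flat (by simp [hxe])⟩
  · rintro ⟨x, hx, ⟨-, u, w, h, hxe⟩, hxv⟩
    have : u ∉ H.hull v ∨ w ∉ H.hull v := by
      by_contra! hcon
      refine hxv (mem_flat.2 ⟨hx, ?_⟩)
      rw [hxe]
      exact Finset.insert_subset hcon.1 (by simpa using hcon.2)
    rcases this with hu | hw
    · rcases hH.eq_or_eq_of_twin_of_notMem_hull h hv hne hu with rfl | rfl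
      · exact ⟨w, h⟩
      · exact ⟨u, h.symm⟩
    · rcases hH.eq_or_eq_of_twin_of_notMem_hull h.symm hv hne hw with rfl | rfl
      · exact ⟨u, h.symm⟩
      · exact ⟨w, h⟩

/-- An edge outside the common flat has `v` or `w` as an end, and `s` is the only one that has `w`
but not `v`. Excluding `s` thus tells the twins apart. -/
theorem star_eq_of_twin {v w : β} (h : H.Twin v w) {s : α} (hs : s ∈ H.E) (hws : w ∈ H.ends s)
    (hvs : v ∉ H.ends s) {e : α} (he : e ∈ H.E) : e ∈ H.star v ↔ e ∉ H.flat v ∧ e ≠ s := by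
  constructor
  · rintro ⟨-, hv⟩
    exact ⟨notMem_flat hv, by rintro rfl; exact hvs hv⟩
  · rintro ⟨hf, hes⟩
    refine ⟨he, ?_⟩
    by_contra hve
    rw [mem_flat, not_and, Finset.not_subset] at hf
    obtain ⟨x, hx, hxv⟩ := hf he
    rcases hH.eq_or_eq_of_twin h (H.ends_subset e he hx) hxv with rfl | rfl
    · exact hve hx
    · exact hes (hH.eq_of_twin_avoiding h he hs hx hws hve hvs)

theorem notMem_twinEdges {v w : β} (h : H.Twin v w) {s : α} (hws : w ∈ H.ends s)
    (hvs : v ∉ H.ends s) : s ∉ H.twinEdges := by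
  rintro ⟨-, a, b, hab, hse⟩
  rw [hse] at hws hvs
  simp only [Finset.mem_insert, Finset.mem_singleton, not_or] at hws hvs
  rcases hws with rfl | rfl
  · have := hH.eq_or_eq_of_twin h hab.2.1 (by
      rw [h.2.2.2.1, hab.2.2.2.1]; exact H.notMem_hull b)
    rcases this with rfl | rfl
    · exact hvs.2 rfl
    · exact hab.2.2.1 rfl
  · have := hH.eq_or_eq_of_twin h hab.1 (by
      rw [h.2.2.2.1, ← hab.2.2.2.1]; exact H.notMem_hull a)
    rcases this with rfl | rfl
    · exact hvs.1 rfl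
    · exact hab.2.2.1 rfl

/-- Degree counting gives more edges than vertices outside the hull, hence a circuit there. A
circuit missing `v` is impossible because it would push the number of edges touching the rim and
avoiding `v` above `|rim v|`. -/
theorem exists_circ {v : β} (hv : v ∈ H.V) (hne : (H.hull v).Nonempty)
    (h : ∀ e ∈ H.E, v ∈ H.ends e → ∃ b ∈ H.rim v, H.ends e = {v, b}) :
    ∃ K ⊆ H.E, H.IsCirc K ∧ v ∈ H.span K ∧ H.span K ⊆ H.V \ H.hull v := by
  have hvh := H.notMem_hull v
  have hX : H.V \ H.hull v = insert v (H.rim v) := by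
    ext x
    rw [Finset.mem_sdiff, Finset.mem_insert, mem_rim]
    by_cases hxv : x = v
    · subst hxv; tauto
    · tauto
  have hvr : v ∉ H.rim v := fun h => (H.mem_rim.1 h).2.1 rfl
  have htouch := H.card_touch_rim_le v
  have hdense : ¬ H.Sparse (H.within (H.V \ H.hull v)) := by
    refine not_sparse_of_card_lt subset_rfl
      ((Finset.card_le_card (span_within_subset _ subset_rfl)).trans_lt ?_)
    rw [hX, Finset.card_insert_of_notMem hvr]
    have h1 := H.three_mul_card_add_le (Y := H.rim v) (A := H.within (insert v (H.rim v)))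
      (B := H.touch v (H.rim v)) (X := ∅) (fun x hx => hH.three_le_deg x (H.mem_rim.1 hx).1)
      (H.within_subset _) (H.touch_subset _ _) (by simp) (fun e he => by
        obtain ⟨x, hx, y, hy, hxy⟩ := H.exists_ends he
        by_cases hve : v ∈ H.ends e
        · obtain ⟨b, hb, hbe⟩ := h e he hve
          have hA : e ∈ H.within (insert v (H.rim v)) := by
            rw [mem_within, hbe]
            exact ⟨he, Finset.insert_subset_insert v (by simpa using hb)⟩
          have hB : e ∉ H.touch v (H.rim v) := fun h' => (H.mem_touch.1 h').2.1 hve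
          have hc : (H.ends e ∩ H.rim v).card ≤ 1 := by
            rw [hbe, Finset.insert_inter_of_notMem hvr]
            exact (Finset.card_le_card Finset.inter_subset_left).trans (by simp)
          simpa [hA, hB] using hc
        · by_cases hsub : H.ends e ⊆ H.rim v
          · have hA : e ∈ H.within (insert v (H.rim v)) := H.mem_within.2
              ⟨he, hsub.trans (Finset.subset_insert _ _)⟩
            have hB : e ∈ H.touch v (H.rim v) := H.mem_touch.2
              ⟨he, hve, x, hsub (by simp [hxy]), by simp [hxy]⟩
            have := (Finset.card_le_card (Finset.inter_subset_left : H.ends e ∩ H.rim v ⊆ _)).trans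
              (H.card_ends_le e he)
            simpa [hA, hB] using this
          · by_cases hemp : H.ends e ∩ H.rim v = ∅
            · simp [hemp]
            · obtain ⟨z, hz⟩ := Finset.nonempty_iff_ne_empty.2 hemp
              rw [Finset.mem_inter] at hz
              have hB : e ∈ H.touch v (H.rim v) := H.mem_touch.2 ⟨he, hve, z, hz.2, hz.1⟩
              have h1 : (H.ends e ∩ H.rim v).card < (H.ends e).card :=
                Finset.card_lt_card (Finset.ssubset_iff_subset_ne.2 ⟨Finset.inter_subset_left,
                  fun heq => hsub (Finset.inter_eq_left.1 heq)⟩)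
              have h2 := H.card_ends_le e he
              have hc : (H.ends e ∩ H.rim v).card ≤ 1 := by omega
              simp only [Finset.notMem_empty, if_false, hB, if_true]
              omega)
    have h2 : H.deg v ≤ (H.within (insert v (H.rim v))).card := Finset.card_le_card fun e he => by
      rw [Finset.mem_filter] at he
      obtain ⟨b, hb, hbe⟩ := h e he.1 he.2
      rw [mem_within, hbe]
      exact ⟨he.1, Finset.insert_subset_insert v (by simpa using hb)⟩
    have h3 := hH.three_le_deg v hv
    have h4 : 0 < (H.rim v).card := by
      obtain ⟨e, he⟩ := Finset.card_pos.1 (by unfold deg at h3; omega : 0 < (H.E.filter fun e => v ∈ H.ends e).card)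
      rw [Finset.mem_filter] at he
      obtain ⟨b, hb, -⟩ := h e he.1 he.2
      exact Finset.card_pos.2 ⟨b, hb⟩
    rw [Finset.card_empty] at h1
    omega
  obtain ⟨K, hKX, hK⟩ := exists_isCirc_of_not_sparse hdense
  have hKE := hKX.trans (H.within_subset _)
  have hKs := span_within_subset _ hKX
  refine ⟨K, hKE, hK, ?_, hKs⟩
  by_contra hvK
  have hKr : H.span K ⊆ H.rim v := fun x hx => by
    have := hKs hx
    rw [hX, Finset.mem_insert] at this
    exact this.resolve_left (by rintro rfl; exact hvK hx)
  -- Growing from the hull and `span K` through `H - v` yields an edge for every remaining rim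
  -- vertex, besides the more than `|span K|` edges of `K`.
  have hsub : H.hull v ∪ H.span K ⊆ H.V.erase v := Finset.union_subset
    (fun x hx => Finset.mem_erase.2 ⟨by rintro rfl; exact hvh hx, H.hull_subset v hx⟩)
    (hKr.trans Finset.sdiff_subset)
  have h1 := H.card_sdiff_le_card_filter (F := H.E) subset_rfl (U := H.V.erase v) _ hsub
    fun Q hQ hQU hQne => by
      obtain ⟨e, he, hve, hq, hr⟩ := hH.twoConn v hv Q hQU (hne.mono (Finset.subset_union_left.trans hQ)) hQne
      exact ⟨e, he, fun x hx => Finset.mem_erase.2 ⟨by rintro rfl; exact hve hx, H.ends_subset e he hx⟩,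
        hq, hr⟩
  set N := H.E.filter fun e => H.ends e ⊆ H.V.erase v ∧
    ∃ u ∈ H.V.erase v \ (H.hull v ∪ H.span K), u ∈ H.ends e with hN
  have hd : Disjoint K N := by
    rw [Finset.disjoint_left]
    intro e he heN
    rw [hN, Finset.mem_filter] at heN
    obtain ⟨-, -, u, hu, hue⟩ := heN
    exact (Finset.mem_sdiff.1 hu).2 (Finset.mem_union_right _ (mem_span.2 ⟨e, he, hue⟩))
  have h2 : K ∪ N ⊆ H.touch v (H.rim v) := by
    intro e he
    rw [mem_touch]
    rcases Finset.mem_union.1 he with he | he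
    · obtain ⟨x, hx⟩ := H.ends_nonempty e (hKE he)
      exact ⟨hKE he, fun hve => hvK (mem_span.2 ⟨e, he, hve⟩), x, hKr (mem_span.2 ⟨e, he, hx⟩), hx⟩
    · rw [hN, Finset.mem_filter] at he
      obtain ⟨he, hsub, u, hu, hue⟩ := he
      rw [Finset.mem_sdiff, Finset.mem_union, not_or] at hu
      exact ⟨he, fun hve => (Finset.mem_erase.1 (hsub hve)).1 rfl, u,
        Finset.mem_sdiff.2 ⟨hu.1, hu.2.1⟩, hue⟩
  have h3 := Finset.card_le_card h2
  rw [Finset.card_union_of_disjoint hd] at h3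
  have h4 := hK.card_lt
  have h5 : H.V.erase v \ (H.hull v ∪ H.span K) = H.rim v \ H.span K := by
    unfold rim; rw [Finset.sdiff_union_distrib, ← Finset.sdiff_sdiff_left']
  have h6 := Finset.card_sdiff_add_card_eq_card hKr
  rw [h5] at h1
  omega

end Robust

end EndGraph

/-! ### Vertex codes and the incidence relation for many vertices -/

namespace EndGraph

variable {α β : Type*} {H : EndGraph α β} {M : SetSystem α}

/-- No edge at `v` has the flat of `v` as a maximal cyclic flat avoiding it. -/
def Hidden (H : EndGraph α β) (M : SetSystem α) (v : β) : Prop :=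
  v ∈ H.V ∧ (H.hull v).Nonempty ∧ ∀ e ∈ H.E, v ∈ H.ends e → ¬ M.AvoidMax e (H.flat v)

/-- The set encoding a vertex. -/
noncomputable def vertexCode (H : EndGraph α β) (v : β) : Set α :=
  if H.hull v = ∅ then H.E else if ∃ w, H.Twin v w then H.star v else H.E \ H.flat v

theorem vertexCode_subset (v : β) : H.vertexCode v ⊆ H.E := by
  unfold vertexCode
  split_ifs
  · exact subset_rfl
  · exact fun e he => he.1
  · exact Set.sdiff_subset

theorem disjoint_vertexCode_flat {v : β} (h : (H.hull v).Nonempty) {e : α} (he : e ∈ H.vertexCode v) :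
    e ∉ H.flat v := by
  unfold vertexCode at he
  rw [if_neg h.ne_empty] at he
  split_ifs at he
  · exact notMem_flat he.2
  · exact he.2

theorem vertexCode_ne {v : β} (h : (H.hull v).Nonempty) : H.vertexCode v ≠ H.E := by
  obtain ⟨e, he⟩ := flat_nonempty.2 h
  intro heq
  exact disjoint_vertexCode_flat h (by rw [heq]; exact (mem_flat.1 he).1) he

namespace Robust

variable (hH : H.Robust) (hM : H.Realizes M)
include hH

/-- Distinct vertices have distinct stars, and vertices with equal non-empty hulls are twins. In the
mixed case, the star of a twin contains a twin edge, whereas the code of a vertex without a twin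
contains none. -/
theorem injOn_vertexCode : Set.InjOn H.vertexCode H.V := by
  intro v hv w hw heq
  rw [Finset.mem_coe] at hv hw
  by_contra hne
  rcases (H.hull v).eq_empty_or_nonempty with hve | hve <;>
    rcases (H.hull w).eq_empty_or_nonempty with hwe | hwe
  · exact hne (eq_of_hull_eq_empty hH.three_le_deg hH.five_le_card hv hw hve hwe)
  · exact vertexCode_ne hwe (by rw [← heq, vertexCode, if_pos hve])
  · exact vertexCode_ne hve (by rw [heq, vertexCode, if_pos hwe])
  · have mixed : ∀ a b, b ∈ H.V → (H.hull a).Nonempty → (H.hull b).Nonempty → (∃ c, H.Twin a c) →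
        (¬ ∃ c, H.Twin b c) → H.vertexCode a ≠ H.vertexCode b := by
      rintro a b hb hae hbe ⟨c, hac⟩ hbt h
      obtain ⟨x, hx, hxe⟩ := hH.exists_twinEdge hac
      have hxa : x ∈ H.vertexCode a := by
        rw [vertexCode, if_neg hae.ne_empty, if_pos ⟨c, hac⟩]
        exact ⟨hx, by simp [hxe]⟩
      rw [h] at hxa
      exact hbt ((hH.exists_twin_iff hb hbe).2 ⟨x, hx, ⟨hx, a, c, hac, hxe⟩,
        disjoint_vertexCode_flat hbe hxa⟩)
    by_cases hvt : ∃ c, H.Twin v c <;> by_cases hwt : ∃ c, H.Twin w c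
    · rw [vertexCode, vertexCode, if_neg hve.ne_empty, if_neg hwe.ne_empty, if_pos hvt, if_pos hwt] at heq
      obtain ⟨e, he, hve', hwe'⟩ := hH.exists_edge_avoiding hv hw hne
      have : e ∈ H.star v := ⟨he, hve'⟩
      rw [heq] at this
      exact hwe' this.2
    · exact mixed v w hw hve hwe hvt hwt heq
    · exact mixed w v hv hwe hve hwt hvt heq.symm
    · rw [vertexCode, vertexCode, if_neg hve.ne_empty, if_neg hwe.ne_empty, if_neg hvt, if_neg hwt] at heq
      refine hvt ⟨w, hv, hw, hne, ?_, hve⟩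
      rw [← flat_inj]
      ext e
      have hE : ∀ v, e ∈ H.flat v → e ∈ H.E := fun v h => (mem_flat.1 h).1
      have := Set.ext_iff.1 heq e
      simp only [Set.mem_sdiff, Finset.mem_coe] at this
      constructor
      · intro h
        by_contra h'
        exact (this.2 ⟨hE v h, h'⟩).2 h
      · intro h
        by_contra h'
        exact (this.1 ⟨hE w h, h'⟩).2 h

include hM

omit hH in
theorem hidden_edge {v : β} (h : H.Hidden M v) {e : α} (he : e ∈ H.E) (hv : v ∈ H.ends e) :
    ∃ b ∈ H.rim v, H.ends e = {v, b} := by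
  obtain ⟨b, hb, hvb, hsub, -⟩ := hM.exists_hull_ssubset he hv (h.2.2 e he hv)
  refine ⟨b, H.mem_rim.2 ⟨H.ends_subset e he (by simp [hb]), hvb.symm, fun hbv => ?_⟩, hb⟩
  exact H.notMem_hull b (hsub hbv)

/-- If `w` were outside the hull of `v`, an edge at `w` avoiding `v` would have its other end in
both rims. So each vertex lies in the hull of the other, and disjointness of the rims does the rest.
-/
theorem disjoint_of_hidden {v w : β} (hv : H.Hidden M v) (hw : H.Hidden M w) (hne : v ≠ w) :
    Disjoint (H.V \ H.hull v) (H.V \ H.hull w) := by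
  have key : ∀ v w, H.Hidden M v → H.Hidden M w → v ≠ w → w ∈ H.hull v := by
    intro v w hv hw hne
    by_contra hwv
    have hsub := H.hull_subset_hull hwv
    obtain ⟨e, he, hwe, hve⟩ := hH.exists_edge_avoiding hw.1 hv.1 hne.symm
    obtain ⟨b, hb, hbe⟩ := hidden_edge hM hw he hwe
    have hb' := H.mem_rim.1 hb
    rw [hbe] at hve
    refine hH.twoConn.disjoint_rims hH.three_le_deg hv.1 hw.1 hne hv.2.1 hw.2.1
      (H.mem_rim.2 ⟨hb'.1, ?_, fun h => hb'.2.2 (hsub h)⟩) hb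
    rintro rfl
    simp at hve
  rw [Finset.disjoint_left]
  intro x hx hx'
  rw [Finset.mem_sdiff] at hx hx'
  refine hH.twoConn.disjoint_rims hH.three_le_deg hv.1 hw.1 hne hv.2.1 hw.2.1
    (H.mem_rim.2 ⟨hx.1, ?_, hx.2⟩) (H.mem_rim.2 ⟨hx.1, ?_, hx'.2⟩)
  · rintro rfl; exact hx'.2 (key w x hw hv hne.symm)
  · rintro rfl; exact hx.2 (key v x hv hw hne)

/-- A set of edges whose circuits exhibit precisely the flats of the hidden vertices. -/
theorem exists_witness : ∃ Ω ⊆ M.E, ∀ F ⊆ M.E,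
    (∃ K ⊆ M.E, K ⊆ Ω ∧ M.Circ K ∧ M.SkewMax K F) ↔ ∃ v, H.Hidden M v ∧ F = H.flat v := by
  have hex : ∀ v, ∃ K : Finset α, H.Hidden M v →
      K ⊆ H.E ∧ H.IsCirc K ∧ v ∈ H.span K ∧ H.span K ⊆ H.V \ H.hull v := by
    intro v
    by_cases h : H.Hidden M v
    · obtain ⟨K, hK⟩ := hH.exists_circ h.1 h.2.1 fun e he hv => hidden_edge hM h he hv
      exact ⟨K, fun _ => hK⟩
    · exact ⟨∅, fun h' => absurd h' h⟩
  choose K hK using hex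
  have hKd : ∀ v, H.Hidden M v → Disjoint (H.hull v) (H.span (K v)) := fun v hv =>
    Finset.disjoint_of_subset_right (hK v hv).2.2.2 Finset.disjoint_sdiff
  refine ⟨{e | ∃ v, H.Hidden M v ∧ e ∈ K v}, ?_, fun F hF => ?_⟩
  · rintro e ⟨v, hv, he⟩
    rw [hM.1]
    exact (hK v hv).1 he
  constructor
  · rintro ⟨C, hCE, hCΩ, hC, hCF⟩
    have hfin : C.Finite := M.finite_E.subset hCE
    lift C to Finset α using hfin
    rw [hM.1, Finset.coe_subset] at hCE
    have hC' := (hM.circ_iff hCE).1 hC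
    obtain ⟨e, he⟩ := hC'.nonempty
    obtain ⟨v, hv, hev⟩ := hCΩ he
    obtain ⟨hKE, hKc, hvK, hKs⟩ := hK v hv
    -- Chosen circuits of different hidden vertices span disjoint sets, so a circuit in their union
    -- cannot be spread over several of them.
    have hCK : C ⊆ K v := by
      by_contra hCK
      have h1 : C ∩ K v ⊂ C := Finset.ssubset_iff_subset_ne.2 ⟨Finset.inter_subset_left, fun h =>
        hCK (Finset.inter_eq_left.1 h)⟩
      have h2 : C \ K v ⊂ C := Finset.ssubset_iff_subset_ne.2 ⟨Finset.sdiff_subset, fun h =>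
        (Finset.mem_sdiff.1 (by rw [h]; exact he : e ∈ C \ K v)).2 hev⟩
      have h3 := (hC'.2 _ h1).union_of_disjoint (hC'.2 _ h2) (by
        rw [Finset.disjoint_left]
        intro x hx hx'
        obtain ⟨f, hf, hxf⟩ := mem_span.1 hx'
        rw [Finset.mem_sdiff] at hf
        obtain ⟨w, hw, hfw⟩ := hCΩ hf.1
        have hvw : v ≠ w := by rintro rfl; exact hf.2 hfw
        exact Finset.disjoint_left.1 (hH.disjoint_of_hidden hM hv hw hvw)
          (hKs (span_mono Finset.inter_subset_right hx)) ((hK w hw).2.2.2 (mem_span.2 ⟨f, hfw, hxf⟩)))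
      rw [Finset.union_comm, Finset.sdiff_union_inter] at h3
      exact hC'.1 h3
    have hCeq : C = K v := by
      by_contra hne
      exact hC'.1 (hKc.2 C (Finset.ssubset_iff_subset_ne.2 ⟨hCK, hne⟩))
    subst hCeq
    exact ⟨v, hv, (hM.skewMax_iff hKE hKc hvK (hKd v hv) hF).1 hCF⟩
  · rintro ⟨v, hv, rfl⟩
    obtain ⟨hKE, hKc, hvK, hKs⟩ := hK v hv
    exact ⟨K v, by rw [hM.1]; exact_mod_cast hKE, fun e he => ⟨v, hv, he⟩, (hM.circ_iff hKE).2 hKc,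
      (hM.skewMax_iff hKE hKc hvK (hKd v hv) hF).2 rfl⟩

omit hH in
-- A vertex is hidden precisely when its flat does not appear as a maximal one for an edge at it;
-- the circuits in `Ω` supply these missing flats and no others.
theorem code_iff {Ω : Set α} (hΩ : ∀ F ⊆ M.E,
    (∃ K ⊆ M.E, K ⊆ Ω ∧ M.Circ K ∧ M.SkewMax K F) ↔ ∃ v, H.Hidden M v ∧ F = H.flat v)
    {F : Set α} (hF : F ⊆ M.E) :
    M.Code Ω F ↔ ∃ v ∈ H.V, (H.hull v).Nonempty ∧ F = H.flat v := by
  unfold SetSystem.Code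
  rw [hΩ F hF]
  constructor
  · rintro ⟨⟨x, -, hx⟩, ⟨e, he, h⟩ | ⟨v, hv, rfl⟩⟩
    · rw [hM.1] at he
      obtain ⟨a, ha, rfl⟩ := hM.eq_flat_of_avoidMax hF he h
      exact ⟨a, H.ends_subset e he ha, flat_nonempty.1 ⟨x, hx⟩, rfl⟩
    · exact ⟨v, hv.1, hv.2.1, rfl⟩
  · rintro ⟨v, hv, hne, rfl⟩
    obtain ⟨x, hx⟩ := flat_nonempty.2 hne
    refine ⟨⟨x, hF hx, hx⟩, ?_⟩
    by_cases h : ∃ e ∈ M.E, M.AvoidMax e (H.flat v)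
    · exact Or.inl h
    · push Not at h
      exact Or.inr ⟨v, ⟨hv, hne, fun e he _ => h e (by rw [hM.1]; exact he)⟩, rfl⟩

theorem exists_of_manyInc {Ω : Set α} (hΩ : ∀ F ⊆ M.E,
    (∃ K ⊆ M.E, K ⊆ Ω ∧ M.Circ K ∧ M.SkewMax K F) ↔ ∃ v, H.Hidden M v ∧ F = H.flat v)
    {e : α} (he : e ∈ H.E) {W : Set α} (hW : W ⊆ M.E)
    (h : M.ManyInc H.loops H.twinEdges Ω H.rootStar e W) : ∃ v ∈ H.ends e, W = H.vertexCode v := by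
  rcases h with ⟨hEW, -, p, hp, hpe⟩ | ⟨heW, F, hF, hcode, h⟩
  · refine ⟨p, hp, ?_⟩
    rw [vertexCode, if_pos hpe, ← hM.1]
    exact hW.antisymm hEW
  obtain ⟨v, hv, hvne, rfl⟩ := (code_iff hM hΩ hF).1 hcode
  rcases h with ⟨hP, hWF, h⟩ | ⟨⟨x, hx, hxP, hxv⟩, s, hs, hsv, hsP, hWs⟩
  · have hnt : ¬ ∃ w, H.Twin v w := by
      rw [hH.exists_twin_iff hv hvne]
      rintro ⟨x, hx, hxP, hxv⟩
      exact hxv (hP x (by rw [hM.1]; exact hx) hxP)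
    refine ⟨v, ?_, ?_⟩
    · rcases h with h | ⟨heZ, heR, F', hF', h, hvF', hF'v⟩
      · obtain ⟨a, ha, hva⟩ := hM.eq_flat_of_avoidMax hF he h
        -- Two vertices with the same flat are twins, and `v` has none.
        by_cases hav : v = a
        · exact hav ▸ ha
        · exact absurd ⟨a, hv, H.ends_subset e he ha, hav, flat_inj.1 hva, hvne⟩ hnt
      · obtain ⟨b, hb, rfl, hmax⟩ := hM.eq_flat_of_avoidTop hF' he h
        obtain ⟨a, ha, hab⟩ : ∃ a ∈ H.ends e, a ≠ b := by
          by_contra! hcon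
          exact heZ ⟨he, b, Finset.eq_singleton_iff_unique_mem.2 ⟨hb, hcon⟩⟩
        have hane : (H.hull a).Nonempty := by
          by_contra hemp
          exact heR ⟨he, a, ha, Finset.not_nonempty_iff_eq_empty.1 hemp⟩
        by_contra hve
        have hva : v ≠ a := by rintro rfl; exact hve ha
        have hvb : v ≠ b := by rintro rfl; exact hve hb
        -- The flats of `v` and of the end `a` both lie in that of `b`, so `b` would be in both rims
        -- if `v` were not an end of `e`.
        refine hH.twoConn.disjoint_rims hH.three_le_deg hv (H.ends_subset e he ha) hva hvne hane
          (H.mem_rim.2 ⟨H.ends_subset e he hb, hvb.symm, fun h' => ?_⟩)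
          (H.mem_rim.2 ⟨H.ends_subset e he hb, hab.symm, fun h' => ?_⟩)
        · exact H.notMem_hull b (flat_subset_flat.1 hvF' h')
        · exact H.notMem_hull b (flat_subset_flat.1 (hmax a ha) h')
    · rw [vertexCode, if_neg hvne.ne_empty, if_neg hnt]
      ext y
      constructor
      · intro hy
        have hyE := hW hy
        exact ⟨by rw [← hM.1]; exact hyE, (hWF y hyE).1 hy⟩
      · rintro ⟨hy, hyv⟩
        exact (hWF y (by rw [hM.1]; exact hy)).2 hyv
  · rw [hM.1] at hx hs
    obtain ⟨w, htw⟩ := (hH.exists_twin_iff hv hvne).2 ⟨x, hx, hxP, hxv⟩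
    -- The formula does not say which twin `s` avoids. Twins have the same flat, so the roles may be
    -- exchanged.
    have main : ∀ v w, H.Twin v w → (∀ x ∈ M.E, x ∈ W ↔ x ∉ H.flat v ∧ x ≠ s) → w ∈ H.ends s →
        v ∉ H.ends s → ∃ v ∈ H.ends e, W = H.vertexCode v := by
      intro v w htw hWs hws hvs
      have hWstar : W = H.star v := by
        ext y
        constructor
        · intro hy
          have hyE := hW hy
          exact (hH.star_eq_of_twin htw hs hws hvs (by rw [hM.1] at hyE; exact hyE)).2 ((hWs y hyE).1 hy)
        · intro hy
          exact (hWs y (by rw [hM.1]; exact hy.1)).2 ((hH.star_eq_of_twin htw hs hws hvs hy.1).1 hy)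
      rw [hWstar] at heW ⊢
      exact ⟨v, heW.2, by rw [vertexCode, if_neg htw.2.2.2.2.ne_empty, if_pos ⟨w, htw⟩]⟩
    by_cases hvs : v ∈ H.ends s
    · by_cases hws : w ∈ H.ends s
      · exact absurd ⟨hs, v, w, htw, H.ends_eq_pair hs hvs hws htw.2.2.1⟩ hsP
      · exact main w v htw.symm (by rw [← flat_inj.2 htw.2.2.2.1]; exact hWs) hvs hws
    · refine main v w htw hWs ?_ hvs
      rw [mem_flat, not_and, Finset.not_subset] at hsv
      obtain ⟨y, hy, hyv⟩ := hsv hs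
      rcases hH.eq_or_eq_of_twin htw (H.ends_subset s hs hy) hyv with rfl | rfl
      · exact absurd hy hvs
      · exact hy

theorem manyInc_vertexCode {Ω : Set α} (hΩ : ∀ F ⊆ M.E,
    (∃ K ⊆ M.E, K ⊆ Ω ∧ M.Circ K ∧ M.SkewMax K F) ↔ ∃ v, H.Hidden M v ∧ F = H.flat v)
    {e : α} (he : e ∈ H.E) {v : β} (hve : v ∈ H.ends e) :
    M.ManyInc H.loops H.twinEdges Ω H.rootStar e (H.vertexCode v) := by
  have hv := H.ends_subset e he hve
  rcases (H.hull v).eq_empty_or_nonempty with hemp | hvne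
  · refine Or.inl ⟨fun x hx => ?_, he, v, hve, hemp⟩
    rw [vertexCode, if_pos hemp, ← hM.1]
    exact hx
  have hcode := (code_iff hM hΩ (hM.flat_subset v)).2 ⟨v, hv, hvne, rfl⟩
  by_cases htw : ∃ w, H.Twin v w
  · rw [vertexCode, if_neg hvne.ne_empty, if_pos htw]
    obtain ⟨x, hx, hxP, hxv⟩ := (hH.exists_twin_iff hv hvne).1 htw
    obtain ⟨w, htw⟩ := htw
    obtain ⟨s, hs, hws, hvs⟩ := hH.exists_edge_avoiding htw.2.1 hv htw.2.2.1.symm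
    refine Or.inr ⟨⟨he, hve⟩, H.flat v, hM.flat_subset v, hcode, Or.inr
      ⟨⟨x, by rw [hM.1]; exact hx, hxP, hxv⟩, s, by rw [hM.1]; exact hs, ?_,
        hH.notMem_twinEdges htw hws hvs, fun y hy => ?_⟩⟩
    · rw [flat_inj.2 htw.2.2.2.1]; exact notMem_flat hws
    · rw [hM.1] at hy
      exact hH.star_eq_of_twin htw hs hws hvs hy
  · rw [vertexCode, if_neg hvne.ne_empty, if_neg htw]
    refine Or.inr ⟨⟨he, notMem_flat hve⟩, H.flat v, hM.flat_subset v, hcode, Or.inl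
      ⟨fun x hx hxP => ?_, fun x hx => ?_, ?_⟩⟩
    · by_contra hxv
      rw [hM.1] at hx
      exact htw ((hH.exists_twin_iff hv hvne).2 ⟨x, hx, hxP, hxv⟩)
    · rw [hM.1] at hx
      simp [Finset.mem_coe.1 hx]
    · by_cases hmax : M.AvoidMax e (H.flat v)
      · exact Or.inl hmax
      · obtain ⟨b, hb, hvb, hsub, hne⟩ := hM.exists_hull_ssubset he hve hmax
        refine Or.inr ⟨?_, ?_, H.flat b, hM.flat_subset b, hM.avoidTop_flat he hb hsub,
          flat_subset_flat.2 hsub, fun h => hne (hsub.antisymm (flat_subset_flat.1 h))⟩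
        · rintro ⟨-, x, hx⟩
          have h1 : v ∈ ({x} : Finset β) := hx ▸ hve
          have h2 : b ∈ ({x} : Finset β) := hx ▸ (by rw [hb]; simp)
          rw [Finset.mem_singleton] at h1 h2
          exact hvb (h1.trans h2.symm)
        · rintro ⟨-, p, hp, hpe⟩
          rw [hb, Finset.mem_insert, Finset.mem_singleton] at hp
          rcases hp with rfl | rfl
          · exact hvne.ne_empty hpe
          · exact (hvne.mono hsub).ne_empty hpe

theorem exists_encodes_manyInc :
    ∃ Z ⊆ M.E, ∃ P ⊆ M.E, ∃ Ω ⊆ M.E, ∃ R ⊆ M.E, H.Encodes M (M.ManyInc Z P Ω R) H.vertexCode := by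
  obtain ⟨Ω, hΩE, hΩ⟩ := hH.exists_witness hM
  have hE : ∀ {X : Set α}, X ⊆ H.E → X ⊆ M.E := fun h => by rw [hM.1]; exact h
  refine ⟨H.loops, hE fun e he => he.1, H.twinEdges, hE fun e he => he.1, Ω, hΩE, H.rootStar,
    hE fun e he => he.1, hM.1, hH.injOn_vertexCode, fun v _ => hE (vertexCode_subset v),
    fun e he W hW => ⟨hH.exists_of_manyInc hM hΩ he hW, ?_⟩⟩
  rintro ⟨v, hv, rfl⟩
  exact hH.manyInc_vertexCode hM hΩ he hv

end Robust

end EndGraph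

/-! ### Completeness and conclusion -/

theorem SetSystem.IsThreeConnectedRootedBicircular.bicircularLoops {α : Type*} {M : SetSystem α} {L : Set α}
    (hLE : L ⊆ M.E) (h : M.IsThreeConnectedRootedBicircular L) : M.BicircularLoops L := by
  obtain ⟨N, hN, hN3, hNL⟩ := h
  obtain ⟨β, H, hV, hE, hI, hL⟩ := hNL.exists_endGraph (by rw [hN.1]; exact M.finite_E)
    (by rw [hN.1]; exact hLE)
  have hM : H.Realizes M := ⟨hN.1.symm.trans hE, fun I hIE => by
    rw [← hN.2, hI]; exact and_iff_right hIE⟩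
  refine ⟨hN.matroidAxioms, hN.unseparated_iff.2 hN3, ?_⟩
  by_cases h4 : H.V.card ≤ 4
  · left
    obtain ⟨C₀, hC₀, S₀, hS₀, C₁, hC₁, S₁, hS₁, C₂, hC₂, S₂, hS₂, C₃, hC₃, S₃, hS₃, c, hc⟩ :=
      EndGraph.exists_encodes_fewInc hV hM.1 h4
    exact ⟨C₀, hC₀, S₀, hS₀, C₁, hC₁, S₁, hS₁, C₂, hC₂, S₂, hS₂, C₃, hC₃, S₃, hS₃,
      hc.represents hL hM.2⟩
  · right
    have h5 : 5 ≤ H.V.card := by omega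
    have h3 := (EndGraph.isNConnected_three_iff hI hE).1 hN3
    have hR : H.Robust := ⟨h3.twoConn hV h5, h3.three_le_deg hV h5, h5⟩
    obtain ⟨Z, hZ, P, hP, Ω, hΩ, R, hR', hc⟩ := hR.exists_encodes_manyInc hM
    exact ⟨Z, hZ, P, hP, Ω, hΩ, R, hR', hc.represents hL hM.2⟩

theorem theorem3p5 :
    ∃ (φ : MS0.Expr) (X : ℕ), φ.IsFormula ∧ φ.free = {X} ∧
      ∀ (α : Type*) (M : SetSystem α) (L : Set α), L ⊆ M.E →
        (MS0.SatAt M φ X L ↔ M.IsThreeConnectedRootedBicircular L) := by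
  obtain ⟨φ, X, h1, h2, h3⟩ := MS0.Definable.exists_formula (MS0.Definable.bicircularLoops (n := 1) (m := 0) 0)
  exact ⟨φ, X, h1, h2, fun α M L hL => (h3 α M L hL).trans
    ⟨fun h => h.isThreeConnectedRootedBicircular hL, fun h => h.bicircularLoops hL⟩⟩
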